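/- Let $q\in\mathbb R\setminus\{0\}$ and $n\ge 1$; sums over repeated indices are understood. **Quantum groups.** Let $R=R_n$ be the standard R-matrix $$R_n=q^{-1/n}\Big(q\sum_i E_{ii}\otimes E_{ii}+\sum_{i\ne j}E_{ii}\otimes E_{jj}+(q-q^{-1})\sum_{j>i}E_{ij}\otimes E_{ji}\Big).$$ Let $U_q(n)$ be the Hopf $*$-algebra over $\mathbb C$ generated by the entries $t^a_{\ b}$ ($1\le a,b\le n$) of a matrix $t$ and the entries of $t^\dagger$, where $(t^\dagger)^a_{\ b}=(t^b_{\ a})^*$, with relations $R^{ab}_{\ \ cd}t^c_{\ e}t^d_{\ f}=t^b_{\ d}t^a_{\ c}R^{cd}_{\ \ ef}$, $\;tt^\dagger=t^\dagger t=1$ and $\det_{q}\det_{q}^*=\det_q^*\det_q=1$. Here $\det_q=\nu^{-1}\varepsilon_{a_1\dots a_n}t^{a_1}_{\ b_1}\cdots t^{a_n}_{\ b_n}\varepsilon^{b_n\dots b_1}$, $\nu=\varepsilon_{a_1\dots a_n}\varepsilon^{a_n\dots a_1}$, and $\varepsilon_{a_1\dots a_n}=\varepsilon^{a_1\dots a_n}$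 is $(-q)^{\text{length}}$ on permutations of $1,\dots,n$ and $0$ on all other words. The structure maps are determined by $\Delta t^a_{\ b}=t^a_{\ c}\otimes t^c_{\ b}$, $\epsilon(t^a_{\ b})=\delta^a_b$, $S(t)=t^\dagger$. For $n=1$ this is $U_q(1)=\mathbb C[z,z^{-1}]$ with $z=t^1_{\ 1}$, $z^*=z^{-1}$; put $U_q(0)=\mathbb C$. For $m\ge1$ let $\alpha_m,\alpha_m':U_q(m)\to U_q(m-1)$ be the $*$-Hopf algebra morphisms given as follows: $\alpha_m$ sends $t^1_{\ 1}\mapsto 1$, $t^1_{\ i},t^i_{\ 1}\mapsto 0$ for $i>1$, and $t^{i}_{\ j}\mapsto t^{i-1}_{\ j-1}$ for $i,j>1$; $\alpha'_m$ sends $t^m_{\ m}\mapsto 1$, $t^m_{\ i},t^i_{\ m}\mapsto0$ for $i<m$, and $t^i_{\ j}\mapsto t^i_{\ j}$ for $i,j<m$. Put $$\alpha_{1,n}=\big((\alpha_2\circ\dots\circ\alpha_n)\otimes\alpha_n'\big)\circ\Delta:\;U_q(n)\to U_q(1)\otimes U_q(n-1).$$ **Complex projective quantum space.** Let $\lambda=q\cdot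 q^{-1/n}$ and $\widetilde R=((R^{t_2})^{-1})^{t_2}$, with $t_2$ the transposition in the second tensor factor. The quantum sphere $S_q^{2n-1}$ is the $*$-algebra with generators $v^i,x_i$ ($1\le i\le n$), $x_i^*=v^i$, and relations $$v^iv^j=\lambda^{-1}R^{ij}_{\ \ kl}v^lv^k,\quad x_ix_j=\lambda^{-1}x_lx_kR^{kl}_{\ \ ij},\quad x_iv^j=\lambda\widetilde R^{lj}_{\ \ ik}v^kx_l,\quad v^ag_a^{\ b}x_b=1,$$ where $g_a^{\ b}=\lambda\widetilde R^{bc}_{\ \ ca}$. Then $\mathbb{CP}_q^{n-1}=(S_q^{2n-1})^{U_q(1)}$ is the $*$-subalgebra of elements $u$ with $\rho(u)=u\otimes1$ for the $*$-coaction $\rho:S_q^{2n-1}\to S_q^{2n-1}\otimes U_q(1)$, $\rho(x_i)=x_i\otimes z$, $\rho(v^i)=v^i\otimes z^*$. **Quantum principal bundles.** Let $A$ be a Hopf algebra, $P$ an algebra, $\beta:P\to A\otimes P$ a linear map and $B\subseteq P$ a subalgebra. Then $P$ is a quantum principal bundle (with the universal calculus) with structure quantum group $A$, base $B$ and coaction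 $\beta$ if $\beta$ makes $P$ a left $A$-comodule algebra; $B=P^A=\{u\in P:\beta(u)=1\otimes u\}$; the map $\chi:P\otimes P\to A\otimes P$, $\chi(u\otimes v)=\beta(u)(1\otimes v)$, is surjective (freeness); and $\ker\chi\cap\Gamma_P=P\,\Gamma_B\,P$ (exactness), where $\Gamma_X=\ker(\cdot:X\otimes X\to X)$. **Theorem.** The Hopf algebra $U_q(n)$ is a quantum principal bundle with structure quantum group $U_q(1)\otimes U_q(n-1)$, coaction $(\alpha_{1,n}\otimes\mathrm{id})\circ\Delta$ and base $U_q(n)^{U_q(1)\otimes U_q(n-1)}$. Moreover the base is complex projective quantum space: there is a $*$-algebra morphism $\iota:S_q^{2n-1}\to U_q(n)$ with $\iota(x_a)=t^n_{\ a}$ for all $a$, and it restricts to a $*$-algebra isomorphism $$\mathbb{CP}_q^{n-1}\;\cong\;U_q(n)^{U_q(1)\otimes U_q(n-1)}.$$ -/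

import Mathlib

open scoped TensorProduct

noncomputable section

namespace QuantumProjective

open MulOpposite

/-- The complex number `q^(-1/n)`. -/
def normFactor (q : ℝˣ) (n : ℕ) : ℂ := (((q : ℝ) : ℂ)) ^ (-(1 : ℂ) / (n : ℂ))

/-- The standard R-matrix, `R (a, b) (c, d) = R^{ab}_{cd}`. The three cases of the entry are the
three sums `q ∑ E_ii ⊗ E_ii`, `∑_{i ≠ j} E_ii ⊗ E_jj` and `(q - q⁻¹) ∑_{i < j} E_ij ⊗ E_ji`. -/
def Rmat (q : ℝˣ) (n : ℕ) : Matrix (Fin n × Fin n) (Fin n × Fin n) ℂ :=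
  Matrix.of fun x y => normFactor q n *
    (if x.1 = y.1 ∧ x.2 = y.2 then (if x.1 = x.2 then ((q : ℝ) : ℂ) else 1)
     else if x.1 = y.2 ∧ x.2 = y.1 ∧ x.1 < x.2 then ((q : ℝ) : ℂ) - ((q : ℝ) : ℂ)⁻¹ else 0)

/-- Transposition in the second tensor component. -/
def transposeSnd {n : ℕ} (M : Matrix (Fin n × Fin n) (Fin n × Fin n) ℂ) :
    Matrix (Fin n × Fin n) (Fin n × Fin n) ℂ :=
  Matrix.of fun x y => M (x.1, y.2) (y.1, x.2)

/-- `R~ = ((R^{t₂})⁻¹)^{t₂}`. -/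
def Rtilde (q : ℝˣ) (n : ℕ) : Matrix (Fin n × Fin n) (Fin n × Fin n) ℂ :=
  transposeSnd (transposeSnd (Rmat q n))⁻¹

/-- The normalisation factor `q^(1 - 1/n)`. -/
def lam (q : ℝˣ) (n : ℕ) : ℂ := ((q : ℝ) : ℂ) * normFactor q n

/-- The number of inversions of a word. -/
def inversions {n : ℕ} (a : Fin n → Fin n) : ℕ :=
  (Finset.univ.filter fun p : Fin n × Fin n => p.1 < p.2 ∧ a p.2 < a p.1).card

/-- The q-epsilon tensor `ε_{a₁…aₙ} = ε^{a₁…aₙ}`: it is `(-q)^(length of a)` if the word `a` is a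
permutation of `1, …, n`, and zero otherwise. -/
def eps (q : ℝˣ) {n : ℕ} (a : Fin n → Fin n) : ℂ :=
  if Function.Injective a then (-((q : ℝ) : ℂ)) ^ inversions a else 0

/-- `ν = ε_{a₁…aₙ} ε^{aₙ…a₁}` (summed). -/
def nu (q : ℝˣ) (n : ℕ) : ℂ := ∑ a : Fin n → Fin n, eps q a * eps q (a ∘ Fin.rev)

section families

variable {A : Type*} [Ring A] [Algebra ℂ A] {n : ℕ}

/-- The quantum determinant `ν⁻¹ ε_{a₁…aₙ} t^{a₁}_{b₁} … t^{aₙ}_{bₙ} ε^{bₙ…b₁}` of a matrix `t` of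
elements of an algebra (`t a b = t^a_b`). -/
def qdet (q : ℝˣ) (t : Fin n → Fin n → A) : A :=
  (nu q n)⁻¹ • ∑ a : Fin n → Fin n, ∑ b : Fin n → Fin n,
    (eps q a * eps q (b ∘ Fin.rev)) • (List.ofFn fun i => t (a i) (b i)).prod

/-- The adjoint of the quantum determinant, as a polynomial in the entries `s^b_a = (t^a_b)^*`:
all products are reversed and the coefficients, being real, are unchanged. -/
def qdetStar (q : ℝˣ) (s : Fin n → Fin n → A) : A :=
  (nu q n)⁻¹ • ∑ a : Fin n → Fin n, ∑ b : Fin n → Fin n,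
    (eps q a * eps q (b ∘ Fin.rev)) • (List.ofFn fun i => s (b i) (a i)).reverse.prod

/-- Matrices `t` and `s` of elements of an algebra satisfy `R t₁ t₂ = t₂ t₁ R`, and `s` is the
inverse matrix of `t`. -/
structure IsFRT (q : ℝˣ) (t s : Fin n → Fin n → A) : Prop where
  rtt : ∀ a b e f, ∑ c, ∑ d, Rmat q n (a, b) (c, d) • (t c e * t d f) =
    ∑ c, ∑ d, Rmat q n (c, d) (e, f) • (t b d * t a c)
  ts : ∀ i j, ∑ k, t i k * s k j = if i = j then 1 else 0
  st : ∀ i j, ∑ k, s i k * t k j = if i = j then 1 else 0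

/-- `R t₁ t₂ = t₂ t₁ R` written out, without the normalisation of `R`. -/
def RTT (q : ℝˣ) (t : Fin n → Fin n → A) : Prop := ∀ a b e f,
    (if a = b then ((q : ℝ) : ℂ) else 1) • (t a e * t b f) +
      (if a < b then ((q : ℝ) : ℂ) - ((q : ℝ) : ℂ)⁻¹ else 0) • (t b e * t a f) =
    (if e = f then ((q : ℝ) : ℂ) else 1) • (t b f * t a e) +
      (if f < e then ((q : ℝ) : ℂ) - ((q : ℝ) : ℂ)⁻¹ else 0) • (t b e * t a f)

lemma q_ne (q : ℝˣ) : ((q : ℝ) : ℂ) ≠ 0 := by exact_mod_cast q.ne_zero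

lemma normFactor_ne (q : ℝˣ) (n : ℕ) : normFactor q n ≠ 0 := by
  unfold normFactor; rw [Ne, Complex.cpow_eq_zero_iff]; simp

lemma sum_Rmat_left (q : ℝˣ) (a b : Fin n) (X : Fin n → Fin n → A) :
    ∑ c, ∑ d, Rmat q n (a, b) (c, d) • X c d = normFactor q n •
      ((if a = b then ((q : ℝ) : ℂ) else 1) • X a b +
        (if a < b then ((q : ℝ) : ℂ) - ((q : ℝ) : ℂ)⁻¹ else 0) • X b a) := by
  have h : ∀ c d, Rmat q n (a, b) (c, d) • X c d =
      (if a = c then (if b = d then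
        (normFactor q n * (if a = b then ((q : ℝ) : ℂ) else 1)) • X c d else 0) else 0) +
      (if b = c then (if a = d then
        (normFactor q n * (if a < b then ((q : ℝ) : ℂ) - ((q : ℝ) : ℂ)⁻¹ else 0)) • X c d else 0)
        else 0) := by
    intro c d
    simp only [Rmat, Matrix.of_apply]
    split_ifs <;> first | (exfalso; grind) | simp
  simp only [h, Finset.sum_add_distrib, Finset.sum_ite_irrel, Finset.sum_const_zero,
    Finset.sum_ite_eq, Finset.mem_univ, if_true]
  simp only [smul_add, mul_smul]

lemma sum_Rmat_right (q : ℝˣ) (e f : Fin n) (X : Fin n → Fin n → A) :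
    ∑ c, ∑ d, Rmat q n (c, d) (e, f) • X c d = normFactor q n •
      ((if e = f then ((q : ℝ) : ℂ) else 1) • X e f +
        (if f < e then ((q : ℝ) : ℂ) - ((q : ℝ) : ℂ)⁻¹ else 0) • X f e) := by
  have h : ∀ c d, Rmat q n (c, d) (e, f) • X c d =
      (if e = c then (if f = d then
        (normFactor q n * (if e = f then ((q : ℝ) : ℂ) else 1)) • X c d else 0) else 0) +
      (if f = c then (if e = d then
        (normFactor q n * (if f < e then ((q : ℝ) : ℂ) - ((q : ℝ) : ℂ)⁻¹ else 0)) • X c d else 0)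
        else 0) := by
    intro c d
    simp only [Rmat, Matrix.of_apply]
    split_ifs <;> first | (exfalso; grind) | simp
  simp only [h, Finset.sum_add_distrib, Finset.sum_ite_irrel, Finset.sum_const_zero,
    Finset.sum_ite_eq, Finset.mem_univ, if_true]
  simp only [smul_add, mul_smul]

lemma rtt_iff (q : ℝˣ) (t : Fin n → Fin n → A) :
    (∀ a b e f, ∑ c, ∑ d, Rmat q n (a, b) (c, d) • (t c e * t d f) =
      ∑ c, ∑ d, Rmat q n (c, d) (e, f) • (t b d * t a c)) ↔ RTT q t := by
  unfold RTT
  refine forall_congr' fun a => forall_congr' fun b => forall_congr' fun e =>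
    forall_congr' fun f => ?_
  rw [sum_Rmat_left q a b (fun c d => t c e * t d f),
    sum_Rmat_right q e f (fun c d => t b d * t a c)]
  exact (smul_right_injective A (normFactor_ne q n)).eq_iff

end families
lemma inversions_swap {n : ℕ} {a : Fin n → Fin n} {i j : Fin n} (hij : i.val + 1 = j.val)
    (h : a i < a j) : inversions (a ∘ Equiv.swap i j) = inversions a + 1 := by
  have key : (Finset.univ.filter fun p : Fin n × Fin n =>
        p.1 < p.2 ∧ (a ∘ Equiv.swap i j) p.2 < (a ∘ Equiv.swap i j) p.1) =
      insert (i, j) ((Finset.univ.filter fun p : Fin n × Fin n =>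
        p.1 < p.2 ∧ a p.2 < a p.1).map
          ((Equiv.swap i j).prodCongr (Equiv.swap i j)).toEmbedding) := by
    ext ⟨x, y⟩
    have hne : i ≠ j := fun h => by simp [h] at hij
    simp only [Finset.mem_filter, Finset.mem_univ, true_and, Function.comp_apply,
      Finset.mem_insert, Prod.mk.injEq, Finset.mem_map_equiv, Equiv.prodCongr_symm,
      Equiv.symm_swap, Equiv.prodCongr_apply, Prod.map_apply]
    by_cases h1 : x = i ∧ y = j
    · obtain ⟨rfl, rfl⟩ := h1
      have h3 : x < y := by rw [Fin.lt_def]; omega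
      simp [h, h3]
    · by_cases h2 : x = j ∧ y = i
      · obtain ⟨rfl, rfl⟩ := h2
        have : ¬ x < y := by rw [Fin.lt_def]; omega
        simp [this, hne.symm, not_lt.mpr h.le]
      · have : x < y ↔ Equiv.swap i j x < Equiv.swap i j y := by
          rw [Equiv.swap_apply_def, Equiv.swap_apply_def]
          split_ifs <;> simp only [Fin.ext_iff, Fin.lt_def] at * <;> omega
        rw [← this]; simp [h1]
  unfold inversions
  rw [key, Finset.card_insert_of_notMem, Finset.card_map]
  have : ¬ j < i := by rw [Fin.lt_def]; omega
  simp [this]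

lemma eps_swap (q : ℝˣ) {n : ℕ} {a : Fin n → Fin n} {i j : Fin n} (hij : i.val + 1 = j.val)
    (h : a i < a j) : eps q (a ∘ Equiv.swap i j) = -((q : ℝ) : ℂ) * eps q a := by
  unfold eps
  rw [inversions_swap hij h]
  simp only [(Equiv.swap i j).injective_comp]
  split_ifs <;> simp [pow_succ, mul_comm]

lemma eps_zero (q : ℝˣ) {n : ℕ} {a : Fin n → Fin n} {i j : Fin n} (hij : i ≠ j)
    (h : a i = a j) : eps q a = 0 := by
  unfold eps
  rw [if_neg fun hi => hij (hi h)]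

/-- The weight `ε^{bₙ…b₁}`. -/
def revEps (q : ℝˣ) {n : ℕ} (b : Fin n → Fin n) : ℂ := eps q (b ∘ Fin.rev)

lemma revEps_swap (q : ℝˣ) {n : ℕ} {a : Fin n → Fin n} {i j : Fin n} (hij : i.val + 1 = j.val)
    (h : a i < a j) :
    revEps q (a ∘ Equiv.swap i j) = -((q : ℝ) : ℂ)⁻¹ * revEps q a := by
  have h1 : a ∘ Fin.rev =
      ((a ∘ Equiv.swap i j) ∘ Fin.rev) ∘ Equiv.swap (Fin.rev j) (Fin.rev i) := by
    funext x
    simp only [Function.comp_apply, Equiv.swap_apply_def]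
    congr 1
    by_cases hx : x = Fin.rev j
    · simp [hx]
    · by_cases hx' : x = Fin.rev i
      · have hne : i ≠ j := fun h => by simp [h] at hij
        subst hx'; simp [hne, hne.symm]
      · have e1 : Fin.rev x ≠ i := fun h => hx' (by rw [← h]; simp)
        have e2 : Fin.rev x ≠ j := fun h => hx (by rw [← h]; simp)
        simp [e1, e2, hx, hx']
  have h2 : revEps q a = -((q : ℝ) : ℂ) * revEps q (a ∘ Equiv.swap i j) := by
    unfold revEps
    conv_lhs => rw [h1]
    apply eps_swap
    · simp only [Fin.val_rev]; omega
    · simpa using h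
  rw [h2]
  have := q_ne q
  field_simp

lemma revEps_zero (q : ℝˣ) {n : ℕ} {a : Fin n → Fin n} {i j : Fin n} (hij : i ≠ j)
    (h : a i = a j) : revEps q a = 0 :=
  eps_zero q (i := Fin.rev i) (j := Fin.rev j) (by simpa using hij) (by simpa using h)

lemma revEps_id_ne (q : ℝˣ) (n : ℕ) : revEps q (id : Fin n → Fin n) ≠ 0 := by
  unfold revEps eps
  rw [if_pos (by simpa using Fin.rev_injective)]
  exact pow_ne_zero _ (neg_ne_zero.mpr (q_ne q))

lemma word_unique (q : ℝˣ) {n : ℕ} {M : Type*} [AddCommGroup M] [Module ℂ M]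
    (φ : (Fin n → Fin n) → M)
    (h0 : ∀ (i j : Fin n), i.val + 1 = j.val → ∀ a, a i = a j → φ a = 0)
    (h1 : ∀ (i j : Fin n), i.val + 1 = j.val → ∀ a, a i < a j →
      φ (a ∘ Equiv.swap i j) = (-((q : ℝ) : ℂ)⁻¹) • φ a) :
    ∃ D, ∀ a, φ a = revEps q a • D := by
  refine ⟨(revEps q (id : Fin n → Fin n))⁻¹ • φ id, ?_⟩
  intro a
  induction hk : inversions a using Nat.strong_induction_on generalizing a with
  | _ k ih =>
    by_cases hex : ∃ i j : Fin n, i.val + 1 = j.val ∧ a j ≤ a i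
    · obtain ⟨i, j, hij, hle⟩ := hex
      have hne : i ≠ j := fun h => by simp [h] at hij
      rcases hle.eq_or_lt with he | hl
      · rw [h0 i j hij a he.symm, revEps_zero q hne he.symm, zero_smul]
      · have hb : (a ∘ Equiv.swap i j) i < (a ∘ Equiv.swap i j) j := by simpa using hl
        have haa : a = (a ∘ Equiv.swap i j) ∘ Equiv.swap i j := by
          funext x; simp
        have hinv := inversions_swap hij hb
        rw [← haa] at hinv
        have := ih (inversions (a ∘ Equiv.swap i j)) (by omega) _ rfl
        rw [haa, h1 i j hij _ hb, revEps_swap q hij hb, this, smul_smul]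
    · push Not at hex
      have hm : StrictMono a := by
        cases n with
        | zero => exact fun x => x.elim0
        | succ m => exact Fin.strictMono_iff_lt_succ.mpr fun i => hex _ _ (by simp)
      have : a = id := by
        funext i
        exact le_antisymm (hm.apply_le) (hm.le_apply)
      rw [this, smul_smul, mul_inv_cancel₀ (revEps_id_ne q n), one_smul]

lemma nu_ne (q : ℝˣ) (n : ℕ) : nu q n ≠ 0 := by
  obtain ⟨D, hD⟩ := word_unique q (n := n) (fun a => (eps q a)⁻¹)
    (fun i j hij a h => by
      rw [eps_zero q (fun h => by simp [h] at hij) h, inv_zero])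
    (fun i j hij a h => by
      rw [eps_swap q hij h]; simp [inv_neg, mul_comm])
  have h : nu q n * D = ((Finset.univ.filter fun a : Fin n → Fin n =>
      eps q a ≠ 0).card : ℂ) := by
    unfold nu
    rw [Finset.sum_mul, Finset.card_filter, Nat.cast_sum]
    refine Finset.sum_congr rfl fun a _ => ?_
    have := hD a
    simp only [smul_eq_mul, revEps] at this
    rw [mul_assoc, ← this]
    by_cases h : eps q a = 0 <;> simp [h]
  intro h0
  rw [h0, zero_mul, eq_comm, Nat.cast_eq_zero, Finset.card_eq_zero,
    Finset.filter_eq_empty_iff] at h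
  apply h (Finset.mem_univ id)
  unfold eps
  rw [if_pos Function.injective_id]
  exact pow_ne_zero _ (neg_ne_zero.mpr (q_ne q))

lemma sum_revEps_sq_ne (q : ℝˣ) (n : ℕ) :
    ∑ a : Fin n → Fin n, revEps q a * revEps q a ≠ 0 := by
  classical
  have hre : ∀ a : Fin n → Fin n, ∃ r : ℝ, revEps q a = r := by
    intro a
    unfold revEps eps
    split_ifs
    · exact ⟨(-(q : ℝ)) ^ inversions (a ∘ Fin.rev), by push_cast; rfl⟩
    · exact ⟨0, by simp⟩
  choose r hr using hre
  simp only [hr]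
  have : r id ≠ 0 := fun h => revEps_id_ne q n (by rw [hr, h]; simp)
  have hpos : 0 < ∑ a, r a * r a :=
    Finset.sum_pos' (fun a _ => mul_self_nonneg _) ⟨id, Finset.mem_univ _, mul_self_pos.mpr this⟩
  exact_mod_cast hpos.ne'

section words

variable {A : Type*} [Ring A] [Algebra ℂ A] {n : ℕ}

lemma prod_ofFn_adj {m : ℕ} (f : Fin m → A) (i j : Fin m) (hij : i.val + 1 = j.val) :
    ∃ P Q : A, ∀ x y, (List.ofFn (Function.update (Function.update f i x) j y)).prod =
      P * x * y * Q := by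
  induction m with
  | zero => exact i.elim0
  | succ m ih =>
    cases j using Fin.cases with
    | zero => simp at hij
    | succ j =>
      cases i using Fin.cases with
      | zero =>
        cases m with
        | zero => exact j.elim0
        | succ m =>
          have : j = 0 := by ext; simpa using hij.symm
          subst this
          refine ⟨1, (List.ofFn fun k : Fin m => f k.succ.succ).prod, fun x y => ?_⟩
          rw [List.ofFn_succ, List.ofFn_succ]
          have h0 : (0 : Fin (m + 2)) ≠ Fin.succ 0 := by simp [Fin.ext_iff]
          have hk : ∀ k : Fin m, k.succ.succ ≠ (Fin.succ 0 : Fin (m + 2)) := by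
            intro k; simp [Fin.ext_iff]
          have hk' : ∀ k : Fin m, k.succ.succ ≠ (0 : Fin (m + 2)) := by
            intro k; simp [Fin.ext_iff]
          simp only [List.prod_cons, Function.update_self, Function.update_of_ne h0,
            Function.update_of_ne (hk _), Function.update_of_ne (hk' _), one_mul, mul_assoc]
      | succ i =>
        obtain ⟨P, Q, h⟩ := ih (fun k => f k.succ) i j (by simpa using hij)
        refine ⟨f 0 * P, Q, fun x y => ?_⟩
        rw [List.ofFn_succ, List.prod_cons]
        have e : (fun k : Fin m => Function.update (Function.update f i.succ x) j.succ y k.succ) =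
            Function.update (Function.update (fun k => f k.succ) i x) j y := by
          funext k
          simp [Function.update_apply]
        rw [e, h, Function.update_of_ne (by simp [Fin.ext_iff]),
          Function.update_of_ne (by simp [Fin.ext_iff])]
        simp only [mul_assoc]

lemma RTT.transpose {q : ℝˣ} {t : Fin n → Fin n → A} (h : RTT q t) :
    RTT q (fun a b => t b a) := by
  intro a b e f
  have := h f e b a
  rw [eq_comm] at this
  simpa only [eq_comm (a := b) (b := a), eq_comm (a := f) (b := e)] using this

lemma sum_word (q : ℝˣ) {t : Fin n → Fin n → A} (ht : RTT q t) :
    ∃ D, ∀ a : Fin n → Fin n,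
      ∑ b : Fin n → Fin n, revEps q b • (List.ofFn fun i => t (a i) (b i)).prod =
        revEps q a • D := by
  have hq := q_ne q
  have two : ∀ x : A, x + x = 0 → x = 0 := by
    intro x hx
    have : (2 : ℂ) • x = 0 := by rw [two_smul]; exact hx
    exact (smul_eq_zero.mp this).resolve_left two_ne_zero
  -- a function on words that is antisymmetric under an adjacent swap has zero sum
  have anti : ∀ (g : (Fin n → Fin n) → A) (i j : Fin n), i.val + 1 = j.val →
      (∀ b, b i = b j → g b = 0) → (∀ b, b i < b j → g b + g (b ∘ Equiv.swap i j) = 0) →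
      ∑ b, g b = 0 := by
    intro g i j hij hz hl
    have e : ∑ b, g b = ∑ b, g (b ∘ Equiv.swap i j) :=
      (Equiv.sum_comp ((Equiv.swap i j).arrowCongr (Equiv.refl (Fin n))) g).symm
    apply two
    conv_lhs => rw [e]
    conv_lhs => arg 2; rw [← e]
    rw [← Finset.sum_add_distrib]
    refine Finset.sum_eq_zero fun b _ => ?_
    rcases lt_trichotomy (b i) (b j) with h | h | h
    · rw [add_comm]; exact hl b h
    · rw [hz b h, hz _ (by simpa using h.symm), add_zero]
    · have := hl (b ∘ Equiv.swap i j) (by simpa using h)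
      have hb : (b ∘ Equiv.swap i j) ∘ Equiv.swap i j = b := by funext x; simp
      rwa [hb] at this
  have upd : ∀ (i j : Fin n), i ≠ j → ∀ (a b a' b' : Fin n → Fin n),
      (∀ k, k ≠ i → k ≠ j → a' k = a k) → (∀ k, k ≠ i → k ≠ j → b' k = b k) →
      (fun k => t (a' k) (b' k)) = Function.update (Function.update (fun k => t (a k) (b k)) i
        (t (a' i) (b' i))) j (t (a' j) (b' j)) := by
    intro i j hij a b a' b' ha hb
    funext k
    by_cases hk : k = j
    · subst hk; simp
    · by_cases hk' : k = i
      · subst hk'; simp [hk]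
      · simp [hk, hk', ha k hk' hk, hb k hk' hk]
  have sw : ∀ (i j : Fin n) (c : Fin n → Fin n) (k : Fin n), k ≠ i → k ≠ j →
      (c ∘ Equiv.swap i j) k = c k := by
    intro i j c k h1 h2
    simp [Equiv.swap_apply_of_ne_of_ne h1 h2]
  apply word_unique
  · intro i j hij a ha
    have hne : i ≠ j := fun h => by simp [h] at hij
    apply anti _ i j hij
    · intro b hb; rw [revEps_zero q hne hb, zero_smul]
    · intro b hb
      obtain ⟨P, Q, hPQ⟩ := prod_ofFn_adj (fun k => t (a k) (b k)) i j hij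
      rw [upd i j hne a b a b (fun _ _ _ => rfl) (fun _ _ _ => rfl),
        upd i j hne a b a (b ∘ Equiv.swap i j) (fun _ _ _ => rfl) (sw i j b), hPQ, hPQ,
        revEps_swap q hij hb]
      have := ht (a j) (a j) (b i) (b j)
      simp only [if_true, lt_irrefl, if_false, zero_smul, add_zero, hb.ne, not_lt.mpr hb.le,
        one_smul] at this
      simp only [ha, Function.comp_apply, Equiv.swap_apply_left, Equiv.swap_apply_right]
      rw [mul_assoc P, mul_assoc P (t (a j) (b j)), ← this]
      simp only [mul_smul_comm, smul_mul_assoc, smul_smul]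
      rw [← add_smul]
      convert zero_smul ℂ _
      field_simp
      ring
  · intro i j hij a ha
    have hne : i ≠ j := fun h => by simp [h] at hij
    rw [← sub_eq_zero, Finset.smul_sum, ← Finset.sum_sub_distrib]
    apply anti _ i j hij
    · intro b hb; rw [revEps_zero q hne hb]; simp
    · intro b hb
      obtain ⟨P, Q, hPQ⟩ := prod_ofFn_adj (fun k => t (a k) (b k)) i j hij
      rw [upd i j hne a b a b (fun _ _ _ => rfl) (fun _ _ _ => rfl),
        upd i j hne a b a (b ∘ Equiv.swap i j) (fun _ _ _ => rfl) (sw i j b),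
        upd i j hne a b (a ∘ Equiv.swap i j) b (sw i j a) (fun _ _ _ => rfl),
        upd i j hne a b (a ∘ Equiv.swap i j) (b ∘ Equiv.swap i j) (sw i j a) (sw i j b),
        hPQ, hPQ, hPQ, hPQ, revEps_swap q hij hb]
      have r1 := ht (a i) (a j) (b i) (b j)
      have r2 := ht (a i) (a j) (b j) (b i)
      simp only [if_true, if_false, zero_smul, add_zero, hb.ne, hb.ne', not_lt.mpr hb.le, hb,
        one_smul, ha.ne, ha] at r1 r2
      have r2' : t (a i) (b j) * t (a j) (b i) = t (a j) (b i) * t (a i) (b j) := by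
        simpa using r2
      have r1' : t (a j) (b j) * t (a i) (b i) = t (a i) (b i) * t (a j) (b j) +
        (((q : ℝ) : ℂ) - ((q : ℝ) : ℂ)⁻¹) • (t (a j) (b i) * t (a i) (b j)) := r1.symm
      simp only [Function.comp_apply, Equiv.swap_apply_left, Equiv.swap_apply_right]
      simp only [mul_assoc P, r2', r1', mul_add, add_mul, mul_smul_comm, smul_mul_assoc]
      match_scalars <;> (field_simp; ring)

lemma sum_t_s {t s : Fin n → Fin n → A}
    (ts : ∀ i j, ∑ k, t i k * s k j = if i = j then 1 else 0) {m : ℕ} (a c : Fin m → Fin n) :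
    ∑ b : Fin m → Fin n, (List.ofFn fun i => t (a i) (b i)).prod *
      (List.ofFn fun i => s (b i) (c i)).reverse.prod = if a = c then 1 else 0 := by
  induction m with
  | zero => simp [Subsingleton.elim a c]
  | succ m ih =>
    rw [← (Fin.consEquiv fun _ => Fin n).sum_comp, Fintype.sum_prod_type]
    simp only [Fin.consEquiv_apply, List.ofFn_succ, Fin.cons_zero, Fin.cons_succ,
      List.prod_cons, List.reverse_cons, List.prod_append, List.prod_nil, mul_one]
    have : ∀ x : Fin n, ∑ y : Fin m → Fin n,
        t (a 0) x * (List.ofFn fun i => t (a i.succ) (y i)).prod *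
          ((List.ofFn fun i => s (y i) (c i.succ)).reverse.prod * s x (c 0)) =
        if (fun i : Fin m => a i.succ) = (fun i => c i.succ) then t (a 0) x * s x (c 0) else 0 := by
      intro x
      have e := congrArg (fun z => t (a 0) x * z * s x (c 0))
        (ih (fun i => a i.succ) (fun i => c i.succ))
      simp only [Finset.mul_sum, Finset.sum_mul] at e
      simp only [mul_assoc] at e ⊢
      rw [e]
      split_ifs <;> simp
    simp only [this, Finset.sum_ite_irrel, Finset.sum_const_zero, ts]
    have hac : a = c ↔ (fun i : Fin m => a i.succ) = (fun i => c i.succ) ∧ a 0 = c 0 := by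
      constructor
      · rintro rfl; exact ⟨rfl, rfl⟩
      · rintro ⟨h1, h2⟩
        funext i
        cases i using Fin.cases with
        | zero => exact h2
        | succ i => exact congrFun h1 i
    rw [← ite_and]
    simp only [hac]

lemma sum_s_t {t s : Fin n → Fin n → A}
    (st : ∀ i j, ∑ k, s i k * t k j = if i = j then 1 else 0) {m : ℕ} (c b : Fin m → Fin n) :
    ∑ a : Fin m → Fin n, (List.ofFn fun i => s (c i) (a i)).reverse.prod *
      (List.ofFn fun i => t (a i) (b i)).prod = if c = b then 1 else 0 := by
  induction m with
  | zero => simp [Subsingleton.elim c b]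
  | succ m ih =>
    rw [← (Fin.consEquiv fun _ => Fin n).sum_comp, Fintype.sum_prod_type, Finset.sum_comm]
    simp only [Fin.consEquiv_apply, List.ofFn_succ, Fin.cons_zero, Fin.cons_succ,
      List.prod_cons, List.reverse_cons, List.prod_append, List.prod_nil, mul_one]
    have : ∀ y : Fin m → Fin n, ∑ x : Fin n,
        (List.ofFn fun i => s (c i.succ) (y i)).reverse.prod * s (c 0) x *
          (t x (b 0) * (List.ofFn fun i => t (y i) (b i.succ)).prod) =
        if c 0 = b 0 then (List.ofFn fun i => s (c i.succ) (y i)).reverse.prod *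
          (List.ofFn fun i => t (y i) (b i.succ)).prod else 0 := by
      intro y
      have e := congrArg (fun z => (List.ofFn fun i => s (c i.succ) (y i)).reverse.prod * z *
        (List.ofFn fun i => t (y i) (b i.succ)).prod) (st (c 0) (b 0))
      simp only [Finset.mul_sum, Finset.sum_mul] at e
      simp only [mul_assoc] at e ⊢
      rw [e]
      split_ifs <;> simp
    simp only [this, Finset.sum_ite_irrel, Finset.sum_const_zero,
      ih (fun i => c i.succ) (fun i => b i.succ)]
    have hac : c = b ↔ c 0 = b 0 ∧ (fun i : Fin m => c i.succ) = (fun i => b i.succ) := by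
      constructor
      · rintro rfl; exact ⟨rfl, rfl⟩
      · rintro ⟨h2, h1⟩
        funext i
        cases i using Fin.cases with
        | zero => exact h2
        | succ i => exact congrFun h1 i
    rw [← ite_and]
    simp only [hac]

/-- The relations `R t₁ t₂ = t₂ t₁ R` and `t s = s t = 1` force the quantum determinant to be
unitary. -/
lemma IsFRT.det {q : ℝˣ} {t s : Fin n → Fin n → A} (h : IsFRT q t s) :
    qdet q t * qdetStar q s = 1 ∧ qdetStar q s * qdet q t = 1 := by
  have hR := (rtt_iff q t).mp h.rtt
  obtain ⟨D, hD⟩ := sum_word q hR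
  obtain ⟨D', hD'⟩ := sum_word q hR.transpose
  have hnu := nu_ne q n
  have hDD : D = D' := by
    have e1 : (∑ a : Fin n → Fin n, revEps q a * revEps q a) • D =
        (∑ a : Fin n → Fin n, revEps q a * revEps q a) • D' := by
      rw [Finset.sum_smul, Finset.sum_smul]
      simp only [mul_smul, ← hD, ← hD', Finset.smul_sum]
      rw [Finset.sum_comm]
      refine Finset.sum_congr rfl fun a _ => Finset.sum_congr rfl fun b _ => ?_
      rw [smul_smul, smul_smul, mul_comm]
    exact smul_right_injective A (sum_revEps_sq_ne q n) e1
  have hdet : qdet q t = D := by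
    unfold qdet
    have : ∀ a : Fin n → Fin n, ∑ b : Fin n → Fin n,
        (eps q a * eps q (b ∘ Fin.rev)) • (List.ofFn fun i => t (a i) (b i)).prod =
        (eps q a * eps q (a ∘ Fin.rev)) • D := by
      intro a
      simp only [mul_smul]
      rw [← Finset.smul_sum]
      congr 1
      exact hD a
    simp only [this]
    rw [← Finset.sum_smul, smul_smul]
    change ((nu q n)⁻¹ * nu q n) • D = D
    rw [inv_mul_cancel₀ hnu, one_smul]
  have hr : D * qdetStar q s = 1 := by
    have key : ∀ c : Fin n → Fin n, D * ∑ b : Fin n → Fin n, revEps q b •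
        (List.ofFn fun i => s (b i) (c i)).reverse.prod = revEps q c • 1 := by
      intro c
      have : ∀ b : Fin n → Fin n, D * (revEps q b •
          (List.ofFn fun i => s (b i) (c i)).reverse.prod) =
          ∑ a : Fin n → Fin n, revEps q a • ((List.ofFn fun i => t (a i) (b i)).prod *
            (List.ofFn fun i => s (b i) (c i)).reverse.prod) := by
        intro b
        rw [mul_smul_comm, ← smul_mul_assoc, hDD, ← hD' b, Finset.sum_mul]
        simp only [smul_mul_assoc]
      rw [Finset.mul_sum]
      simp only [this]
      rw [Finset.sum_comm]
      simp only [← Finset.smul_sum, sum_t_s h.ts]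
      simp
    unfold qdetStar
    rw [mul_smul_comm, Finset.mul_sum]
    have : ∀ a : Fin n → Fin n, D * ∑ b : Fin n → Fin n,
        (eps q a * eps q (b ∘ Fin.rev)) • (List.ofFn fun i => s (b i) (a i)).reverse.prod =
        (eps q a * eps q (a ∘ Fin.rev)) • 1 := by
      intro a
      simp only [mul_smul]
      rw [← Finset.smul_sum, mul_smul_comm]
      congr 1
      exact key a
    simp only [this]
    rw [← Finset.sum_smul, smul_smul]
    change ((nu q n)⁻¹ * nu q n) • (1 : A) = 1
    rw [inv_mul_cancel₀ hnu, one_smul]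
  have hl : ∃ E, E * D = 1 := by
    have key : ∀ c : Fin n → Fin n, (∑ a : Fin n → Fin n, revEps q a •
        (List.ofFn fun i => s (c i) (a i)).reverse.prod) * D = revEps q c • 1 := by
      intro c
      have : ∀ a : Fin n → Fin n, (revEps q a •
          (List.ofFn fun i => s (c i) (a i)).reverse.prod) * D =
          ∑ b : Fin n → Fin n, revEps q b • ((List.ofFn fun i => s (c i) (a i)).reverse.prod *
            (List.ofFn fun i => t (a i) (b i)).prod) := by
        intro a
        rw [smul_mul_assoc, ← mul_smul_comm, ← hD a, Finset.mul_sum]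
        simp only [mul_smul_comm]
      rw [Finset.sum_mul]
      simp only [this]
      rw [Finset.sum_comm]
      simp only [← Finset.smul_sum, sum_s_t h.st]
      simp
    refine ⟨(revEps q (id : Fin n → Fin n))⁻¹ • ∑ a : Fin n → Fin n, revEps q a •
        (List.ofFn fun i => s (id i) (a i)).reverse.prod, ?_⟩
    rw [smul_mul_assoc, key, smul_smul, inv_mul_cancel₀ (revEps_id_ne q n), one_smul]
  obtain ⟨E, hE⟩ := hl
  have : E = qdetStar q s := by
    calc E = E * (D * qdetStar q s) := by rw [hr, mul_one]
      _ = qdetStar q s := by rw [← mul_assoc, hE, one_mul]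
  rw [hdet]
  exact ⟨hr, this ▸ hE⟩

end words

section families

variable {A : Type*} [Ring A] [Algebra ℂ A] {n : ℕ} {q : ℝˣ} {t s : Fin n → Fin n → A}

lemma IsFRT.ts_exchange (h : IsFRT q t s) (a c e g : Fin n) :
    (if c = e then ((q : ℝ) : ℂ) else 1) • (s a e * t c g) +
      (if c = e then ((q : ℝ) : ℂ) - ((q : ℝ) : ℂ)⁻¹ else 0) •
        ∑ b, (if c < b then s a b * t b g else 0) =
    (if g = a then ((q : ℝ) : ℂ) else 1) • (t c g * s a e) +
      (if g = a then ((q : ℝ) : ℂ) - ((q : ℝ) : ℂ)⁻¹ else 0) •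
        ∑ d, (if d < g then t c d * s d e else 0) := by
  have hR := (rtt_iff q t).mp h.rtt
  have key : ∑ B, ∑ F, s a B * ((if c = B then ((q : ℝ) : ℂ) else 1) • (t c g * t B F) +
      (if c < B then ((q : ℝ) : ℂ) - ((q : ℝ) : ℂ)⁻¹ else 0) • (t B g * t c F)) * s F e =
      ∑ B, ∑ F, s a B * ((if g = F then ((q : ℝ) : ℂ) else 1) • (t B F * t c g) +
      (if F < g then ((q : ℝ) : ℂ) - ((q : ℝ) : ℂ)⁻¹ else 0) • (t B g * t c F)) * s F e :=
    Finset.sum_congr rfl fun B _ => Finset.sum_congr rfl fun F _ => by rw [hR c B g F]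
  have l1 : ∀ B, ∑ F, s a B * ((if c = B then ((q : ℝ) : ℂ) else 1) • (t c g * t B F) +
      (if c < B then ((q : ℝ) : ℂ) - ((q : ℝ) : ℂ)⁻¹ else 0) • (t B g * t c F)) * s F e =
      (if c = B then ((q : ℝ) : ℂ) else 1) • (s a B * t c g * ∑ F, t B F * s F e) +
      (if c < B then ((q : ℝ) : ℂ) - ((q : ℝ) : ℂ)⁻¹ else 0) •
        (s a B * t B g * ∑ F, t c F * s F e) := by
    intro B
    simp only [Finset.mul_sum, Finset.smul_sum, ← Finset.sum_add_distrib]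
    refine Finset.sum_congr rfl fun F _ => ?_
    simp only [mul_add, add_mul, mul_smul_comm, smul_mul_assoc, mul_assoc]
  have l2 : ∀ F, ∑ B, s a B * ((if g = F then ((q : ℝ) : ℂ) else 1) • (t B F * t c g) +
      (if F < g then ((q : ℝ) : ℂ) - ((q : ℝ) : ℂ)⁻¹ else 0) • (t B g * t c F)) * s F e =
      (if g = F then ((q : ℝ) : ℂ) else 1) • ((∑ B, s a B * t B F) * (t c g * s F e)) +
      (if F < g then ((q : ℝ) : ℂ) - ((q : ℝ) : ℂ)⁻¹ else 0) •
        ((∑ B, s a B * t B g) * (t c F * s F e)) := by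
    intro F
    simp only [Finset.sum_mul, Finset.smul_sum, ← Finset.sum_add_distrib]
    refine Finset.sum_congr rfl fun F _ => ?_
    simp only [mul_add, add_mul, mul_smul_comm, smul_mul_assoc, mul_assoc]
  rw [Finset.sum_comm (f := fun B F => s a B * ((if g = F then ((q : ℝ) : ℂ) else 1) •
    (t B F * t c g) + (if F < g then ((q : ℝ) : ℂ) - ((q : ℝ) : ℂ)⁻¹ else 0) •
    (t B g * t c F)) * s F e)] at key
  simp only [l1, l2, h.ts, h.st, Finset.sum_add_distrib] at key
  simp only [mul_ite, ite_mul, mul_one, mul_zero, one_mul, zero_mul, smul_ite, smul_zero,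
    Finset.sum_ite_eq, Finset.sum_ite_eq', Finset.mem_univ, if_true] at key
  simp only [Finset.smul_sum]
  have e1 : ∀ x, (if c = e then ((q : ℝ) : ℂ) - ((q : ℝ) : ℂ)⁻¹ else 0) •
      (if c < x then s a x * t x g else 0) = if c = e then
        (if c < x then ((q : ℝ) : ℂ) - ((q : ℝ) : ℂ)⁻¹ else 0) • (s a x * t x g) else 0 := by
    intro x; split_ifs <;> simp
  have e2 : ∀ x, (if g = a then ((q : ℝ) : ℂ) - ((q : ℝ) : ℂ)⁻¹ else 0) •
      (if x < g then t c x * s x e else 0) = if a = g then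
        (if x < g then ((q : ℝ) : ℂ) - ((q : ℝ) : ℂ)⁻¹ else 0) • (t c x * s x e) else 0 := by
    intro x; simp only [eq_comm (a := a) (b := g)]; split_ifs <;> simp
  simp only [e1, e2]
  convert key using 2

lemma sum_lower (a : Fin n) (f : ℕ → ℂ) :
    ∑ d : Fin n, (if d < a then f d else 0) = ∑ d ∈ Finset.range a, f d := by
  have := Fin.sum_univ_eq_sum_range (fun d => if d < a.val then f d else 0) n
  simp only [Fin.lt_def]
  rw [this, ← Finset.sum_filter]
  congr 1
  ext x
  simp only [Finset.mem_filter, Finset.mem_range]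
  have := a.isLt
  omega

lemma sum_upper (a : Fin n) (f : ℕ → ℂ) :
    ∑ d : Fin n, (if a < d then f d else 0) =
      ∑ d ∈ Finset.range n, f d - ∑ d ∈ Finset.range (a + 1), f d := by
  have h : ∑ d : Fin n, (if a < d then f d else 0) + ∑ d : Fin n, (if d < a then f d else 0) +
      ∑ d : Fin n, (if a = d then f d else 0) = ∑ d : Fin n, f d := by
    rw [← Finset.sum_add_distrib, ← Finset.sum_add_distrib]
    refine Finset.sum_congr rfl fun d _ => ?_
    rcases lt_trichotomy a d with h | h | h
    · simp [h, h.ne, h.not_gt]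
    · simp [h]
    · simp [h, h.ne', h.not_gt]
  rw [sum_lower, Fin.sum_univ_eq_sum_range f n] at h
  simp only [Finset.sum_ite_eq, Finset.mem_univ, if_true] at h
  rw [Finset.sum_range_succ, ← h]
  ring

lemma geom_down (z : ℂ) (hz : z ≠ 0) (m : ℕ) :
    (z - z⁻¹) * ∑ d ∈ Finset.range m, z ^ (-2 * (d : ℤ)) = z - z * z ^ (-2 * (m : ℤ)) := by
  induction m with
  | zero => simp
  | succ m ih =>
    rw [Finset.sum_range_succ, mul_add, ih]
    have : z ^ (-2 * ((m + 1 : ℕ) : ℤ)) = z ^ (-2 * (m : ℤ)) * (z⁻¹ * z⁻¹) := by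
      rw [show (-2 * ((m + 1 : ℕ) : ℤ)) = -2 * (m : ℤ) + (-2) by push_cast; ring, zpow_add₀ hz, zpow_neg z 2, zpow_two, mul_inv]
    rw [this]; field_simp; ring

lemma geom_up (z : ℂ) (hz : z ≠ 0) (m : ℕ) :
    (z - z⁻¹) * ∑ d ∈ Finset.range m, z ^ (2 * (d : ℤ)) = z⁻¹ * z ^ (2 * (m : ℤ)) - z⁻¹ := by
  induction m with
  | zero => simp
  | succ m ih =>
    rw [Finset.sum_range_succ, mul_add, ih]
    have : z ^ (2 * ((m + 1 : ℕ) : ℤ)) = z ^ (2 * (m : ℤ)) * (z * z) := by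
      rw [show (2 * ((m + 1 : ℕ) : ℤ)) = 2 * (m : ℤ) + 2 by push_cast; ring, zpow_add₀ hz, zpow_two]
    rw [this]; field_simp; ring

lemma IsFRT.twisted_ts (h : IsFRT q t s) (d b : Fin n) :
    ∑ c : Fin n, (((q : ℝ) : ℂ) ^ (-2 * ((c : ℕ) : ℤ))) • (t c d * s b c) =
      if d = b then (((q : ℝ) : ℂ) ^ (-2 * ((d : ℕ) : ℤ))) • 1 else 0 := by
  have hz := q_ne q
  set z : ℂ := ((q : ℝ) : ℂ) with hzdef
  set Y : Fin n → Fin n → A := fun d b =>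
    ∑ c : Fin n, (z ^ (-2 * ((c : ℕ) : ℤ))) • (t c d * s b c) with hY
  have eqn : ∀ a g : Fin n, (if g = a then z else 1) • Y g a +
      (if g = a then z - z⁻¹ else 0) • ∑ d, (if d < g then Y d d else 0) =
      if a = g then z • 1 else 0 := by
    intro a g
    have hsum : ∑ c : Fin n, (z ^ (-2 * ((c : ℕ) : ℤ))) •
        ((if c = c then z else 1) • (s a c * t c g) + (if c = c then z - z⁻¹ else 0) •
          ∑ b, (if c < b then s a b * t b g else 0)) =
        ∑ c : Fin n, (z ^ (-2 * ((c : ℕ) : ℤ))) • ((if g = a then z else 1) • (t c g * s a c) +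
      (if g = a then z - z⁻¹ else 0) • ∑ d, (if d < g then t c d * s d c else 0)) :=
      Finset.sum_congr rfl fun c _ => by rw [h.ts_exchange a c c g]
    have hl : ∑ c : Fin n, (z ^ (-2 * ((c : ℕ) : ℤ))) •
        ((if c = c then z else 1) • (s a c * t c g) + (if c = c then z - z⁻¹ else 0) •
          ∑ b, (if c < b then s a b * t b g else 0)) = z • ∑ b, s a b * t b g := by
      simp only [if_true, smul_add, Finset.sum_add_distrib, Finset.smul_sum]
      rw [Finset.sum_comm (s := Finset.univ) (t := Finset.univ), ← Finset.sum_add_distrib]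
      refine Finset.sum_congr rfl fun b _ => ?_
      have : ∀ c : Fin n, z ^ (-2 * ((c : ℕ) : ℤ)) • (z - z⁻¹) •
          (if c < b then s a b * t b g else 0) =
          ((z - z⁻¹) * (if c < b then z ^ (-2 * ((c : ℕ) : ℤ)) else 0)) • (s a b * t b g) := by
        intro c; split_ifs <;> simp [smul_smul, mul_comm]
      simp only [this]
      rw [← Finset.sum_smul, ← Finset.mul_sum, sum_lower b (fun c => z ^ (-2 * (c : ℤ))),
        geom_down z hz, smul_smul, ← add_smul]
      congr 1; ring
    have hr : ∑ c : Fin n, (z ^ (-2 * ((c : ℕ) : ℤ))) •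
        ((if g = a then z else 1) • (t c g * s a c) +
      (if g = a then z - z⁻¹ else 0) • ∑ d, (if d < g then t c d * s d c else 0)) =
      (if g = a then z else 1) • Y g a +
      (if g = a then z - z⁻¹ else 0) • ∑ d, (if d < g then Y d d else 0) := by
      simp only [hY, smul_add, Finset.sum_add_distrib, Finset.smul_sum]
      congr 1
      · exact Finset.sum_congr rfl fun c _ => smul_comm _ _ _
      · rw [Finset.sum_comm (s := Finset.univ) (t := Finset.univ)]
        refine Finset.sum_congr rfl fun d _ => ?_
        by_cases hd : d < g
        · simp only [hd, if_true, Finset.smul_sum]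
          exact Finset.sum_congr rfl fun c _ => smul_comm _ _ _
        · simp [hd]
    rw [← hr, ← hsum, hl, h.st]
    split_ifs <;> simp
  have diag : ∀ a : Fin n, Y a a = (z ^ (-2 * ((a : ℕ) : ℤ))) • 1 := by
    intro a
    induction a using WellFoundedLT.induction with
    | _ a ih =>
      have e := eqn a a
      have : ∀ d : Fin n, (if d < a then Y d d else 0) =
          (if d < a then z ^ (-2 * ((d : ℕ) : ℤ)) else 0) • (1 : A) := by
        intro d
        by_cases hd : d < a
        · simp [hd, ih d hd]
        · simp [hd]
      simp only [this, if_true] at e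
      rw [← Finset.sum_smul, sum_lower a (fun c => z ^ (-2 * (c : ℤ))), smul_smul,
        geom_down z hz] at e
      have e' : z • Y a a = z • (z ^ (-2 * ((a : ℕ) : ℤ))) • (1 : A) := by
        rw [eq_sub_of_add_eq e, ← sub_smul, smul_smul]; congr 1; ring
      exact smul_right_injective A hz e'
  change Y d b = _
  by_cases hdb : d = b
  · subst hdb; simp [diag]
  · have e := eqn b d
    simpa [hdb, Ne.symm hdb] using e

lemma IsFRT.twisted_st (h : IsFRT q t s) (b d : Fin n) :
    ∑ a : Fin n, (((q : ℝ) : ℂ) ^ (2 * ((a : ℕ) : ℤ))) • (s a b * t d a) =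
      if b = d then (((q : ℝ) : ℂ) ^ (2 * ((b : ℕ) : ℤ))) • 1 else 0 := by
  have hz := q_ne q
  set z : ℂ := ((q : ℝ) : ℂ) with hzdef
  set Z : Fin n → Fin n → A := fun b d =>
    ∑ a : Fin n, (z ^ (2 * ((a : ℕ) : ℤ))) • (s a b * t d a) with hZ
  have eqn : ∀ c e : Fin n, (if c = e then z else 1) • Z e c +
      (if c = e then z - z⁻¹ else 0) • ∑ b, (if c < b then Z b b else 0) =
      if c = e then (z⁻¹ * z ^ (2 * (n : ℤ))) • 1 else 0 := by
    intro c e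
    have hsum : ∑ a : Fin n, (z ^ (2 * ((a : ℕ) : ℤ))) •
        ((if c = e then z else 1) • (s a e * t c a) + (if c = e then z - z⁻¹ else 0) •
          ∑ b, (if c < b then s a b * t b a else 0)) =
        ∑ a : Fin n, (z ^ (2 * ((a : ℕ) : ℤ))) • ((if a = a then z else 1) • (t c a * s a e) +
      (if a = a then z - z⁻¹ else 0) • ∑ d, (if d < a then t c d * s d e else 0)) :=
      Finset.sum_congr rfl fun a _ => by rw [h.ts_exchange a c e a]
    have hl : ∑ a : Fin n, (z ^ (2 * ((a : ℕ) : ℤ))) • ((if a = a then z else 1) • (t c a * s a e) +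
      (if a = a then z - z⁻¹ else 0) • ∑ d, (if d < a then t c d * s d e else 0)) =
      (z⁻¹ * z ^ (2 * (n : ℤ))) • ∑ d, t c d * s d e := by
      simp only [if_true, smul_add, Finset.sum_add_distrib, Finset.smul_sum]
      rw [Finset.sum_comm (s := Finset.univ) (t := Finset.univ), ← Finset.sum_add_distrib]
      refine Finset.sum_congr rfl fun b _ => ?_
      have : ∀ a : Fin n, z ^ (2 * ((a : ℕ) : ℤ)) • (z - z⁻¹) •
          (if b < a then t c b * s b e else 0) =
          ((z - z⁻¹) * (if b < a then z ^ (2 * ((a : ℕ) : ℤ)) else 0)) • (t c b * s b e) := by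
        intro a; split_ifs <;> simp [smul_smul, mul_comm]
      simp only [this]
      rw [← Finset.sum_smul, ← Finset.mul_sum, sum_upper b (fun c => z ^ (2 * (c : ℤ))),
        mul_sub, geom_up z hz, geom_up z hz, smul_smul, ← add_smul]
      congr 1
      have : z ^ (2 * ((b.val + 1 : ℕ) : ℤ)) = z ^ (2 * (b.val : ℤ)) * (z * z) := by
        rw [show (2 * ((b.val + 1 : ℕ) : ℤ)) = 2 * (b.val : ℤ) + 2 by push_cast; ring,
          zpow_add₀ hz, zpow_two]
      rw [this]
      field_simp
      ring
    have hr : ∑ a : Fin n, (z ^ (2 * ((a : ℕ) : ℤ))) •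
        ((if c = e then z else 1) • (s a e * t c a) + (if c = e then z - z⁻¹ else 0) •
          ∑ b, (if c < b then s a b * t b a else 0)) =
      (if c = e then z else 1) • Z e c +
      (if c = e then z - z⁻¹ else 0) • ∑ b, (if c < b then Z b b else 0) := by
      simp only [hZ, smul_add, Finset.sum_add_distrib, Finset.smul_sum]
      congr 1
      · exact Finset.sum_congr rfl fun c _ => smul_comm _ _ _
      · rw [Finset.sum_comm (s := Finset.univ) (t := Finset.univ)]
        refine Finset.sum_congr rfl fun d _ => ?_
        by_cases hd : c < d
        · simp only [hd, if_true, Finset.smul_sum]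
          exact Finset.sum_congr rfl fun c _ => smul_comm _ _ _
        · simp [hd]
    rw [← hr, hsum, hl, h.ts]
    split_ifs <;> simp
  have diag : ∀ a : Fin n, Z a a = (z ^ (2 * ((a : ℕ) : ℤ))) • 1 := by
    intro a
    induction a using WellFoundedGT.induction with
    | _ a ih =>
      have e := eqn a a
      have : ∀ d : Fin n, (if a < d then Z d d else 0) =
          (if a < d then z ^ (2 * ((d : ℕ) : ℤ)) else 0) • (1 : A) := by
        intro d
        by_cases hd : a < d
        · simp [hd, ih d hd]
        · simp [hd]
      simp only [this, if_true] at e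
      rw [← Finset.sum_smul, sum_upper a (fun c => z ^ (2 * (c : ℤ))), smul_smul,
        mul_sub, geom_up z hz, geom_up z hz] at e
      have e' : z • Z a a = z • (z ^ (2 * ((a : ℕ) : ℤ))) • (1 : A) := by
        have : z ^ (2 * ((a.val + 1 : ℕ) : ℤ)) = z ^ (2 * (a.val : ℤ)) * (z * z) := by
          rw [show (2 * ((a.val + 1 : ℕ) : ℤ)) = 2 * (a.val : ℤ) + 2 by push_cast; ring,
            zpow_add₀ hz, zpow_two]
        rw [eq_sub_of_add_eq e, ← sub_smul, smul_smul, this]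
        congr 1
        field_simp
        ring
      exact smul_right_injective A hz e'
  change Z b d = _
  by_cases hdb : b = d
  · subst hdb; simp [diag]
  · have e := eqn d b
    simpa [hdb, Ne.symm hdb] using e

lemma IsFRT.s_relation (h : IsFRT q t s) (a b e f : Fin n) :
    (if a = b then ((q : ℝ) : ℂ) else 1) • (s b f * s a e) +
      (if a < b then ((q : ℝ) : ℂ) - ((q : ℝ) : ℂ)⁻¹ else 0) • (s a f * s b e) =
    (if e = f then ((q : ℝ) : ℂ) else 1) • (s a e * s b f) +
      (if f < e then ((q : ℝ) : ℂ) - ((q : ℝ) : ℂ)⁻¹ else 0) • (s a f * s b e) := by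
  let R : Matrix (Fin n × Fin n) (Fin n × Fin n) A := (Rmat q n).map (algebraMap ℂ A)
  let M : Matrix (Fin n × Fin n) (Fin n × Fin n) A :=
    Matrix.of fun x y => t x.1 y.1 * t x.2 y.2
  let M' : Matrix (Fin n × Fin n) (Fin n × Fin n) A :=
    Matrix.of fun x y => s x.2 y.2 * s x.1 y.1
  let N : Matrix (Fin n × Fin n) (Fin n × Fin n) A :=
    Matrix.of fun x y => t x.2 y.2 * t x.1 y.1
  let N' : Matrix (Fin n × Fin n) (Fin n × Fin n) A :=
    Matrix.of fun x y => s x.1 y.1 * s x.2 y.2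
  have hRM : R * M = N * R := by
    ext ⟨a, b⟩ ⟨e, f⟩
    have := h.rtt a b e f
    simp only [Matrix.mul_apply, Fintype.sum_prod_type, R, M, N, Matrix.map_apply,
      Matrix.of_apply]
    simp only [← Algebra.smul_def, ← Algebra.commutes (R := ℂ) (A := A)]
    exact this
  have hMM : M * M' = 1 := by
    ext ⟨a, b⟩ ⟨e, f⟩
    simp only [Matrix.mul_apply, Fintype.sum_prod_type, M, M', Matrix.of_apply]
    have : ∀ x, ∑ y, t a x * t b y * (s y f * s x e) =
        t a x * (∑ y, t b y * s y f) * s x e := by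
      intro x
      simp only [Finset.mul_sum, Finset.sum_mul, mul_assoc]
    simp only [this, h.ts, mul_ite, ite_mul, mul_one, mul_zero, zero_mul, Finset.sum_ite_irrel,
      Finset.sum_const_zero, Matrix.one_apply, Prod.mk.injEq]
    rw [← ite_and]
    simp only [and_comm]
  have hNN : N' * N = 1 := by
    ext ⟨a, b⟩ ⟨e, f⟩
    simp only [Matrix.mul_apply, Fintype.sum_prod_type, N, N', Matrix.of_apply]
    have : ∀ x, ∑ y, s a x * s b y * (t y f * t x e) =
        s a x * (∑ y, s b y * t y f) * t x e := by
      intro x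
      simp only [Finset.mul_sum, Finset.sum_mul, mul_assoc]
    simp only [this, h.st, mul_ite, ite_mul, mul_one, mul_zero, zero_mul, Finset.sum_ite_irrel,
      Finset.sum_const_zero, Matrix.one_apply, Prod.mk.injEq]
    rw [← ite_and]
    simp only [and_comm]
  have hfin : R * M' = N' * R := by
    calc R * M' = N' * N * (R * M') := by rw [hNN, one_mul]
      _ = N' * (N * R) * M' := by simp only [mul_assoc]
      _ = N' * R * (M * M') := by rw [← hRM]; simp only [mul_assoc]
      _ = N' * R := by rw [hMM, mul_one]
  have e0 := congrFun (congrFun hfin (a, b)) (e, f)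
  simp only [Matrix.mul_apply, Fintype.sum_prod_type, R, M', N', Matrix.map_apply,
    Matrix.of_apply] at e0
  simp only [← Algebra.smul_def, ← Algebra.commutes (R := ℂ) (A := A)] at e0
  rw [sum_Rmat_left q a b (fun c d => s d f * s c e),
    sum_Rmat_right q e f (fun c d => s a c * s b d)] at e0
  exact smul_right_injective A (normFactor_ne q n) e0

end families
/-- The generators of `U_q(n)`: `t i j` stands for `t^i_j` and `s i j` for `(t†)^i_j`, the entry of
`t† = S t`, i.e. for `(t^j_i)^*`. -/
inductive UqGen (n : ℕ) : Type
  | t (i j : Fin n) : UqGen n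
  | s (i j : Fin n) : UqGen n

/-- The defining relations of `U_q(n)`: the relations `R t₁ t₂ = t₂ t₁ R` of `A(R)`, the relations
`t t† = t† t = 1` saying that `t^{a *}_b = S t^b_a`, and `det det^* = det^* det = 1`. -/
inductive UqRel (q : ℝˣ) (n : ℕ) :
    FreeAlgebra ℂ (UqGen n) → FreeAlgebra ℂ (UqGen n) → Prop
  | rtt (a b e f : Fin n) : UqRel q n
      (∑ c, ∑ d, Rmat q n (a, b) (c, d) •
        (FreeAlgebra.ι ℂ (UqGen.t c e) * FreeAlgebra.ι ℂ (UqGen.t d f)))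
      (∑ c, ∑ d, Rmat q n (c, d) (e, f) •
        (FreeAlgebra.ι ℂ (UqGen.t b d) * FreeAlgebra.ι ℂ (UqGen.t a c)))
  | ts (i j : Fin n) : UqRel q n
      (∑ k, FreeAlgebra.ι ℂ (UqGen.t i k) * FreeAlgebra.ι ℂ (UqGen.s k j))
      (if i = j then 1 else 0)
  | st (i j : Fin n) : UqRel q n
      (∑ k, FreeAlgebra.ι ℂ (UqGen.s i k) * FreeAlgebra.ι ℂ (UqGen.t k j))
      (if i = j then 1 else 0)
  | det_mul : UqRel q n
      (qdet q (fun i j => FreeAlgebra.ι ℂ (UqGen.t i j)) *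
        qdetStar q (fun i j => FreeAlgebra.ι ℂ (UqGen.s i j))) 1
  | mul_det : UqRel q n
      (qdetStar q (fun i j => FreeAlgebra.ι ℂ (UqGen.s i j)) *
        qdet q (fun i j => FreeAlgebra.ι ℂ (UqGen.t i j))) 1

/-- The algebra `U_q(n)`. -/
def Uq (q : ℝˣ) (n : ℕ) : Type := RingQuot (UqRel q n)

instance (q : ℝˣ) (n : ℕ) : Ring (Uq q n) := inferInstanceAs (Ring (RingQuot (UqRel q n)))

instance (q : ℝˣ) (n : ℕ) : Algebra ℂ (Uq q n) :=
  inferInstanceAs (Algebra ℂ (RingQuot (UqRel q n)))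

lemma map_qdet {A B : Type*} [Ring A] [Algebra ℂ A] [Ring B] [Algebra ℂ B] (f : A →ₐ[ℂ] B)
    (q : ℝˣ) {n : ℕ} (t : Fin n → Fin n → A) :
    f (qdet q t) = qdet q (fun i j => f (t i j)) := by
  simp [qdet, map_sum, map_list_prod, List.map_ofFn, Function.comp_def]

lemma map_qdetStar {A B : Type*} [Ring A] [Algebra ℂ A] [Ring B] [Algebra ℂ B] (f : A →ₐ[ℂ] B)
    (q : ℝˣ) {n : ℕ} (s : Fin n → Fin n → A) :
    f (qdetStar q s) = qdetStar q (fun i j => f (s i j)) := by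
  simp [qdetStar, map_sum, map_list_prod, List.map_ofFn, Function.comp_def, List.map_reverse]

namespace Uq

variable {q : ℝˣ} {n : ℕ}

/-- The quotient map from the free algebra. -/
def mk (q : ℝˣ) (n : ℕ) : FreeAlgebra ℂ (UqGen n) →ₐ[ℂ] Uq q n := RingQuot.mkAlgHom ℂ (UqRel q n)

lemma mk_surjective : Function.Surjective (mk q n) := RingQuot.mkAlgHom_surjective ℂ (UqRel q n)

lemma mk_rel {x y : FreeAlgebra ℂ (UqGen n)} (h : UqRel q n x y) : mk q n x = mk q n y :=
  RingQuot.mkAlgHom_rel ℂ h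

/-- The generator `t^i_j`. -/
def t (q : ℝˣ) {n : ℕ} (i j : Fin n) : Uq q n := mk q n (FreeAlgebra.ι ℂ (UqGen.t i j))

/-- The generator `(t†)^i_j`. -/
def s (q : ℝˣ) {n : ℕ} (i j : Fin n) : Uq q n := mk q n (FreeAlgebra.ι ℂ (UqGen.s i j))

lemma isFRT (q : ℝˣ) (n : ℕ) : IsFRT q (t q (n := n)) (s q (n := n)) where
  rtt a b e f := by simpa [map_sum, t] using mk_rel (UqRel.rtt (q := q) a b e f)
  ts i j := by
    have := mk_rel (UqRel.ts (q := q) i j)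
    rw [map_sum, apply_ite (mk q n)] at this
    simpa [t, s] using this
  st i j := by
    have := mk_rel (UqRel.st (q := q) i j)
    rw [map_sum, apply_ite (mk q n)] at this
    simpa [t, s] using this

variable {A : Type*} [Ring A] [Algebra ℂ A]

/-- The universal property of `U_q(n)`. -/
def lift {T S : Fin n → Fin n → A} (h : IsFRT q T S) : Uq q n →ₐ[ℂ] A :=
  RingQuot.liftAlgHom ℂ ⟨FreeAlgebra.lift ℂ (fun g : UqGen n => match g with
    | .t i j => T i j
    | .s i j => S i j), by
    intro x y hxy
    cases hxy with
    | rtt a b e f => simpa [map_sum] using h.rtt a b e f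
    | ts i j => rw [map_sum, apply_ite (FreeAlgebra.lift ℂ _)]; simpa using h.ts i j
    | st i j => rw [map_sum, apply_ite (FreeAlgebra.lift ℂ _)]; simpa using h.st i j
    | det_mul => rw [map_mul, map_qdet, map_qdetStar, map_one]; simpa using h.det.1
    | mul_det => rw [map_mul, map_qdet, map_qdetStar, map_one]; simpa using h.det.2⟩

@[simp] lemma lift_t {T S : Fin n → Fin n → A} (h : IsFRT q T S) (i j : Fin n) :
    lift h (t q i j) = T i j := by
  unfold lift t mk
  erw [RingQuot.liftAlgHom_mkAlgHom_apply]
  simp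

@[simp] lemma lift_s {T S : Fin n → Fin n → A} (h : IsFRT q T S) (i j : Fin n) :
    lift h (s q i j) = S i j := by
  unfold lift s mk
  erw [RingQuot.liftAlgHom_mkAlgHom_apply]
  simp

lemma induction {P : Uq q n → Prop} (halg : ∀ r : ℂ, P (algebraMap ℂ _ r))
    (ht : ∀ i j, P (t q i j)) (hs : ∀ i j, P (s q i j))
    (hmul : ∀ a b, P a → P b → P (a * b)) (hadd : ∀ a b, P a → P b → P (a + b))
    (a : Uq q n) : P a := by
  obtain ⟨x, rfl⟩ := mk_surjective a
  induction x using FreeAlgebra.induction with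
  | grade0 r => rw [AlgHom.commutes]; exact halg r
  | grade1 g =>
    cases g with
    | t i j => exact ht i j
    | s i j => exact hs i j
  | mul a b ha hb => rw [map_mul]; exact hmul _ _ ha hb
  | add a b ha hb => rw [map_add]; exact hadd _ _ ha hb

lemma hom_ext {f g : Uq q n →ₐ[ℂ] A} (ht : ∀ i j, f (t q i j) = g (t q i j))
    (hs : ∀ i j, f (s q i j) = g (s q i j)) : f = g := by
  ext a
  induction a using induction with
  | halg r => simp
  | ht i j => exact ht i j
  | hs i j => exact hs i j
  | hmul a b ha hb => rw [map_mul, map_mul, ha, hb]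
  | hadd a b ha hb => rw [map_add, map_add, ha, hb]

end Uq

lemma IsFRT.tensor {A B : Type*} [Ring A] [Algebra ℂ A] [Ring B] [Algebra ℂ B] {q : ℝˣ} {n : ℕ}
    {t s : Fin n → Fin n → A} {t' s' : Fin n → Fin n → B} (h : IsFRT q t s)
    (h' : IsFRT q t' s') :
    IsFRT q (fun i j => ∑ k, t i k ⊗ₜ[ℂ] t' k j) (fun i j => ∑ k, s k j ⊗ₜ[ℂ] s' i k) where
  rtt := by
    rw [rtt_iff]
    have hR := (rtt_iff q t).mp h.rtt
    have hR' := (rtt_iff q t').mp h'.rtt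
    intro a b e f
    simp only [Finset.sum_mul_sum, Algebra.TensorProduct.tmul_mul_tmul]
    have l : ∀ k l, (if a = b then ((q : ℝ) : ℂ) else 1) •
          ((t a k * t b l) ⊗ₜ[ℂ] (t' k e * t' l f)) +
        (if a < b then ((q : ℝ) : ℂ) - ((q : ℝ) : ℂ)⁻¹ else 0) •
          ((t b k * t a l) ⊗ₜ[ℂ] (t' k e * t' l f)) =
        (t b l * t a k) ⊗ₜ[ℂ] ((if k = l then ((q : ℝ) : ℂ) else 1) • (t' k e * t' l f)) +
        (t b k * t a l) ⊗ₜ[ℂ]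
          ((if l < k then ((q : ℝ) : ℂ) - ((q : ℝ) : ℂ)⁻¹ else 0) • (t' k e * t' l f)) := by
      intro k l
      rw [TensorProduct.smul_tmul', TensorProduct.smul_tmul', ← TensorProduct.add_tmul, hR a b k l,
        TensorProduct.add_tmul, TensorProduct.smul_tmul, TensorProduct.smul_tmul]
    have r : ∀ k l, (if e = f then ((q : ℝ) : ℂ) else 1) •
          ((t b l * t a k) ⊗ₜ[ℂ] (t' l f * t' k e)) +
        (if f < e then ((q : ℝ) : ℂ) - ((q : ℝ) : ℂ)⁻¹ else 0) •
          ((t b l * t a k) ⊗ₜ[ℂ] (t' l e * t' k f)) =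
        (t b l * t a k) ⊗ₜ[ℂ] ((if k = l then ((q : ℝ) : ℂ) else 1) • (t' k e * t' l f)) +
        (t b l * t a k) ⊗ₜ[ℂ]
          ((if k < l then ((q : ℝ) : ℂ) - ((q : ℝ) : ℂ)⁻¹ else 0) • (t' l e * t' k f)) := by
      intro k l
      rw [← TensorProduct.tmul_smul, ← TensorProduct.tmul_smul, ← TensorProduct.tmul_add,
        ← hR' k l e f, TensorProduct.tmul_add]
    rw [Finset.sum_comm (f := fun i j => (t b i * t a j) ⊗ₜ[ℂ] (t' i f * t' j e))]
    conv_rhs => arg 2; rw [Finset.sum_comm]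
    simp only [Finset.smul_sum, ← Finset.sum_add_distrib, l, r]
    simp only [Finset.sum_add_distrib]
    congr 1
    rw [Finset.sum_comm]
  ts i j := by
    simp only [Finset.sum_mul_sum, Algebra.TensorProduct.tmul_mul_tmul]
    rw [Finset.sum_comm]
    have : ∀ k, ∑ x, ∑ l, (t i k * s l j) ⊗ₜ[ℂ] (t' k x * s' x l) =
        (t i k * s k j) ⊗ₜ[ℂ] (1 : B) := by
      intro k
      rw [Finset.sum_comm]
      simp only [← TensorProduct.tmul_sum, h'.ts, TensorProduct.tmul_ite, TensorProduct.tmul_zero,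
        Finset.sum_ite_eq, Finset.mem_univ, if_true]
    simp only [this]
    rw [← TensorProduct.sum_tmul, h.ts]
    split_ifs <;> simp [Algebra.TensorProduct.one_def]
  st i j := by
    simp only [Finset.sum_mul_sum, Algebra.TensorProduct.tmul_mul_tmul]
    rw [Finset.sum_comm]
    have : ∀ k, ∑ x, ∑ l, (s k x * t x l) ⊗ₜ[ℂ] (s' i k * t' l j) =
        (1 : A) ⊗ₜ[ℂ] (s' i k * t' k j) := by
      intro k
      rw [Finset.sum_comm]
      simp only [← TensorProduct.sum_tmul, h.st, TensorProduct.ite_tmul, TensorProduct.zero_tmul,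
        Finset.sum_ite_eq, Finset.mem_univ, if_true]
    simp only [this]
    rw [← TensorProduct.tmul_sum, h'.st]
    split_ifs <;> simp [Algebra.TensorProduct.one_def]

lemma IsFRT.one {A : Type*} [Ring A] [Algebra ℂ A] (q : ℝˣ) (n : ℕ) :
    IsFRT q (fun i j : Fin n => if i = j then (1 : A) else 0)
      (fun i j => if i = j then 1 else 0) where
  rtt := by
    rw [rtt_iff]
    intro a b e f
    by_cases h1 : a = e <;> by_cases h2 : b = f <;> by_cases h3 : b = e <;>
      by_cases h4 : a = f <;> simp_all
  ts i j := by simp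
  st i j := by simp

namespace Uq

/-- The comultiplication `Δ t^i_j = ∑ t^i_k ⊗ t^k_j`. -/
def comulHom (q : ℝˣ) (n : ℕ) : Uq q n →ₐ[ℂ] Uq q n ⊗[ℂ] Uq q n :=
  lift ((isFRT q n).tensor (isFRT q n))

/-- The counit `ε(t^i_j) = δ^i_j`. -/
def counitHom (q : ℝˣ) (n : ℕ) : Uq q n →ₐ[ℂ] ℂ := lift (IsFRT.one q n)

instance (q : ℝˣ) (n : ℕ) : Bialgebra ℂ (Uq q n) :=
  Bialgebra.ofAlgHom (comulHom q n) (counitHom q n)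
    (by
      apply hom_ext <;> intro i j
      · simp only [comulHom, AlgHom.comp_apply, lift_t, map_sum,
          Algebra.TensorProduct.map_tmul, TensorProduct.sum_tmul, TensorProduct.tmul_sum,
          AlgHom.id_apply]
        rw [Finset.sum_comm]
        simp
      · simp only [comulHom, AlgHom.comp_apply, lift_s, map_sum,
          Algebra.TensorProduct.map_tmul, TensorProduct.sum_tmul, TensorProduct.tmul_sum,
          AlgHom.id_apply]
        rw [Finset.sum_comm]
        simp)
    (by
      apply hom_ext <;> intro i j
      · simp [comulHom, counitHom, map_sum, TensorProduct.ite_tmul]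
      · simp [comulHom, counitHom, map_sum, TensorProduct.ite_tmul])
    (by
      apply hom_ext <;> intro i j
      · simp [comulHom, counitHom, map_sum, TensorProduct.tmul_ite]
      · simp [comulHom, counitHom, map_sum, TensorProduct.tmul_ite])

@[simp] lemma comul_t (q : ℝˣ) {n : ℕ} (i j : Fin n) :
    Coalgebra.comul (R := ℂ) (t q i j) = ∑ k, t q i k ⊗ₜ[ℂ] t q k j :=
  lift_t ((isFRT q n).tensor (isFRT q n)) i j

@[simp] lemma comul_s (q : ℝˣ) {n : ℕ} (i j : Fin n) :
    Coalgebra.comul (R := ℂ) (s q i j) = ∑ k, s q k j ⊗ₜ[ℂ] s q i k :=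
  lift_s ((isFRT q n).tensor (isFRT q n)) i j

@[simp] lemma counit_t (q : ℝˣ) {n : ℕ} (i j : Fin n) :
    Coalgebra.counit (R := ℂ) (t q i j) = if i = j then 1 else 0 :=
  lift_t (IsFRT.one q n) i j

@[simp] lemma counit_s (q : ℝˣ) {n : ℕ} (i j : Fin n) :
    Coalgebra.counit (R := ℂ) (s q i j) = if i = j then 1 else 0 :=
  lift_s (IsFRT.one q n) i j

end Uq

section antipode

variable {A : Type*} [Ring A] [Algebra ℂ A] {n : ℕ} {q : ℝˣ} {t s : Fin n → Fin n → A}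

lemma IsFRT.op (h : IsFRT q t s) :
    IsFRT q (fun i j => op (s i j))
      (fun i j => op ((((q : ℝ) : ℂ) ^ (2 * (((j : ℕ) : ℤ) - ((i : ℕ) : ℤ)))) • t i j)) where
  rtt := by
    rw [rtt_iff]
    intro a b e f
    simp only [← op_mul, ← op_smul, ← op_add]
    rw [h.s_relation a b e f]
  ts i j := by
    have hz := q_ne q
    simp only [← op_mul, ← Finset.op_sum, smul_mul_assoc]
    have : ∀ k : Fin n, (((q : ℝ) : ℂ) ^ (2 * (((j : ℕ) : ℤ) - ((k : ℕ) : ℤ)))) •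
        (t k j * s i k) = (((q : ℝ) : ℂ) ^ (2 * ((j : ℕ) : ℤ))) •
          (((q : ℝ) : ℂ) ^ (-2 * ((k : ℕ) : ℤ))) • (t k j * s i k) := by
      intro k
      rw [smul_smul, ← zpow_add₀ hz]; congr 2; ring
    simp only [this]
    rw [← Finset.smul_sum, h.twisted_ts]
    by_cases hij : i = j
    · subst hij
      rw [if_pos rfl, if_pos rfl, smul_smul, ← zpow_add₀ hz]
      simp
    · simp [hij, Ne.symm hij]
  st i j := by
    have hz := q_ne q
    simp only [← op_mul, ← Finset.op_sum, mul_smul_comm]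
    have : ∀ k : Fin n, (((q : ℝ) : ℂ) ^ (2 * (((k : ℕ) : ℤ) - ((i : ℕ) : ℤ)))) •
        (s k j * t i k) = (((q : ℝ) : ℂ) ^ (-2 * ((i : ℕ) : ℤ))) •
          (((q : ℝ) : ℂ) ^ (2 * ((k : ℕ) : ℤ))) • (s k j * t i k) := by
      intro k
      rw [smul_smul, ← zpow_add₀ hz]; congr 2; ring
    simp only [this]
    rw [← Finset.smul_sum, h.twisted_st]
    by_cases hij : i = j
    · subst hij
      rw [if_pos rfl, if_pos rfl, smul_smul, ← zpow_add₀ hz]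
      simp
    · simp [hij, Ne.symm hij]

end antipode

section antihom

variable {H : Type*} [Ring H] [Bialgebra ℂ H] (S : H →ₐ[ℂ] Hᵐᵒᵖ)

/-- An algebra map to the opposite algebra, as a linear map. -/
def antiLinear : H →ₗ[ℂ] H := (opLinearEquiv ℂ).symm.toLinearMap ∘ₗ S.toLinearMap

lemma antiLinear_mul (a b : H) : antiLinear S (a * b) = antiLinear S b * antiLinear S a := by
  simp [antiLinear]

lemma antiLinear_left_mul (a b : H)
    (ha : LinearMap.mul' ℂ H ((antiLinear S).rTensor H (Coalgebra.comul a)) =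
      algebraMap ℂ H (Coalgebra.counit a))
    (hb : LinearMap.mul' ℂ H ((antiLinear S).rTensor H (Coalgebra.comul b)) =
      algebraMap ℂ H (Coalgebra.counit b)) :
    LinearMap.mul' ℂ H ((antiLinear S).rTensor H (Coalgebra.comul (a * b))) =
      algebraMap ℂ H (Coalgebra.counit (a * b)) := by
  have h1 : ∀ (X : H ⊗[ℂ] H) (x y : H),
      LinearMap.mul' ℂ H ((antiLinear S).rTensor H (X * (x ⊗ₜ y))) =
      antiLinear S x * LinearMap.mul' ℂ H ((antiLinear S).rTensor H X) * y := by
    intro X x y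
    induction X using TensorProduct.induction_on with
    | zero => simp
    | tmul u v => simp [antiLinear_mul, mul_assoc]
    | add u v hu hv => rw [add_mul, map_add, map_add, hu, hv, map_add, map_add, mul_add, add_mul]
  have h2 : ∀ Y : H ⊗[ℂ] H,
      LinearMap.mul' ℂ H ((antiLinear S).rTensor H (Coalgebra.comul a * Y)) =
      algebraMap ℂ H (Coalgebra.counit a) * LinearMap.mul' ℂ H ((antiLinear S).rTensor H Y) := by
    intro Y
    induction Y using TensorProduct.induction_on with
    | zero => simp
    | tmul u v => rw [h1, ha, ← Algebra.commutes]; simp [mul_assoc]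
    | add u v hu hv => rw [mul_add, map_add, map_add, hu, hv, map_add, map_add, mul_add]
  rw [Bialgebra.comul_mul, h2, hb, Bialgebra.counit_mul, map_mul]

lemma antiLinear_right_mul (a b : H)
    (ha : LinearMap.mul' ℂ H ((antiLinear S).lTensor H (Coalgebra.comul a)) =
      algebraMap ℂ H (Coalgebra.counit a))
    (hb : LinearMap.mul' ℂ H ((antiLinear S).lTensor H (Coalgebra.comul b)) =
      algebraMap ℂ H (Coalgebra.counit b)) :
    LinearMap.mul' ℂ H ((antiLinear S).lTensor H (Coalgebra.comul (a * b))) =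
      algebraMap ℂ H (Coalgebra.counit (a * b)) := by
  have h1 : ∀ (X : H ⊗[ℂ] H) (x y : H),
      LinearMap.mul' ℂ H ((antiLinear S).lTensor H ((x ⊗ₜ y) * X)) =
      x * LinearMap.mul' ℂ H ((antiLinear S).lTensor H X) * antiLinear S y := by
    intro X x y
    induction X using TensorProduct.induction_on with
    | zero => simp
    | tmul u v => simp [antiLinear_mul, mul_assoc]
    | add u v hu hv => rw [mul_add, map_add, map_add, hu, hv, map_add, map_add, mul_add, add_mul]
  have h2 : ∀ Y : H ⊗[ℂ] H,
      LinearMap.mul' ℂ H ((antiLinear S).lTensor H (Y * Coalgebra.comul b)) =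
      LinearMap.mul' ℂ H ((antiLinear S).lTensor H Y) * algebraMap ℂ H (Coalgebra.counit b) := by
    intro Y
    induction Y using TensorProduct.induction_on with
    | zero => simp
    | tmul u v => rw [h1, hb, mul_assoc, Algebra.commutes]; simp [mul_assoc]
    | add u v hu hv => rw [add_mul, map_add, map_add, hu, hv, map_add, map_add, add_mul]
  rw [Bialgebra.comul_mul, h2, ha, Bialgebra.counit_mul, map_mul]

end antihom

namespace Uq

/-- The antipode as an algebra map to the opposite algebra: `S t = t†` and
`S (t†)^i_j = q^(2 (j - i)) t^i_j`. -/
def antipodeHom (q : ℝˣ) (n : ℕ) : Uq q n →ₐ[ℂ] (Uq q n)ᵐᵒᵖ := lift (isFRT q n).op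

lemma antiLinear_t (q : ℝˣ) {n : ℕ} (i j : Fin n) :
    antiLinear (antipodeHom q n) (t q i j) = s q i j := by
  simp [antiLinear, antipodeHom]

lemma antiLinear_s (q : ℝˣ) {n : ℕ} (i j : Fin n) :
    antiLinear (antipodeHom q n) (s q i j) =
      (((q : ℝ) : ℂ) ^ (2 * (((j : ℕ) : ℤ) - ((i : ℕ) : ℤ)))) • t q i j := by
  simp [antiLinear, antipodeHom]

instance (q : ℝˣ) (n : ℕ) : HopfAlgebra ℂ (Uq q n) where
  antipode := antiLinear (antipodeHom q n)
  mul_antipode_rTensor_comul := by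
    ext a
    simp only [LinearMap.comp_apply, Algebra.linearMap_apply]
    induction a using induction with
    | halg r =>
      rw [Algebra.algebraMap_eq_smul_one, map_smul, map_smul, map_smul, map_smul,
        Bialgebra.comul_one, Bialgebra.counit_one, Algebra.TensorProduct.one_def]
      simp [antiLinear, Algebra.algebraMap_eq_smul_one]
    | ht i j =>
      simp only [comul_t, map_sum, LinearMap.rTensor_tmul, LinearMap.mul'_apply, antiLinear_t,
        (isFRT q n).st, counit_t]
      split_ifs <;> simp
    | hs i j =>
      have h := (isFRT q n).op.ts i j
      simp only [← op_mul, ← Finset.op_sum] at h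
      simp only [comul_s, map_sum, LinearMap.rTensor_tmul, LinearMap.mul'_apply, antiLinear_s,
        counit_s]
      rw [← op_injective.eq_iff, h]
      split_ifs <;> simp
    | hmul a b ha hb => exact antiLinear_left_mul _ a b ha hb
    | hadd a b ha hb => simp only [map_add, ha, hb]
  mul_antipode_lTensor_comul := by
    ext a
    simp only [LinearMap.comp_apply, Algebra.linearMap_apply]
    induction a using induction with
    | halg r =>
      rw [Algebra.algebraMap_eq_smul_one, map_smul, map_smul, map_smul, map_smul,
        Bialgebra.comul_one, Bialgebra.counit_one, Algebra.TensorProduct.one_def]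
      simp [antiLinear, Algebra.algebraMap_eq_smul_one]
    | ht i j =>
      simp only [comul_t, map_sum, LinearMap.lTensor_tmul, LinearMap.mul'_apply, antiLinear_t,
        (isFRT q n).ts, counit_t]
      split_ifs <;> simp
    | hs i j =>
      have h := (isFRT q n).op.st i j
      simp only [← op_mul, ← Finset.op_sum] at h
      simp only [comul_s, map_sum, LinearMap.lTensor_tmul, LinearMap.mul'_apply, antiLinear_s,
        counit_s]
      rw [← op_injective.eq_iff, h]
      split_ifs <;> simp
    | hmul a b ha hb => exact antiLinear_right_mul _ a b ha hb
    | hadd a b ha hb => simp only [map_add, ha, hb]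

end Uq

/-- The opposite algebra with the complex conjugate scalar multiplication: an algebra map from `A`
to `ConjOp A` is an antilinear antimultiplicative map from `A` to `A`. -/
def ConjOp (A : Type*) : Type _ := Aᵐᵒᵖ

instance (A : Type*) [Ring A] : Ring (ConjOp A) := inferInstanceAs (Ring Aᵐᵒᵖ)

instance (A : Type*) [Ring A] [Algebra ℂ A] : Algebra ℂ (ConjOp A) :=
  Algebra.compHom Aᵐᵒᵖ (starRingEnd ℂ)

namespace ConjOp

variable {A : Type*} [Ring A] [Algebra ℂ A]

/-- The identity map from `A` to `ConjOp A`. -/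
def mk : A ≃+ ConjOp A := opAddEquiv

lemma mk_mul (a b : A) : mk (a * b) = mk b * mk a := rfl

lemma mk_one : mk (1 : A) = 1 := rfl

lemma smul_mk (c : ℂ) (a : A) : c • mk a = mk (starRingEnd ℂ c • a) := rfl

lemma symm_mul (a b : ConjOp A) : mk.symm (a * b) = mk.symm b * mk.symm a := rfl

lemma symm_smul (c : ℂ) (a : ConjOp A) : mk.symm (c • a) = starRingEnd ℂ c • mk.symm a := rfl

lemma symm_algebraMap (c : ℂ) :
    mk.symm (algebraMap ℂ (ConjOp A) c) = algebraMap ℂ A (starRingEnd ℂ c) := rfl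

end ConjOp

lemma IsFRT.conjOp {A : Type*} [Ring A] [Algebra ℂ A] {q : ℝˣ} {n : ℕ}
    {t s : Fin n → Fin n → A} (h : IsFRT q t s) :
    IsFRT q (fun i j => ConjOp.mk (s j i)) (fun i j => ConjOp.mk (t j i)) where
  rtt := by
    rw [rtt_iff]
    intro a b e f
    simp only [← ConjOp.mk_mul, ConjOp.smul_mk, ← map_add, apply_ite (starRingEnd ℂ), map_sub,
      map_inv₀, Complex.conj_ofReal, map_one, map_zero]
    congr 1
    have := h.s_relation f e b a
    rw [eq_comm] at this
    simpa only [eq_comm (a := b) (b := a), eq_comm (a := f) (b := e)] using this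
  ts i j := by
    simp only [← ConjOp.mk_mul, ← map_sum, h.ts, eq_comm (a := j) (b := i)]
    split_ifs
    · exact ConjOp.mk_one
    · exact map_zero _
  st i j := by
    simp only [← ConjOp.mk_mul, ← map_sum, h.st, eq_comm (a := j) (b := i)]
    split_ifs
    · exact ConjOp.mk_one
    · exact map_zero _

namespace Uq

/-- The star operation, with `(t^a_b)^* = (t†)^b_a`, as an algebra map to `ConjOp`. -/
def starHom (q : ℝˣ) (n : ℕ) : Uq q n →ₐ[ℂ] ConjOp (Uq q n) := lift (isFRT q n).conjOp

instance (q : ℝˣ) (n : ℕ) : Star (Uq q n) := ⟨fun a => ConjOp.mk.symm (starHom q n a)⟩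

lemma star_def {q : ℝˣ} {n : ℕ} (a : Uq q n) : star a = ConjOp.mk.symm (starHom q n a) := rfl

@[simp] lemma star_t (q : ℝˣ) {n : ℕ} (i j : Fin n) : star (t q i j) = s q j i := by
  simp [star_def, starHom]

@[simp] lemma star_s (q : ℝˣ) {n : ℕ} (i j : Fin n) : star (s q i j) = t q j i := by
  simp [star_def, starHom]

lemma star_mul_aux {q : ℝˣ} {n : ℕ} (a b : Uq q n) : star (a * b) = star b * star a := by
  simp [star_def, ConjOp.symm_mul]

lemma star_add_aux {q : ℝˣ} {n : ℕ} (a b : Uq q n) : star (a + b) = star a + star b := by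
  simp [star_def]

lemma star_algebraMap_aux {q : ℝˣ} {n : ℕ} (r : ℂ) :
    star (algebraMap ℂ (Uq q n) r) = algebraMap ℂ (Uq q n) (starRingEnd ℂ r) := by
  rw [star_def, AlgHom.commutes, ConjOp.symm_algebraMap]

instance (q : ℝˣ) (n : ℕ) : StarRing (Uq q n) where
  star_involutive a := by
    induction a using induction with
    | halg r => rw [star_algebraMap_aux, star_algebraMap_aux]; simp
    | ht i j => simp
    | hs i j => simp
    | hmul a b ha hb => rw [star_mul_aux, star_mul_aux, ha, hb]
    | hadd a b ha hb => rw [star_add_aux, star_add_aux, ha, hb]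
  star_mul := star_mul_aux
  star_add := star_add_aux

instance (q : ℝˣ) (n : ℕ) : StarModule ℂ (Uq q n) where
  star_smul r a := by
    rw [star_def, map_smul, ConjOp.symm_smul]
    rfl

/-- An algebra map out of `U_q(n)` which is compatible with the star on generators, as a
`*`-algebra map. -/
def toStarHom {q : ℝˣ} {n : ℕ} {A : Type*} [Ring A] [Algebra ℂ A] [StarRing A] [StarModule ℂ A]
    (f : Uq q n →ₐ[ℂ] A) (hf : ∀ i j, f (s q i j) = star (f (t q j i))) : Uq q n →⋆ₐ[ℂ] A where
  toAlgHom := f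
  map_star' a := by
    change f (star a) = star (f a)
    induction a using induction with
    | halg r =>
      rw [star_algebraMap_aux, AlgHom.commutes, AlgHom.commutes, Algebra.algebraMap_eq_smul_one,
        Algebra.algebraMap_eq_smul_one, star_smul, star_one]
      rfl
    | ht i j => rw [star_t, hf]
    | hs i j => rw [star_s, hf, star_star]
    | hmul a b ha hb => rw [star_mul, map_mul, map_mul, star_mul, ha, hb]
    | hadd a b ha hb => rw [star_add, map_add, map_add, star_add, ha, hb]

lemma star_qdet (q : ℝˣ) (n : ℕ) :
    star (qdet q (t q (n := n))) = qdetStar q (s q (n := n)) := by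
  have hr : ∀ a : Fin n → Fin n, star (eps q a) = eps q a := by
    intro a
    unfold eps
    split_ifs <;> simp
  have hnu : star (nu q n) = nu q n := by
    unfold nu
    simp [hr]
  have hp : ∀ l : List (Uq q n), star l.prod = (l.map star).reverse.prod := by
    intro l
    induction l with
    | nil => simp
    | cons a l ih => simp [star_mul, ih]
  simp only [qdet, qdetStar, star_smul, star_sum, star_inv₀, hnu, star_mul, hr, hp, List.map_ofFn,
    Function.comp_def, star_t]
  simp only [mul_comm]

end Uq

/-! ### Quantum spheres and complex projective quantum spaces -/

/-- The metric `g_a^b = λ R~^{bc}_{ca}`. -/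
def metric (q : ℝˣ) (n : ℕ) (a b : Fin n) : ℂ := ∑ c, lam q n * Rtilde q n (b, c) (c, a)

/-- The generators `v^i` and `x_i` of the algebra `ℂ_q^n`. -/
inductive CqGen (n : ℕ) : Type
  | v (i : Fin n) : CqGen n
  | x (i : Fin n) : CqGen n

/-- The defining relations of the braided tensor product `ℂ_q^n = V(R) ⊗ V^*(R)`: the relations of
the quantum vectors `v^i = v^i ⊗ 1`, those of the quantum covectors `x_i = 1 ⊗ x_i`, and the cross
relations `(1 ⊗ x_i) (v^j ⊗ 1) = Ψ(x_i ⊗ v^j)`. -/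
inductive CqRel (q : ℝˣ) (n : ℕ) :
    FreeAlgebra ℂ (CqGen n) → FreeAlgebra ℂ (CqGen n) → Prop
  | vv (i j : Fin n) : CqRel q n
      (FreeAlgebra.ι ℂ (CqGen.v i) * FreeAlgebra.ι ℂ (CqGen.v j))
      (∑ k, ∑ l, ((lam q n)⁻¹ * Rmat q n (i, j) (k, l)) •
        (FreeAlgebra.ι ℂ (CqGen.v l) * FreeAlgebra.ι ℂ (CqGen.v k)))
  | xx (i j : Fin n) : CqRel q n
      (FreeAlgebra.ι ℂ (CqGen.x i) * FreeAlgebra.ι ℂ (CqGen.x j))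
      (∑ k, ∑ l, ((lam q n)⁻¹ * Rmat q n (k, l) (i, j)) •
        (FreeAlgebra.ι ℂ (CqGen.x l) * FreeAlgebra.ι ℂ (CqGen.x k)))
  | xv (i j : Fin n) : CqRel q n
      (FreeAlgebra.ι ℂ (CqGen.x i) * FreeAlgebra.ι ℂ (CqGen.v j))
      (∑ k, ∑ l, (lam q n * Rtilde q n (l, j) (i, k)) •
        (FreeAlgebra.ι ℂ (CqGen.v k) * FreeAlgebra.ι ℂ (CqGen.x l)))

/-- The defining relations of the quantum sphere `S_q^{2n-1}`: those of `ℂ_q^n` and `N = 1` for the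
quantum norm `N = v^a g_a^b x_b`. -/
inductive SphereRel (q : ℝˣ) (n : ℕ) :
    FreeAlgebra ℂ (CqGen n) → FreeAlgebra ℂ (CqGen n) → Prop
  | cq {a b : FreeAlgebra ℂ (CqGen n)} (h : CqRel q n a b) : SphereRel q n a b
  | norm : SphereRel q n
      (∑ a, ∑ b, metric q n a b •
        (FreeAlgebra.ι ℂ (CqGen.v a) * FreeAlgebra.ι ℂ (CqGen.x b))) 1

/-- The quantum sphere `S_q^{2n-1}`. -/
def Sphere (q : ℝˣ) (n : ℕ) : Type := RingQuot (SphereRel q n)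

instance (q : ℝˣ) (n : ℕ) : Ring (Sphere q n) :=
  inferInstanceAs (Ring (RingQuot (SphereRel q n)))

instance (q : ℝˣ) (n : ℕ) : Algebra ℂ (Sphere q n) :=
  inferInstanceAs (Algebra ℂ (RingQuot (SphereRel q n)))

/-- Elements `v i`, `x i` of an algebra satisfying the relations of the quantum sphere. -/
structure IsSphere {A : Type*} [Ring A] [Algebra ℂ A] (q : ℝˣ) {n : ℕ} (v x : Fin n → A) :
    Prop where
  vv : ∀ i j, v i * v j = ∑ k, ∑ l, ((lam q n)⁻¹ * Rmat q n (i, j) (k, l)) • (v l * v k)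
  xx : ∀ i j, x i * x j = ∑ k, ∑ l, ((lam q n)⁻¹ * Rmat q n (k, l) (i, j)) • (x l * x k)
  xv : ∀ i j, x i * v j = ∑ k, ∑ l, (lam q n * Rtilde q n (l, j) (i, k)) • (v k * x l)
  norm : ∑ a, ∑ b, metric q n a b • (v a * x b) = 1

lemma conj_R (q : ℝˣ) {n : ℕ} (a b c d : Fin n) :
    starRingEnd ℂ ((lam q n)⁻¹ * Rmat q n (a, b) (c, d)) =
      (lam q n)⁻¹ * Rmat q n (d, c) (b, a) := by
  have hr := normFactor_ne q n
  have hz := q_ne q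
  have h : ∀ X : ℂ, (lam q n)⁻¹ * (normFactor q n * X) = ((q : ℝ) : ℂ)⁻¹ * X := by
    intro X; unfold lam; field_simp
  simp only [Rmat, Matrix.of_apply, h, map_mul, map_inv₀, Complex.conj_ofReal,
    apply_ite (starRingEnd ℂ), map_sub, map_one, map_zero]
  congr 1
  split_ifs <;> first | rfl | (exfalso; grind)

lemma conj_Rtilde (q : ℝˣ) {n : ℕ} (l j i k : Fin n) :
    starRingEnd ℂ (lam q n * Rtilde q n (l, j) (i, k)) =
      lam q n * Rtilde q n (k, i) (j, l) := by
  have hl : lam q n ≠ 0 := mul_ne_zero (q_ne q) (normFactor_ne q n)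
  set M := transposeSnd (Rmat q n) with hM
  have hinv : lam q n • M⁻¹ = ((lam q n)⁻¹ • M)⁻¹ := by
    by_cases h : IsUnit M.det
    · have := Matrix.inv_smul' M (Units.mk0 _ (inv_ne_zero hl)) h
      rw [Units.smul_def, Units.smul_def] at this
      simpa using this.symm
    · rw [Matrix.nonsing_inv_apply_not_isUnit _ h, Matrix.nonsing_inv_apply_not_isUnit, smul_zero]
      rw [Matrix.det_smul]
      simpa [hl] using h
  set W := (lam q n)⁻¹ • M with hW
  have hconj : W.conjTranspose = W.transpose.submatrix (Equiv.prodComm (Fin n) (Fin n))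
      (Equiv.prodComm (Fin n) (Fin n)) := by
    ext ⟨a, b⟩ ⟨c, d⟩
    simp only [Matrix.conjTranspose_apply, Matrix.submatrix_apply, Matrix.transpose_apply,
      Equiv.prodComm_apply, Prod.swap_prod_mk, hW, hM, transposeSnd, Matrix.smul_apply,
      Matrix.of_apply, smul_eq_mul]
    exact conj_R q c b a d
  have hWi : (W⁻¹).conjTranspose = (W⁻¹).transpose.submatrix (Equiv.prodComm (Fin n) (Fin n))
      (Equiv.prodComm (Fin n) (Fin n)) := by
    rw [Matrix.conjTranspose_nonsing_inv, hconj, Matrix.inv_submatrix_equiv,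
      Matrix.transpose_nonsing_inv]
  have e := congrFun (congrFun hWi (i, j)) (l, k)
  rw [← hinv] at e
  exact e

lemma conj_metric (q : ℝˣ) {n : ℕ} (a b : Fin n) :
    starRingEnd ℂ (metric q n a b) = metric q n b a := by
  unfold metric
  rw [map_sum]
  exact Finset.sum_congr rfl fun c _ => conj_Rtilde q b c c a

lemma IsSphere.conjOp {A : Type*} [Ring A] [Algebra ℂ A] {q : ℝˣ} {n : ℕ} {v x : Fin n → A}
    (h : IsSphere q v x) :
    IsSphere q (fun i => ConjOp.mk (x i)) (fun i => ConjOp.mk (v i)) where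
  vv i j := by
    simp only [← ConjOp.mk_mul, ConjOp.smul_mk, ← map_sum, conj_R]
    rw [h.xx j i, Finset.sum_comm]
  xx i j := by
    simp only [← ConjOp.mk_mul, ConjOp.smul_mk, ← map_sum, conj_R]
    rw [h.vv j i, Finset.sum_comm]
  xv i j := by
    simp only [← ConjOp.mk_mul, ConjOp.smul_mk, ← map_sum, conj_Rtilde]
    rw [h.xv j i, Finset.sum_comm]
  norm := by
    simp only [← ConjOp.mk_mul, ConjOp.smul_mk, ← map_sum, conj_metric]
    rw [Finset.sum_comm, h.norm, ConjOp.mk_one]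

lemma IsSphere.tensor {A B : Type*} [Ring A] [Algebra ℂ A] [Ring B] [Algebra ℂ B] {q : ℝˣ}
    {n : ℕ} {v x : Fin n → A} (h : IsSphere q v x) {z w : B} (hzw : z * w = 1)
    (hwz : w * z = 1) :
    IsSphere q (fun i => v i ⊗ₜ[ℂ] w) (fun i => x i ⊗ₜ[ℂ] z) where
  vv i j := by
    simp only [Algebra.TensorProduct.tmul_mul_tmul, TensorProduct.smul_tmul',
      ← TensorProduct.sum_tmul, ← h.vv]
  xx i j := by
    simp only [Algebra.TensorProduct.tmul_mul_tmul, TensorProduct.smul_tmul',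
      ← TensorProduct.sum_tmul, ← h.xx]
  xv i j := by
    simp only [Algebra.TensorProduct.tmul_mul_tmul, TensorProduct.smul_tmul', hzw, hwz,
      ← TensorProduct.sum_tmul, ← h.xv]
  norm := by
    simp only [Algebra.TensorProduct.tmul_mul_tmul, TensorProduct.smul_tmul', hwz,
      ← TensorProduct.sum_tmul, h.norm]
    rfl

namespace Sphere

variable {q : ℝˣ} {n : ℕ}

/-- The quotient map from the free algebra. -/
def mk (q : ℝˣ) (n : ℕ) : FreeAlgebra ℂ (CqGen n) →ₐ[ℂ] Sphere q n :=
  RingQuot.mkAlgHom ℂ (SphereRel q n)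

lemma mk_surjective : Function.Surjective (mk q n) :=
  RingQuot.mkAlgHom_surjective ℂ (SphereRel q n)

lemma mk_rel {x y : FreeAlgebra ℂ (CqGen n)} (h : SphereRel q n x y) : mk q n x = mk q n y :=
  RingQuot.mkAlgHom_rel ℂ h

/-- The generator `v^i`. -/
def v (q : ℝˣ) {n : ℕ} (i : Fin n) : Sphere q n := mk q n (FreeAlgebra.ι ℂ (CqGen.v i))

/-- The generator `x_i`. -/
def x (q : ℝˣ) {n : ℕ} (i : Fin n) : Sphere q n := mk q n (FreeAlgebra.ι ℂ (CqGen.x i))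

lemma isSphere (q : ℝˣ) (n : ℕ) : IsSphere q (v q (n := n)) (x q (n := n)) where
  vv i j := by simpa [map_sum, v] using mk_rel (SphereRel.cq (CqRel.vv (q := q) i j))
  xx i j := by simpa [map_sum, x] using mk_rel (SphereRel.cq (CqRel.xx (q := q) i j))
  xv i j := by simpa [map_sum, v, x] using mk_rel (SphereRel.cq (CqRel.xv (q := q) i j))
  norm := by simpa [map_sum, v, x] using mk_rel (SphereRel.norm (q := q) (n := n))

variable {A : Type*} [Ring A] [Algebra ℂ A]

/-- The universal property of the quantum sphere. -/
def lift {V X : Fin n → A} (h : IsSphere q V X) : Sphere q n →ₐ[ℂ] A :=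
  RingQuot.liftAlgHom ℂ ⟨FreeAlgebra.lift ℂ (fun g : CqGen n => match g with
    | .v i => V i
    | .x i => X i), by
    intro a b hab
    cases hab with
    | cq hab =>
      cases hab with
      | vv i j => simpa [map_sum] using h.vv i j
      | xx i j => simpa [map_sum] using h.xx i j
      | xv i j => simpa [map_sum] using h.xv i j
    | norm => simpa [map_sum] using h.norm⟩

@[simp] lemma lift_v {V X : Fin n → A} (h : IsSphere q V X) (i : Fin n) :
    lift h (v q i) = V i := by
  unfold lift v mk
  erw [RingQuot.liftAlgHom_mkAlgHom_apply]
  simp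

@[simp] lemma lift_x {V X : Fin n → A} (h : IsSphere q V X) (i : Fin n) :
    lift h (x q i) = X i := by
  unfold lift x mk
  erw [RingQuot.liftAlgHom_mkAlgHom_apply]
  simp

lemma induction {P : Sphere q n → Prop} (halg : ∀ r : ℂ, P (algebraMap ℂ _ r))
    (hv : ∀ i, P (v q i)) (hx : ∀ i, P (x q i))
    (hmul : ∀ a b, P a → P b → P (a * b)) (hadd : ∀ a b, P a → P b → P (a + b))
    (a : Sphere q n) : P a := by
  obtain ⟨y, rfl⟩ := mk_surjective a
  induction y using FreeAlgebra.induction with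
  | grade0 r => rw [AlgHom.commutes]; exact halg r
  | grade1 g =>
    cases g with
    | v i => exact hv i
    | x i => exact hx i
  | mul a b ha hb => rw [map_mul]; exact hmul _ _ ha hb
  | add a b ha hb => rw [map_add]; exact hadd _ _ ha hb

/-- The star operation, with `x_a^* = v^a`, as an algebra map to `ConjOp`. -/
def starHom (q : ℝˣ) (n : ℕ) : Sphere q n →ₐ[ℂ] ConjOp (Sphere q n) := lift (isSphere q n).conjOp

instance (q : ℝˣ) (n : ℕ) : Star (Sphere q n) := ⟨fun a => ConjOp.mk.symm (starHom q n a)⟩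

lemma star_def (a : Sphere q n) : star a = ConjOp.mk.symm (starHom q n a) := rfl

@[simp] lemma star_v (q : ℝˣ) {n : ℕ} (i : Fin n) : star (v q i) = x q i := by
  simp [star_def, starHom]

@[simp] lemma star_x (q : ℝˣ) {n : ℕ} (i : Fin n) : star (x q i) = v q i := by
  simp [star_def, starHom]

lemma star_mul_aux (a b : Sphere q n) : star (a * b) = star b * star a := by
  simp [star_def, ConjOp.symm_mul]

lemma star_add_aux (a b : Sphere q n) : star (a + b) = star a + star b := by
  simp [star_def]

lemma star_algebraMap_aux (r : ℂ) :
    star (algebraMap ℂ (Sphere q n) r) = algebraMap ℂ (Sphere q n) (starRingEnd ℂ r) := by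
  rw [star_def, AlgHom.commutes, ConjOp.symm_algebraMap]

instance (q : ℝˣ) (n : ℕ) : StarRing (Sphere q n) where
  star_involutive a := by
    induction a using induction with
    | halg r => rw [star_algebraMap_aux, star_algebraMap_aux]; simp
    | hv i => simp
    | hx i => simp
    | hmul a b ha hb => rw [star_mul_aux, star_mul_aux, ha, hb]
    | hadd a b ha hb => rw [star_add_aux, star_add_aux, ha, hb]
  star_mul := star_mul_aux
  star_add := star_add_aux

instance (q : ℝˣ) (n : ℕ) : StarModule ℂ (Sphere q n) where
  star_smul r a := by
    rw [star_def, map_smul, ConjOp.symm_smul]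
    rfl

/-- An algebra map out of the quantum sphere which is compatible with the star on generators, as a
`*`-algebra map. -/
def toStarHom [StarRing A] [StarModule ℂ A] (f : Sphere q n →ₐ[ℂ] A)
    (hf : ∀ i, f (v q i) = star (f (x q i))) : Sphere q n →⋆ₐ[ℂ] A where
  toAlgHom := f
  map_star' a := by
    change f (star a) = star (f a)
    induction a using induction with
    | halg r =>
      rw [star_algebraMap_aux, AlgHom.commutes, AlgHom.commutes, Algebra.algebraMap_eq_smul_one,
        Algebra.algebraMap_eq_smul_one, star_smul, star_one]
      rfl
    | hv i => rw [star_v, hf, star_star]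
    | hx i => rw [star_x, hf]
    | hmul a b ha hb => rw [star_mul, map_mul, map_mul, star_mul, ha, hb]
    | hadd a b ha hb => rw [star_add, map_add, map_add, star_add, ha, hb]

end Sphere

section tensorStar

variable (A B : Type*) [Ring A] [Algebra ℂ A] [StarRing A] [StarModule ℂ A]
  [Ring B] [Algebra ℂ B] [StarRing B] [StarModule ℂ B]

/-- The `*`-algebra map `a ↦ a ⊗ 1`. -/
def inlStar : A →⋆ₐ[ℂ] A ⊗[ℂ] B where
  toAlgHom := Algebra.TensorProduct.includeLeft
  map_star' a := by
    change star a ⊗ₜ[ℂ] (1 : B) = star (a ⊗ₜ[ℂ] (1 : B))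
    rw [TensorProduct.star_tmul, star_one]

/-- The `*`-algebra map `b ↦ 1 ⊗ b`. -/
def inrStar : B →⋆ₐ[ℂ] A ⊗[ℂ] B where
  toAlgHom := Algebra.TensorProduct.includeRight
  map_star' b := by
    change (1 : A) ⊗ₜ[ℂ] star b = star ((1 : A) ⊗ₜ[ℂ] b)
    rw [TensorProduct.star_tmul, star_one]

end tensorStar

lemma z_mul_star (q : ℝˣ) : Uq.t q (0 : Fin 1) 0 * Uq.s q 0 0 = 1 := by
  simpa using (Uq.isFRT q 1).ts 0 0

lemma star_mul_z (q : ℝˣ) : Uq.s q (0 : Fin 1) 0 * Uq.t q 0 0 = 1 := by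
  simpa using (Uq.isFRT q 1).st 0 0

/-- The right coaction of `U_q(1)` on the quantum sphere, `x_i ↦ x_i ⊗ z` and `v^i ↦ v^i ⊗ z^*`,
where `z = t^1_1` is the generator of `U_q(1)`. -/
def circleCoaction (q : ℝˣ) (n : ℕ) : Sphere q n →⋆ₐ[ℂ] Sphere q n ⊗[ℂ] Uq q 1 :=
  Sphere.toStarHom
    (Sphere.lift ((Sphere.isSphere q n).tensor (z_mul_star q) (star_mul_z q)))
    (by intro i; simp)

/-- Complex projective quantum space `ℂP_q^{n-1}`: the `*`-algebra `{u | u ↦ u ⊗ 1}` of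
`U_q(1)`-invariant elements of the quantum sphere `S_q^{2n-1}`. -/
def ProjSpace (q : ℝˣ) (n : ℕ) : StarSubalgebra ℂ (Sphere q n) :=
  StarAlgHom.equalizer (circleCoaction q n) (inlStar (Sphere q n) (Uq q 1))

/-! ### The morphism from `U_q(n)` to `U_q(1) ⊗ U_q(n-1)` -/

/-- The block matrix `diag(1, T)`. -/
def extendFirst {A : Type*} [Ring A] {n : ℕ} (T : Fin n → Fin n → A) (i j : Fin (n + 1)) : A :=
  Fin.cases (Fin.cases 1 (fun _ => 0) j) (fun i' => Fin.cases 0 (fun j' => T i' j') j) i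

/-- The block matrix `diag(T, 1)`. -/
def extendLast {A : Type*} [Ring A] {n : ℕ} (T : Fin n → Fin n → A) (i j : Fin (n + 1)) : A :=
  Fin.lastCases (Fin.lastCases 1 (fun _ => 0) j)
    (fun i' => Fin.lastCases 0 (fun j' => T i' j') j) i

section extend

variable {A : Type*} [Ring A] {n : ℕ} (T : Fin n → Fin n → A)

@[simp] lemma extendFirst_zero_zero : extendFirst T 0 0 = 1 := rfl

@[simp] lemma extendFirst_zero_succ (j : Fin n) : extendFirst T 0 j.succ = 0 := rfl

@[simp] lemma extendFirst_succ_zero (i : Fin n) : extendFirst T i.succ 0 = 0 := rfl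

@[simp] lemma extendFirst_succ_succ (i j : Fin n) : extendFirst T i.succ j.succ = T i j := rfl

@[simp] lemma extendLast_last_last : extendLast T (Fin.last n) (Fin.last n) = 1 := by
  simp [extendLast]

@[simp] lemma extendLast_last_castSucc (j : Fin n) :
    extendLast T (Fin.last n) j.castSucc = 0 := by simp [extendLast]

@[simp] lemma extendLast_castSucc_last (i : Fin n) :
    extendLast T i.castSucc (Fin.last n) = 0 := by simp [extendLast]

@[simp] lemma extendLast_castSucc_castSucc (i j : Fin n) :
    extendLast T i.castSucc j.castSucc = T i j := by simp [extendLast]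

end extend

lemma IsFRT.extendFirst {A : Type*} [Ring A] [Algebra ℂ A] {q : ℝˣ} {n : ℕ}
    {t s : Fin n → Fin n → A} (h : IsFRT q t s) :
    IsFRT q (extendFirst t) (extendFirst s) where
  rtt := by
    rw [rtt_iff]
    have hR := (rtt_iff q t).mp h.rtt
    intro a b e f
    cases a using Fin.cases <;> cases b using Fin.cases <;> cases e using Fin.cases <;>
      cases f using Fin.cases <;>
      try simp [Fin.succ_ne_zero, (Fin.succ_ne_zero _).symm, -Complex.coe_smul]
    rename_i a b e f
    simpa using hR a b e f
  ts i j := by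
    cases i using Fin.cases <;> cases j using Fin.cases <;>
      simp [Fin.sum_univ_succ, h.ts, Fin.succ_ne_zero, (Fin.succ_ne_zero _).symm]
  st i j := by
    cases i using Fin.cases <;> cases j using Fin.cases <;>
      simp [Fin.sum_univ_succ, h.st, Fin.succ_ne_zero, (Fin.succ_ne_zero _).symm]

lemma IsFRT.extendLast {A : Type*} [Ring A] [Algebra ℂ A] {q : ℝˣ} {n : ℕ}
    {t s : Fin n → Fin n → A} (h : IsFRT q t s) :
    IsFRT q (extendLast t) (extendLast s) where
  rtt := by
    rw [rtt_iff]
    have hR := (rtt_iff q t).mp h.rtt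
    intro a b e f
    cases a using Fin.lastCases <;> cases b using Fin.lastCases <;>
      cases e using Fin.lastCases <;> cases f using Fin.lastCases <;>
      try simp [Fin.castSucc_ne_last, (Fin.castSucc_ne_last _).symm, Fin.castSucc_lt_last,
        not_lt.mpr (Fin.castSucc_lt_last _).le, -Complex.coe_smul]
    rename_i a b e f
    simpa using hR a b e f
  ts i j := by
    cases i using Fin.lastCases <;> cases j using Fin.lastCases <;>
      simp [Fin.sum_univ_castSucc, h.ts, Fin.castSucc_ne_last, (Fin.castSucc_ne_last _).symm]
  st i j := by
    cases i using Fin.lastCases <;> cases j using Fin.lastCases <;>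
      simp [Fin.sum_univ_castSucc, h.st, Fin.castSucc_ne_last, (Fin.castSucc_ne_last _).symm]

namespace Uq

/-- The `*`-Hopf algebra morphism `α_{n+1} : U_q(n+1) → U_q(n)`, the quotient by `t^1_1 = 1` and
`t^1_i = t^i_1 = 0` for `i > 1`. -/
def alpha (q : ℝˣ) (n : ℕ) : Uq q (n + 1) →⋆ₐ[ℂ] Uq q n :=
  toStarHom (lift (isFRT q n).extendFirst) (by
    intro i j
    rw [lift_t, lift_s]
    cases i using Fin.cases <;> cases j using Fin.cases <;> simp)

/-- The `*`-Hopf algebra morphism `α'_{n+1} : U_q(n+1) → U_q(n)`, the quotient by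
`t^{n+1}_{n+1} = 1` and `t^{n+1}_i = t^i_{n+1} = 0` for `i ≤ n`. -/
def alpha' (q : ℝˣ) (n : ℕ) : Uq q (n + 1) →⋆ₐ[ℂ] Uq q n :=
  toStarHom (lift (isFRT q n).extendLast) (by
    intro i j
    rw [lift_t, lift_s]
    cases i using Fin.lastCases <;> cases j using Fin.lastCases <;> simp)

/-- The composition `α_2 ∘ α_3 ∘ … ∘ α_{n+1} : U_q(n+1) → U_q(1)`. -/
def alphaIter (q : ℝˣ) : (n : ℕ) → Uq q (n + 1) →⋆ₐ[ℂ] Uq q 1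
  | 0 => StarAlgHom.id ℂ (Uq q 1)
  | n + 1 => (alphaIter q n).comp (alpha q (n + 1))

/-- `((α_2 ∘ … ∘ α_{n+1}) ⊗ α'_{n+1}) ∘ Δ : U_q(n+1) → U_q(1) ⊗ U_q(n)`, the morphism
`α_{1,n+1}`. -/
def alphaOne (q : ℝˣ) (n : ℕ) : Uq q (n + 1) →⋆ₐ[ℂ] Uq q 1 ⊗[ℂ] Uq q n :=
  toStarHom ((Algebra.TensorProduct.map (alphaIter q n).toAlgHom (alpha' q n).toAlgHom).comp
    (Bialgebra.comulAlgHom ℂ (Uq q (n + 1)))) (by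
    intro i j
    simp [map_sum, star_sum, ← map_star])

/-- The left coaction `(α_{1,n+1} ⊗ id) ∘ Δ` of `U_q(1) ⊗ U_q(n)` on `U_q(n+1)`. -/
def coaction (q : ℝˣ) (n : ℕ) :
    Uq q (n + 1) →⋆ₐ[ℂ] (Uq q 1 ⊗[ℂ] Uq q n) ⊗[ℂ] Uq q (n + 1) :=
  toStarHom ((Algebra.TensorProduct.map (alphaOne q n).toAlgHom (AlgHom.id ℂ (Uq q (n + 1)))).comp
    (Bialgebra.comulAlgHom ℂ (Uq q (n + 1)))) (by
    intro i j
    simp [map_sum, star_sum, ← map_star])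

/-- The `*`-algebra `U_q(n+1)^{U_q(1) ⊗ U_q(n)}` of elements `u` with coaction `u ↦ 1 ⊗ u`. -/
def invariants (q : ℝˣ) (n : ℕ) : StarSubalgebra ℂ (Uq q (n + 1)) :=
  StarAlgHom.equalizer (coaction q n) (inrStar (Uq q 1 ⊗[ℂ] Uq q n) (Uq q (n + 1)))

end Uq

/-! ### Quantum principal bundles -/

section bundle

variable {A P : Type*} [Ring A] [HopfAlgebra ℂ A] [Ring P] [Algebra ℂ P]

/-- The map `χ : P ⊗ P → A ⊗ P`, `χ(u ⊗ v) = β(u) (1 ⊗ v)`. -/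
def canonicalMap (β : P →ₐ[ℂ] A ⊗[ℂ] P) : P ⊗[ℂ] P →ₗ[ℂ] A ⊗[ℂ] P :=
  LinearMap.mul' ℂ (A ⊗[ℂ] P) ∘ₗ TensorProduct.map β.toLinearMap
    (Algebra.TensorProduct.includeRight : P →ₐ[ℂ] A ⊗[ℂ] P).toLinearMap

/-- The universal one-forms `Γ_P = ker (· : P ⊗ P → P)`. -/
def universalForms (P : Type*) [Ring P] [Algebra ℂ P] : Submodule ℂ (P ⊗[ℂ] P) :=
  LinearMap.ker (LinearMap.mul' ℂ P)

/-- The horizontal forms `P Γ_B P`, the sub-bimodule of `Γ_P` generated by the image of the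
universal one-forms on `B`. -/
def horizontalForms (B : Subalgebra ℂ P) : Submodule ℂ (P ⊗[ℂ] P) :=
  Submodule.span ℂ {y | ∃ (u v : P) (ω : B ⊗[ℂ] B), ω ∈ universalForms B ∧
    y = (u ⊗ₜ[ℂ] 1) * Algebra.TensorProduct.map B.val B.val ω * (1 ⊗ₜ[ℂ] v)}

/-- `P` is a quantum principal bundle (with the universal calculus), with structure quantum group
the Hopf algebra `A`, base `B` and left coaction `β`. -/
structure IsQuantumPrincipalBundle (β : P →ₐ[ℂ] A ⊗[ℂ] P) (B : Subalgebra ℂ P) : Prop where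
  /-- `β` is a coaction: coassociativity; it is an algebra map by its type. -/
  coassoc : ∀ u, TensorProduct.assoc ℂ A A P ((Coalgebra.comul (R := ℂ)).rTensor P (β u)) =
    β.toLinearMap.lTensor A (β u)
  /-- `β` is a coaction: counitality. -/
  counit : ∀ u, TensorProduct.lid ℂ P ((Coalgebra.counit (R := ℂ)).rTensor P (β u)) = u
  /-- The base is the algebra of invariant elements. -/
  base : ∀ u, u ∈ B ↔ β u = 1 ⊗ₜ[ℂ] u
  /-- Freeness. -/
  free : Function.Surjective (canonicalMap β)
  /-- Exactness: the kernel of `χ` on `Γ_P` consists of the horizontal forms. -/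
  exact : LinearMap.ker (canonicalMap β) ⊓ universalForms P = horizontalForms B

end bundle

end QuantumProjective

end

open QuantumProjective

open scoped TensorProduct

noncomputable section

namespace QuantumProjective

open MulOpposite

/-! Notation: N = n + 1, P = U_q(N), A = U_q(1) ⊗ U_q(n), π = `alphaOne` : P → A, and B =
`projAlgebra`, the algebra generated by the products s^i_N t^N_j. On generators π is block diagonal:
the upper n × n block of t goes to 1 ⊗ t, the corner t^N_N to z ⊗ 1, and the remaining entries of
the last row and column to 0.

Bundle. The map u ⊗ v ↦ u₁ ⊗ u₂ v on P ⊗ P is bijective with inverse u ⊗ v ↦ u₁ ⊗ S(u₂) v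
(`translation`), and χ is this bijection followed by π ⊗ id. Hence χ is surjective because π is, and
ker χ is the image of ker π ⊗ P under `translation`. Two facts about B finish the argument. First,
ker π lies in the left ideal P B⁺, where B⁺ = B ∩ ker ε: the off-diagonal entries of the last row
and column generate a left ideal that is in fact two-sided, A maps to the quotient by it, and so ker
π is contained in it (`mem_offDiagIdeal_of_alphaOne_eq_zero`); these entries are in P B⁺ because t s
= 1 (`offDiagIdeal_le`). Second, Δ(B) ⊆ B ⊗ P, so for b in B⁺ the element b₁ ⊗ S(b₂) of B ⊗ P has
product ε(b) = 0 and is horizontal. Therefore ker χ ⊆ P Γ_B P (`ker_canonicalMap_coaction_le`), and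
since B consists of invariants, exactness follows for the algebra of all invariants.

Base. To see that the invariants are no more than B, take a right B-linear projection E of P onto B.
If u is invariant, u ⊗ 1 - 1 ⊗ u lies in ker χ ⊆ P Γ_B P, and p ⊗ p' ↦ E(p) p' kills P Γ_B P; hence
u = E(u) is in B (`invariants_eq_projAlgebra`). The projection E is orthogonal for ⟪x, y⟫ = h(y
x^*), where h is the Haar functional. P is spanned by coefficients of unitary corepresentations, so
it is semisimple as a comodule and h exists (`exists_haar`). Positivity and faithfulness
(`haar_pos`) come from the Gram matrix of a corepresentation: it is an intertwiner, and its weighted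
trace is known explicitly.

Sphere. The last row of t and the last column of s satisfy the sphere relations, which gives ι. It
is equivariant, and its image contains the generators of B, so CP_q is mapped onto the invariants.
Injectivity of ι is a PBW argument: ordered monomials of two consecutive degrees suffice to write
any element of the sphere, because v^a g_a^b x_b = 1 has degree two (`exists_orderedMonomial_span`),
and their images stay independent in an explicit representation by shift operators
(`exists_isFRT_independent`). -/

/-! ### Universal forms on a Hopf algebra -/

section hopfForms

variable {P : Type*} [Ring P] [HopfAlgebra ℂ P]

/-- The linear map `u ↦ u₁ ⊗ S(u₂)`. -/
def comulAntipode (P : Type*) [Ring P] [HopfAlgebra ℂ P] : P →ₗ[ℂ] P ⊗[ℂ] P :=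
  (HopfAlgebra.antipode ℂ (A := P)).lTensor P ∘ₗ Coalgebra.comul

/-- The linear map `u ⊗ v ↦ u₁ ⊗ S(u₂) v`. -/
def translation (P : Type*) [Ring P] [HopfAlgebra ℂ P] : P ⊗[ℂ] P →ₗ[ℂ] P ⊗[ℂ] P :=
  LinearMap.mul' ℂ (P ⊗[ℂ] P) ∘ₗ TensorProduct.map (comulAntipode P)
    (Algebra.TensorProduct.includeRight : P →ₐ[ℂ] P ⊗[ℂ] P).toLinearMap

/-- The linear map `u ⊗ v ↦ u₁ ⊗ u₂ v`. -/
abbrev galoisMap (P : Type*) [Ring P] [HopfAlgebra ℂ P] : P ⊗[ℂ] P →ₗ[ℂ] P ⊗[ℂ] P :=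
  canonicalMap (Bialgebra.comulAlgHom ℂ P)

lemma translation_tmul (u v : P) :
    translation P (u ⊗ₜ v) = comulAntipode P u * (1 ⊗ₜ v) := rfl

lemma canonicalMap_tmul {A P : Type*} [Ring A] [HopfAlgebra ℂ A] [Ring P] [Algebra ℂ P]
    (β : P →ₐ[ℂ] A ⊗[ℂ] P) (u v : P) : canonicalMap β (u ⊗ₜ v) = β u * (1 ⊗ₜ v) := rfl

/-- The composed form lets coassociativity and the antipode axioms, which are stated through
`lTensor` and `rTensor`, be used as rewrite rules. -/
lemma galoisMap_eq : galoisMap P = (LinearMap.mul' ℂ P).lTensor P ∘ₗ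
    (TensorProduct.assoc ℂ P P P).toLinearMap ∘ₗ Coalgebra.comul.rTensor P := by
  ext u v
  simp only [TensorProduct.AlgebraTensorModule.curry_apply, TensorProduct.curry_apply,
    LinearMap.coe_restrictScalars, canonicalMap_tmul, LinearMap.comp_apply,
    LinearMap.rTensor_tmul, LinearEquiv.coe_coe, Bialgebra.comulAlgHom_apply]
  generalize (Coalgebra.comul u : P ⊗[ℂ] P) = X
  induction X using TensorProduct.induction_on with
  | zero => simp
  | tmul a b => simp
  | add x y hx hy => simp only [add_mul, TensorProduct.add_tmul, map_add, hx, hy]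

lemma translation_eq : translation P =
    (LinearMap.mul' ℂ P ∘ₗ (HopfAlgebra.antipode ℂ (A := P)).rTensor P).lTensor P ∘ₗ
    (TensorProduct.assoc ℂ P P P).toLinearMap ∘ₗ Coalgebra.comul.rTensor P := by
  ext u v
  simp only [TensorProduct.AlgebraTensorModule.curry_apply, TensorProduct.curry_apply,
    LinearMap.coe_restrictScalars, translation_tmul, LinearMap.comp_apply, comulAntipode,
    LinearMap.rTensor_tmul, LinearEquiv.coe_coe]
  generalize (Coalgebra.comul u : P ⊗[ℂ] P) = X
  induction X using TensorProduct.induction_on with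
  | zero => simp
  | tmul a b => simp
  | add x y hx hy => simp only [add_mul, TensorProduct.add_tmul, map_add, hx, hy]

lemma canonicalMap_mul_right {A P : Type*} [Ring A] [HopfAlgebra ℂ A] [Ring P] [Algebra ℂ P]
    (β : P →ₐ[ℂ] A ⊗[ℂ] P) (X : P ⊗[ℂ] P) (v : P) :
    canonicalMap β (X * (1 ⊗ₜ v)) = canonicalMap β X * (1 ⊗ₜ v) := by
  induction X using TensorProduct.induction_on with
  | zero => simp
  | tmul a b => simp [canonicalMap_tmul, mul_assoc]
  | add x y hx hy => simp only [add_mul, map_add, hx, hy]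

lemma canonicalMap_mul_left {A P : Type*} [Ring A] [HopfAlgebra ℂ A] [Ring P] [Algebra ℂ P]
    (β : P →ₐ[ℂ] A ⊗[ℂ] P) (X : P ⊗[ℂ] P) (u : P) :
    canonicalMap β ((u ⊗ₜ 1) * X) = β u * canonicalMap β X := by
  induction X using TensorProduct.induction_on with
  | zero => simp
  | tmul a b => simp [canonicalMap_tmul, mul_assoc]
  | add x y hx hy => simp only [mul_add, map_add, hx, hy]

lemma translation_mul_right (X : P ⊗[ℂ] P) (v : P) :
    translation P (X * (1 ⊗ₜ v)) = translation P X * (1 ⊗ₜ v) := by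
  induction X using TensorProduct.induction_on with
  | zero => simp
  | tmul a b => simp [translation_tmul, mul_assoc]
  | add x y hx hy => simp only [add_mul, map_add, hx, hy]

lemma translation_galoisMap (X : P ⊗[ℂ] P) : translation P (galoisMap P X) = X := by
  have key : ∀ u : P, translation P (Coalgebra.comul u) = u ⊗ₜ[ℂ] (1 : P) := by
    intro u
    -- u₁ ⊗ S(u₂) u₃ = u₁ ⊗ ε(u₂) 1 = u ⊗ 1.
    rw [translation_eq, LinearMap.comp_apply, LinearMap.comp_apply, LinearEquiv.coe_coe,
      Coalgebra.coassoc_apply, ← LinearMap.lTensor_comp_apply, LinearMap.comp_assoc,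
      HopfAlgebra.mul_antipode_rTensor_comul, LinearMap.lTensor_comp_apply,
      Coalgebra.lTensor_counit_comul]
    simp
  induction X using TensorProduct.induction_on with
  | zero => simp
  | tmul a b =>
    rw [canonicalMap_tmul, translation_mul_right, Bialgebra.comulAlgHom_apply, key]
    simp
  | add x y hx hy => simp only [map_add, hx, hy]

lemma galoisMap_translation (X : P ⊗[ℂ] P) : galoisMap P (translation P X) = X := by
  have key : ∀ u : P, galoisMap P (comulAntipode P u) = u ⊗ₜ[ℂ] (1 : P) := by
    intro u
    have h : ∀ Y : P ⊗[ℂ] P, galoisMap P ((HopfAlgebra.antipode ℂ (A := P)).lTensor P Y) =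
        (LinearMap.mul' ℂ P ∘ₗ (HopfAlgebra.antipode ℂ (A := P)).lTensor P).lTensor P
        (TensorProduct.assoc ℂ P P P (Coalgebra.comul.rTensor P Y)) := by
      intro Y
      induction Y using TensorProduct.induction_on with
      | zero => simp
      | tmul a b =>
        rw [galoisMap_eq]
        simp only [LinearMap.lTensor_tmul, LinearMap.comp_apply, LinearMap.rTensor_tmul,
          LinearEquiv.coe_coe]
        generalize (Coalgebra.comul a : P ⊗[ℂ] P) = X
        induction X using TensorProduct.induction_on with
        | zero => simp
        | tmul a b => simp
        | add x y hx hy => simp only [TensorProduct.add_tmul, map_add, hx, hy]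
      | add x y hx hy => simp only [map_add, hx, hy]
    -- The same computation with the other antipode axiom: u₁ ⊗ u₂ S(u₃) = u ⊗ 1.
    rw [comulAntipode, LinearMap.comp_apply, h, Coalgebra.coassoc_apply,
      ← LinearMap.lTensor_comp_apply, LinearMap.comp_assoc,
      HopfAlgebra.mul_antipode_lTensor_comul, LinearMap.lTensor_comp_apply,
      Coalgebra.lTensor_counit_comul]
    simp
  induction X using TensorProduct.induction_on with
  | zero => simp
  | tmul a b =>
    rw [translation_tmul, canonicalMap_mul_right, key]
    simp
  | add x y hx hy => simp only [map_add, hx, hy]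

end hopfForms

/-! ### Horizontal forms and their relation to the kernel of the canonical map. -/

section horizontal

variable {P : Type*} [Ring P] [Algebra ℂ P]

lemma horizontalForms_mul_right {B : Subalgebra ℂ P} {y : P ⊗[ℂ] P}
    (hy : y ∈ horizontalForms B) (w : P) : y * (1 ⊗ₜ w) ∈ horizontalForms B := by
  induction hy using Submodule.span_induction with
  | mem y h =>
    obtain ⟨u, v, ω, hω, rfl⟩ := h
    exact Submodule.subset_span ⟨u, v * w, ω, hω, by rw [mul_assoc]; simp⟩
  | zero => simp
  | add x y _ _ hx hy => rw [add_mul]; exact add_mem hx hy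
  | smul c x _ hx => rw [smul_mul_assoc]; exact Submodule.smul_mem _ _ hx

lemma horizontalForms_mul_left {B : Subalgebra ℂ P} {y : P ⊗[ℂ] P}
    (hy : y ∈ horizontalForms B) (w : P) : (w ⊗ₜ 1) * y ∈ horizontalForms B := by
  induction hy using Submodule.span_induction with
  | mem y h =>
    obtain ⟨u, v, ω, hω, rfl⟩ := h
    exact Submodule.subset_span ⟨w * u, v, ω, hω, by simp [← mul_assoc]⟩
  | zero => simp
  | add x y _ _ hx hy => rw [mul_add]; exact add_mem hx hy
  | smul c x _ hx => rw [mul_smul_comm]; exact Submodule.smul_mem _ _ hx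

lemma horizontalForms_mono {B C : Subalgebra ℂ P} (h : B ≤ C) :
    horizontalForms B ≤ horizontalForms C := by
  refine Submodule.span_le.mpr ?_
  rintro _ ⟨u, v, ω, hω, rfl⟩
  refine Submodule.subset_span ⟨u, v, Algebra.TensorProduct.map (Subalgebra.inclusion h)
    (Subalgebra.inclusion h) ω, ?_, ?_⟩
  · have e : ∀ ω : B ⊗[ℂ] B, LinearMap.mul' ℂ C (Algebra.TensorProduct.map
        (Subalgebra.inclusion h) (Subalgebra.inclusion h) ω) =
        Subalgebra.inclusion h (LinearMap.mul' ℂ B ω) := by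
      intro ω
      induction ω using TensorProduct.induction_on with
      | zero => simp
      | tmul a b => simp
      | add x y hx hy => simp only [map_add, hx, hy]
    change LinearMap.mul' ℂ C _ = 0
    rw [e, show LinearMap.mul' ℂ B ω = 0 from hω, map_zero]
  · congr 2
    rw [← AlgHom.comp_apply, ← Algebra.TensorProduct.map_comp]
    rfl

/-- The form `b ⊗ 1 - 1 ⊗ b` is horizontal. -/
lemma sub_mem_horizontalForms {B : Subalgebra ℂ P} {b : P} (hb : b ∈ B) :
    b ⊗ₜ[ℂ] (1 : P) - 1 ⊗ₜ b ∈ horizontalForms B := by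
  refine Submodule.subset_span ⟨1, 1, (⟨b, hb⟩ : B) ⊗ₜ 1 - 1 ⊗ₜ ⟨b, hb⟩, ?_, ?_⟩
  · simp [universalForms]
  · simp [← Algebra.TensorProduct.one_def]

/-- Since b ⊗ p = (b ⊗ 1 - 1 ⊗ b)(1 ⊗ p) + 1 ⊗ bp, every Y differs from 1 ⊗ (its product) by a
horizontal form. Only the left leg has to lie in B. -/
lemma mem_horizontalForms_of_mul_eq_zero {B : Subalgebra ℂ P} (Y : B ⊗[ℂ] P)
    (hY : LinearMap.mul' ℂ P (Algebra.TensorProduct.map B.val (AlgHom.id ℂ P) Y) = 0) :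
    Algebra.TensorProduct.map B.val (AlgHom.id ℂ P) Y ∈ horizontalForms B := by
  have key : ∀ Y : B ⊗[ℂ] P, Algebra.TensorProduct.map B.val (AlgHom.id ℂ P) Y -
      1 ⊗ₜ LinearMap.mul' ℂ P (Algebra.TensorProduct.map B.val (AlgHom.id ℂ P) Y) ∈
      horizontalForms B := by
    intro Y
    induction Y using TensorProduct.induction_on with
    | zero => simp
    | tmul b p =>
      have := horizontalForms_mul_right (sub_mem_horizontalForms b.2) p
      simpa [sub_mul] using this
    | add x y hx hy =>
      have := add_mem hx hy
      simp only [map_add, TensorProduct.tmul_add]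
      convert this using 1
      abel
  simpa [hY] using key Y

/-- The easy half of exactness: on B ⊗ B the canonical map is multiplication, because β is trivial
on B, and it is compatible with the outer factors u and v. -/
lemma horizontalForms_le {A : Type*} [Ring A] [HopfAlgebra ℂ A] (β : P →ₐ[ℂ] A ⊗[ℂ] P)
    {B : Subalgebra ℂ P} (hB : ∀ b ∈ B, β b = 1 ⊗ₜ b) :
    horizontalForms B ≤ LinearMap.ker (canonicalMap β) ⊓ universalForms P := by
  refine Submodule.span_le.mpr ?_
  rintro _ ⟨u, v, ω, hω, rfl⟩
  have e1 : ∀ ω : B ⊗[ℂ] B, canonicalMap β (Algebra.TensorProduct.map B.val B.val ω) =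
      1 ⊗ₜ (LinearMap.mul' ℂ B ω : P) := by
    intro ω
    induction ω using TensorProduct.induction_on with
    | zero => simp
    | tmul a b => simp [canonicalMap_tmul, hB a a.2]
    | add x y hx hy => simp only [map_add, hx, hy, Subalgebra.coe_add, TensorProduct.tmul_add]
  have e2 : ∀ ω : B ⊗[ℂ] B, LinearMap.mul' ℂ P ((u ⊗ₜ[ℂ] 1) *
      Algebra.TensorProduct.map B.val B.val ω * (1 ⊗ₜ[ℂ] v)) =
      u * (LinearMap.mul' ℂ B ω : P) * v := by
    intro ω
    induction ω using TensorProduct.induction_on with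
    | zero => simp
    | tmul a b => simp [mul_assoc]
    | add x y hx hy => simp only [map_add, mul_add, add_mul, hx, hy, Subalgebra.coe_add]
  have hω' : LinearMap.mul' ℂ B ω = 0 := hω
  constructor
  · change canonicalMap β _ = 0
    rw [canonicalMap_mul_right, canonicalMap_mul_left, e1, hω']
    simp
  · change LinearMap.mul' ℂ P _ = 0
    rw [e2, hω']
    simp

end horizontal

/-! ### The canonical map of a quotient Hopf algebra. -/

section homogeneous

variable {A P : Type*} [Ring A] [HopfAlgebra ℂ A] [Ring P] [HopfAlgebra ℂ P]

/-- Membership of `u k ⊗ v` in the preimage of the horizontal forms, for `k` in the left ideal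
generated by the augmentation ideal of a right coideal subalgebra. -/
lemma translation_mem_horizontalForms {B : Subalgebra ℂ P}
    (hB : ∀ b ∈ B, Coalgebra.comul (R := ℂ) b ∈
      (Algebra.TensorProduct.map B.val (AlgHom.id ℂ P)).range)
    {k : P} (hk : k ∈ Ideal.span {b : P | b ∈ B ∧ Coalgebra.counit (R := ℂ) b = 0}) (v : P) :
    translation P (k ⊗ₜ v) ∈ horizontalForms B := by
  rw [translation_tmul]
  apply horizontalForms_mul_right
  -- A free factor p on the left makes the claim stable under left multiplication, so induction over
  -- the left ideal closes.
  suffices ∀ p : P, comulAntipode P (p * k) ∈ horizontalForms B by simpa using this 1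
  clear v
  -- To be used with X = Δ(p), Z = Δ(b) and the antipode: p₁ b₁ ⊗ S(b₂) S(p₂) arises from b₁ ⊗ S(b₂)
  -- by outer multiplications only, and these preserve horizontal forms.
  have hmul : ∀ X Y : P ⊗[ℂ] P, (∀ p : P, Y * (1 ⊗ₜ p) ∈ horizontalForms B) →
      ∀ S : P →ₗ[ℂ] P, (∀ a b : P, S (a * b) = S b * S a) → ∀ Z : P ⊗[ℂ] P,
      S.lTensor P Z = Y → S.lTensor P (X * Z) ∈ horizontalForms B := by
    intro X Y hY S hS Z hZ
    have : ∀ (a b : P) (Z : P ⊗[ℂ] P), S.lTensor P ((a ⊗ₜ b) * Z) =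
        (a ⊗ₜ 1) * (S.lTensor P Z * (1 ⊗ₜ S b)) := by
      intro a b Z
      induction Z using TensorProduct.induction_on with
      | zero => simp
      | tmul x y => simp [hS]
      | add x y hx hy => simp only [mul_add, map_add, hx, hy, add_mul]
    induction X using TensorProduct.induction_on with
    | zero => simp
    | tmul a b =>
      rw [this, hZ]
      exact horizontalForms_mul_left (hY _) _
    | add x y hx hy => rw [add_mul, map_add]; exact add_mem hx hy
  induction hk using Submodule.span_induction with
  | mem b hb =>
    obtain ⟨hb, hε⟩ := hb
    intro p
    -- The coideal property keeps b₁ ⊗ S(b₂) in B ⊗ P, and its product is ε(b) = 0.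
    have h0 : comulAntipode P b ∈ horizontalForms B := by
      obtain ⟨Y, hY⟩ := hB b hb
      have e : comulAntipode P b = Algebra.TensorProduct.map B.val (AlgHom.id ℂ P)
          ((HopfAlgebra.antipode ℂ (A := P)).lTensor B Y) := by
        rw [comulAntipode, LinearMap.comp_apply, ← hY]
        clear hY
        induction Y using TensorProduct.induction_on with
        | zero => simp
        | tmul x y => simp
        | add x y hx hy => simp only [map_add, RingHom.map_add] at hx hy ⊢; rw [hx, hy]
      have e' : LinearMap.mul' ℂ P (comulAntipode P b) = 0 := by
        have := HopfAlgebra.mul_antipode_lTensor_comul_apply (R := ℂ) b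
        rw [hε, map_zero] at this
        exact this
      rw [e] at e' ⊢
      exact mem_horizontalForms_of_mul_eq_zero _ e'
    rw [comulAntipode, LinearMap.comp_apply, Bialgebra.comul_mul]
    exact hmul _ _ (fun p => horizontalForms_mul_right h0 p) _
      (fun a b => HopfAlgebra.antipode_mul_antidistrib a b) _ rfl
  | zero => simp
  | add x y _ _ hx hy => intro p; rw [mul_add, map_add]; exact add_mem (hx p) (hy p)
  | smul c x _ hx => intro p; rw [smul_eq_mul, ← mul_assoc]; exact hx _

/-- For a coaction induced by π the canonical map factors through the bijective `galoisMap`, so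
surjectivity and kernel are read off from π ⊗ id. -/
lemma canonicalMap_eq (π : P →ₐ[ℂ] A) :
    canonicalMap ((Algebra.TensorProduct.map π (AlgHom.id ℂ P)).comp
      (Bialgebra.comulAlgHom ℂ P)) = π.toLinearMap.rTensor P ∘ₗ galoisMap P := by
  ext u v
  simp only [TensorProduct.AlgebraTensorModule.curry_apply, TensorProduct.curry_apply,
    LinearMap.coe_restrictScalars, canonicalMap_tmul, LinearMap.comp_apply, AlgHom.comp_apply]
  generalize (Bialgebra.comulAlgHom ℂ P u : P ⊗[ℂ] P) = X
  induction X using TensorProduct.induction_on with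
  | zero => simp
  | tmul a b => simp
  | add x y hx hy => simp only [add_mul, map_add, hx, hy]

lemma canonicalMap_surjective {π : P →ₐ[ℂ] A} (hπ : Function.Surjective π) :
    Function.Surjective (canonicalMap ((Algebra.TensorProduct.map π (AlgHom.id ℂ P)).comp
      (Bialgebra.comulAlgHom ℂ P))) := by
  rw [canonicalMap_eq]
  exact (LinearMap.rTensor_surjective P (g := π.toLinearMap) hπ).comp
    fun X => ⟨translation P X, galoisMap_translation X⟩

/-- By right exactness of the tensor product the kernel of π ⊗ id is the image of ker π ⊗ P;
`translation` carries it into the horizontal forms. -/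
lemma ker_canonicalMap_le {π : P →ₐ[ℂ] A} (hπ : Function.Surjective π) {B : Subalgebra ℂ P}
    (hB : ∀ b ∈ B, Coalgebra.comul (R := ℂ) b ∈
      (Algebra.TensorProduct.map B.val (AlgHom.id ℂ P)).range)
    (hk : ∀ k, π k = 0 → k ∈ Ideal.span {b : P | b ∈ B ∧ Coalgebra.counit (R := ℂ) b = 0}) :
    LinearMap.ker (canonicalMap ((Algebra.TensorProduct.map π (AlgHom.id ℂ P)).comp
      (Bialgebra.comulAlgHom ℂ P))) ≤ horizontalForms B := by
  intro y hy
  rw [canonicalMap_eq, LinearMap.mem_ker, LinearMap.comp_apply] at hy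
  rw [← translation_galoisMap y]
  have hex : Function.Exact (LinearMap.ker π.toLinearMap).subtype π.toLinearMap :=
    LinearMap.exact_subtype_ker_map _
  obtain ⟨Z, hZ⟩ := (rTensor_exact P hex hπ (galoisMap P y)).mp hy
  rw [← hZ]
  clear hZ hy
  induction Z using TensorProduct.induction_on with
  | zero => simp
  | tmul a b =>
    rw [LinearMap.rTensor_tmul]
    exact translation_mem_horizontalForms hB (hk _ a.2) b
  | add x y hx hy => rw [map_add, map_add]; exact add_mem hx hy

end homogeneous

namespace Uq

/-! ### The projection onto the structure quantum group -/

section projection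

variable (q : ℝˣ)

@[simp] lemma alpha_t {n : ℕ} (i j : Fin (n + 1)) :
    alpha q n (t q i j) = extendFirst (t q) i j := lift_t (isFRT q n).extendFirst i j

@[simp] lemma alpha'_t {n : ℕ} (i j : Fin (n + 1)) :
    alpha' q n (t q i j) = extendLast (t q) i j := lift_t (isFRT q n).extendLast i j

/-- Each `alpha` replaces the first diagonal entry by 1 and clears its row and column, so in the end
only the last diagonal entry survives as z. This is what makes `alphaOne` block diagonal. -/
lemma alphaIter_t (n : ℕ) (i j : Fin (n + 1)) : alphaIter q n (t q i j) =
    if i = j then (if j = Fin.last n then t q 0 0 else 1) else 0 := by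
  induction n with
  | zero =>
    fin_cases i
    fin_cases j
    rfl
  | succ n ih =>
    rw [alphaIter, StarAlgHom.comp_apply, alpha_t, ← Fin.succ_last]
    cases i using Fin.cases <;> cases j using Fin.cases <;>
      simp only [extendFirst_zero_zero, extendFirst_zero_succ, extendFirst_succ_zero,
        extendFirst_succ_succ, Fin.succ_ne_zero, (Fin.succ_ne_zero _).symm, ih, Fin.succ_inj,
        map_one, map_zero, if_true, if_false]

@[simp] lemma alphaOne_castSucc_castSucc {n : ℕ} (i j : Fin n) :
    alphaOne q n (t q i.castSucc j.castSucc) = 1 ⊗ₜ t q i j := by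
  change Algebra.TensorProduct.map (alphaIter q n).toAlgHom (alpha' q n).toAlgHom
    (Coalgebra.comul (t q _ _)) = _
  simp [map_sum, alphaIter_t, Fin.sum_univ_castSucc, Fin.castSucc_ne_last,
    TensorProduct.ite_tmul]

@[simp] lemma alphaOne_castSucc_last {n : ℕ} (i : Fin n) :
    alphaOne q n (t q i.castSucc (Fin.last n)) = 0 := by
  change Algebra.TensorProduct.map (alphaIter q n).toAlgHom (alpha' q n).toAlgHom
    (Coalgebra.comul (t q _ _)) = _
  simp [map_sum, alphaIter_t, Fin.sum_univ_castSucc, Fin.castSucc_ne_last]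

@[simp] lemma alphaOne_last_castSucc {n : ℕ} (i : Fin n) :
    alphaOne q n (t q (Fin.last n) i.castSucc) = 0 := by
  change Algebra.TensorProduct.map (alphaIter q n).toAlgHom (alpha' q n).toAlgHom
    (Coalgebra.comul (t q _ _)) = _
  simp [map_sum, alphaIter_t, Fin.sum_univ_castSucc, (Fin.castSucc_ne_last _).symm]

@[simp] lemma alphaOne_last_last (n : ℕ) :
    alphaOne q n (t q (Fin.last n) (Fin.last n)) = t q 0 0 ⊗ₜ 1 := by
  change Algebra.TensorProduct.map (alphaIter q n).toAlgHom (alpha' q n).toAlgHom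
    (Coalgebra.comul (t q _ _)) = _
  simp [map_sum, alphaIter_t, Fin.sum_univ_castSucc, (Fin.castSucc_ne_last _).symm]

lemma alphaOne_s {n : ℕ} (i j : Fin (n + 1)) :
    alphaOne q n (s q i j) = star (alphaOne q n (t q j i)) := by
  rw [← map_star, star_t]

lemma alphaOne_surjective (n : ℕ) : Function.Surjective (alphaOne q n) := by
  intro X
  have h1 : ∀ a : Uq q 1, a ⊗ₜ[ℂ] (1 : Uq q n) ∈ (alphaOne q n).toAlgHom.range := by
    intro a
    induction a using induction with
    | halg r =>
      exact Subalgebra.algebraMap_mem (alphaOne q n).toAlgHom.range r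
    | ht i j =>
      rw [Subsingleton.elim i 0, Subsingleton.elim j 0]
      exact ⟨_, alphaOne_last_last q n⟩
    | hs i j =>
      rw [Subsingleton.elim i 0, Subsingleton.elim j 0]
      exact ⟨s q (Fin.last n) (Fin.last n), (alphaOne_s q _ _).trans (by simp)⟩
    | hmul a b ha hb =>
      have := mul_mem ha hb
      rwa [Algebra.TensorProduct.tmul_mul_tmul, one_mul] at this
    | hadd a b ha hb => rw [TensorProduct.add_tmul]; exact add_mem ha hb
  have h2 : ∀ b : Uq q n, (1 : Uq q 1) ⊗ₜ[ℂ] b ∈ (alphaOne q n).toAlgHom.range := by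
    intro b
    induction b using induction with
    | halg r =>
      rw [Algebra.algebraMap_eq_smul_one, ← TensorProduct.smul_tmul,
        ← Algebra.algebraMap_eq_smul_one]
      exact Subalgebra.algebraMap_mem (alphaOne q n).toAlgHom.range r
    | ht i j => exact ⟨_, alphaOne_castSucc_castSucc q i j⟩
    | hs i j => exact ⟨s q i.castSucc j.castSucc, (alphaOne_s q _ _).trans (by simp)⟩
    | hmul a b ha hb =>
      have := mul_mem ha hb
      rwa [Algebra.TensorProduct.tmul_mul_tmul, one_mul] at this
    | hadd a b ha hb => rw [TensorProduct.tmul_add]; exact add_mem ha hb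
  change X ∈ (alphaOne q n).toAlgHom.range
  induction X using TensorProduct.induction_on with
  | zero => exact zero_mem _
  | tmul a b =>
    have := mul_mem (h1 a) (h2 b)
    rwa [Algebra.TensorProduct.tmul_mul_tmul, one_mul, mul_one] at this
  | add x y hx hy => exact add_mem hx hy

lemma coaction_apply {n : ℕ} (u : Uq q (n + 1)) : (coaction q n).toAlgHom u =
    Algebra.TensorProduct.map (alphaOne q n).toAlgHom (AlgHom.id ℂ (Uq q (n + 1)))
      (Coalgebra.comul u) := rfl

lemma coaction_t {n : ℕ} (i j : Fin (n + 1)) : (coaction q n).toAlgHom (t q i j) =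
    ∑ k, alphaOne q n (t q i k) ⊗ₜ t q k j := by
  rw [coaction_apply, comul_t, map_sum]
  rfl

lemma coaction_s {n : ℕ} (i j : Fin (n + 1)) : (coaction q n).toAlgHom (s q i j) =
    ∑ k, alphaOne q n (s q k j) ⊗ₜ s q i k := by
  rw [coaction_apply, comul_s, map_sum]
  rfl

lemma comul_alphaOne {n : ℕ} : (Bialgebra.comulAlgHom ℂ (Uq q 1 ⊗[ℂ] Uq q n)).comp
      (alphaOne q n).toAlgHom =
    (Algebra.TensorProduct.map (alphaOne q n).toAlgHom (alphaOne q n).toAlgHom).comp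
      (Bialgebra.comulAlgHom ℂ (Uq q (n + 1))) := by
  apply hom_ext
  · intro i j
    change Coalgebra.comul (R := ℂ) (alphaOne q n (t q i j)) =
      Algebra.TensorProduct.map (alphaOne q n).toAlgHom (alphaOne q n).toAlgHom
        (Coalgebra.comul (R := ℂ) (t q i j))
    rw [comul_t, map_sum, Fin.sum_univ_castSucc]
    cases i using Fin.lastCases <;> cases j using Fin.lastCases <;>
      simp [TensorProduct.comul_tmul, TensorProduct.tmul_sum,
        Algebra.TensorProduct.one_def]
  · intro i j
    change Coalgebra.comul (R := ℂ) (alphaOne q n (s q i j)) =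
      Algebra.TensorProduct.map (alphaOne q n).toAlgHom (alphaOne q n).toAlgHom
        (Coalgebra.comul (R := ℂ) (s q i j))
    rw [comul_s, map_sum, Fin.sum_univ_castSucc]
    cases i using Fin.lastCases <;> cases j using Fin.lastCases <;>
      simp [alphaOne_s, TensorProduct.comul_tmul, TensorProduct.tmul_sum,
        TensorProduct.sum_tmul, Algebra.TensorProduct.one_def]

lemma counit_alphaOne {n : ℕ} (u : Uq q (n + 1)) :
    Coalgebra.counit (R := ℂ) (alphaOne q n u) = Coalgebra.counit (R := ℂ) u := by
  have : (Bialgebra.counitAlgHom ℂ (Uq q 1 ⊗[ℂ] Uq q n)).comp (alphaOne q n).toAlgHom =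
      Bialgebra.counitAlgHom ℂ (Uq q (n + 1)) := by
    apply hom_ext
    · intro i j
      change Coalgebra.counit (R := ℂ) (alphaOne q n (t q i j)) =
        Coalgebra.counit (R := ℂ) (t q i j)
      cases i using Fin.lastCases <;> cases j using Fin.lastCases <;>
        simp [TensorProduct.counit_tmul, Fin.castSucc_ne_last, (Fin.castSucc_ne_last _).symm]
    · intro i j
      change Coalgebra.counit (R := ℂ) (alphaOne q n (s q i j)) =
        Coalgebra.counit (R := ℂ) (s q i j)
      cases i using Fin.lastCases <;> cases j using Fin.lastCases <;>
        simp [alphaOne_s, TensorProduct.counit_tmul, Fin.castSucc_ne_last,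
          (Fin.castSucc_ne_last _).symm]
  exact DFunLike.congr_fun this u

/-- Coassociativity of Δ transported along the bialgebra map `alphaOne`: `e1`, `e2` and `e3` pull
the projections out of the comultiplication, the coaction and the reassociation. -/
lemma coaction_coassoc {n : ℕ} (u : Uq q (n + 1)) :
    TensorProduct.assoc ℂ (Uq q 1 ⊗[ℂ] Uq q n) (Uq q 1 ⊗[ℂ] Uq q n) (Uq q (n + 1))
      ((Coalgebra.comul (R := ℂ)).rTensor (Uq q (n + 1)) ((coaction q n).toAlgHom u)) =
    (coaction q n).toAlgHom.toLinearMap.lTensor (Uq q 1 ⊗[ℂ] Uq q n)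
      ((coaction q n).toAlgHom u) := by
  have e1 : ∀ X : Uq q (n + 1) ⊗[ℂ] Uq q (n + 1), (Coalgebra.comul (R := ℂ)).rTensor (Uq q (n + 1))
      (Algebra.TensorProduct.map (alphaOne q n).toAlgHom (AlgHom.id ℂ (Uq q (n + 1))) X) =
      Algebra.TensorProduct.map (Algebra.TensorProduct.map (alphaOne q n).toAlgHom
        (alphaOne q n).toAlgHom) (AlgHom.id ℂ (Uq q (n + 1)))
        ((Coalgebra.comul (R := ℂ)).rTensor (Uq q (n + 1)) X) := by
    intro X
    induction X using TensorProduct.induction_on with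
    | zero => simp
    | tmul a b =>
      have := DFunLike.congr_fun (comul_alphaOne q (n := n)) a
      exact congrArg (· ⊗ₜ[ℂ] b) this
    | add x y hx hy => simp only [map_add, hx, hy]
  have e2 : ∀ X : Uq q (n + 1) ⊗[ℂ] Uq q (n + 1),
      (coaction q n).toAlgHom.toLinearMap.lTensor (Uq q 1 ⊗[ℂ] Uq q n)
      (Algebra.TensorProduct.map (alphaOne q n).toAlgHom (AlgHom.id ℂ (Uq q (n + 1))) X) =
      Algebra.TensorProduct.map (alphaOne q n).toAlgHom (Algebra.TensorProduct.map
        (alphaOne q n).toAlgHom (AlgHom.id ℂ (Uq q (n + 1))))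
        ((Coalgebra.comul (R := ℂ)).lTensor (Uq q (n + 1)) X) := by
    intro X
    induction X using TensorProduct.induction_on with
    | zero => simp
    | tmul a b => rfl
    | add x y hx hy => simp only [map_add, hx, hy]
  have e3 : ∀ X : (Uq q (n + 1) ⊗[ℂ] Uq q (n + 1)) ⊗[ℂ] Uq q (n + 1),
      TensorProduct.assoc ℂ (Uq q 1 ⊗[ℂ] Uq q n) (Uq q 1 ⊗[ℂ] Uq q n) (Uq q (n + 1))
      (Algebra.TensorProduct.map (Algebra.TensorProduct.map (alphaOne q n).toAlgHom
        (alphaOne q n).toAlgHom) (AlgHom.id ℂ (Uq q (n + 1))) X) =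
      Algebra.TensorProduct.map (alphaOne q n).toAlgHom (Algebra.TensorProduct.map
        (alphaOne q n).toAlgHom (AlgHom.id ℂ (Uq q (n + 1))))
        (TensorProduct.assoc ℂ _ _ _ X) := by
    intro X
    induction X using TensorProduct.induction_on with
    | zero => simp
    | tmul a b =>
      induction a using TensorProduct.induction_on with
      | zero => simp
      | tmul a c => rfl
      | add x y hx hy => simp only [map_add, TensorProduct.add_tmul, hx, hy]
    | add x y hx hy => simp only [map_add, hx, hy]
  rw [coaction_apply, e1, e2, e3, Coalgebra.coassoc_apply]

lemma coaction_counit {n : ℕ} (u : Uq q (n + 1)) :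
    TensorProduct.lid ℂ (Uq q (n + 1)) ((Coalgebra.counit (R := ℂ)).rTensor (Uq q (n + 1))
      ((coaction q n).toAlgHom u)) = u := by
  have e1 : ∀ X : Uq q (n + 1) ⊗[ℂ] Uq q (n + 1), (Coalgebra.counit (R := ℂ)).rTensor (Uq q (n + 1))
      (Algebra.TensorProduct.map (alphaOne q n).toAlgHom (AlgHom.id ℂ (Uq q (n + 1))) X) =
      (Coalgebra.counit (R := ℂ)).rTensor (Uq q (n + 1)) X := by
    intro X
    induction X using TensorProduct.induction_on with
    | zero => simp
    | tmul a b => exact congrArg (· ⊗ₜ[ℂ] b) (counit_alphaOne q a)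
    | add x y hx hy => simp only [map_add, hx, hy]
  rw [coaction_apply, e1, Coalgebra.rTensor_counit_comul]
  simp

end projection

end Uq

namespace Uq

/-! ### The kernel of the projection -/

section kernel

variable (q : ℝˣ) (n : ℕ)

/-- The left ideal of `U_q(n+1)` generated by the entries of the last row and of the last column
of `t`, without the common corner. It is the kernel of the projection to `U_q(1) ⊗ U_q(n)`. -/
def offDiagIdeal : Ideal (Uq q (n + 1)) :=
  Ideal.span {x | ∃ j : Fin n, x = t q (Fin.last n) j.castSucc ∨ x = t q j.castSucc (Fin.last n)}

variable {q n}

lemma t_last_mem (j : Fin n) : t q (Fin.last n) j.castSucc ∈ offDiagIdeal q n :=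
  Ideal.subset_span ⟨j, Or.inl rfl⟩

lemma t_mem_last (j : Fin n) : t q j.castSucc (Fin.last n) ∈ offDiagIdeal q n :=
  Ideal.subset_span ⟨j, Or.inr rfl⟩

/-- Lets one term of a commutation relation be isolated, whatever its nonzero coefficient. -/
lemma smul_mem_ideal_iff {A : Type*} [Ring A] [Algebra ℂ A] (I : Ideal A) {c : ℂ} (hc : c ≠ 0)
    {x : A} : c • x ∈ I ↔ x ∈ I := by
  refine ⟨fun h => ?_, fun h => Submodule.smul_of_tower_mem I c h⟩
  have := Submodule.smul_of_tower_mem I c⁻¹ h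
  rwa [smul_smul, inv_mul_cancel₀ hc, one_smul] at this

lemma rtt (a b e f : Fin n) :
    (if a = b then ((q : ℝ) : ℂ) else 1) • (t q a e * t q b f) +
      (if a < b then ((q : ℝ) : ℂ) - ((q : ℝ) : ℂ)⁻¹ else 0) • (t q b e * t q a f) =
    (if e = f then ((q : ℝ) : ℂ) else 1) • (t q b f * t q a e) +
      (if f < e then ((q : ℝ) : ℂ) - ((q : ℝ) : ℂ)⁻¹ else 0) • (t q b e * t q a f) :=
  (rtt_iff q _).mp (isFRT q n).rtt a b e f

lemma ite_q_ne (p : Prop) [Decidable p] : (if p then ((q : ℝ) : ℂ) else 1) ≠ 0 := by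
  split_ifs
  · exact q_ne q
  · exact one_ne_zero

/-- No row index exceeds N, so the left side of the RTT relation has no correction term, and every
term on the right ends in an off-diagonal entry of the last row. -/
lemma t_last_mul_t_mem (j : Fin n) (b f : Fin (n + 1)) :
    t q (Fin.last n) j.castSucc * t q b f ∈ offDiagIdeal q n := by
  have h := rtt (q := q) (Fin.last n) b j.castSucc f
  rw [if_neg (c := Fin.last n < b) (not_lt.mpr (Fin.le_last b)), zero_smul, add_zero] at h
  rw [← smul_mem_ideal_iff _ (ite_q_ne (q := q) (Fin.last n = b)), h]
  refine add_mem (Submodule.smul_of_tower_mem _ _ (Ideal.mul_mem_left _ _ (t_last_mem j))) ?_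
  split_ifs with hf
  · refine Submodule.smul_of_tower_mem _ _ (Ideal.mul_mem_left _ _ ?_)
    cases f using Fin.lastCases with
    | last => exact absurd hf (not_lt.mpr (Fin.le_last _))
    | cast f => exact t_last_mem f
  · simp

lemma t_mul_t_mem (j : Fin n) (b f : Fin (n + 1)) :
    t q j.castSucc (Fin.last n) * t q b f ∈ offDiagIdeal q n := by
  cases f using Fin.lastCases with
  | last =>
    have h := rtt (q := q) j.castSucc b (Fin.last n) (Fin.last n)
    rw [if_neg (lt_irrefl (Fin.last n)), zero_smul, add_zero, ← eq_sub_iff_add_eq] at h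
    rw [← smul_mem_ideal_iff _ (ite_q_ne (q := q) (j.castSucc = b)), h]
    exact sub_mem (Submodule.smul_of_tower_mem _ _ (Ideal.mul_mem_left _ _ (t_mem_last j)))
      (Submodule.smul_of_tower_mem _ _ (Ideal.mul_mem_left _ _ (t_mem_last j)))
  | cast f =>
    -- For j < b both sides of the relation carry the same correction term, which cancels.
    have lt_case : ∀ (j : Fin n) (b : Fin (n + 1)), j.castSucc < b →
        t q j.castSucc (Fin.last n) * t q b f.castSucc ∈ offDiagIdeal q n := by
      intro j b hjb
      have h := rtt (q := q) j.castSucc b (Fin.last n) f.castSucc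
      rw [if_pos (c := j.castSucc < b) hjb, if_pos (c := f.castSucc < Fin.last n)
        (Fin.castSucc_lt_last f), add_left_inj] at h
      rw [← smul_mem_ideal_iff _ (ite_q_ne (q := q) (j.castSucc = b)), h]
      exact Submodule.smul_of_tower_mem _ _ (Ideal.mul_mem_left _ _ (t_mem_last j))
    rcases lt_trichotomy j.castSucc b with hjb | rfl | hjb
    · exact lt_case j b hjb
    -- In equal rows the correction term is the product itself, and the coefficient that remains is
    -- q - (q - q⁻¹) = q⁻¹.
    · have h := rtt (q := q) j.castSucc j.castSucc (Fin.last n) f.castSucc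
      rw [if_pos rfl, if_neg (lt_irrefl _), zero_smul, add_zero,
        if_pos (c := f.castSucc < Fin.last n) (Fin.castSucc_lt_last f), ← sub_eq_iff_eq_add,
        ← sub_smul, sub_sub_cancel] at h
      rw [← smul_mem_ideal_iff _ (inv_ne_zero (q_ne q)), h]
      exact Submodule.smul_of_tower_mem _ _ (Ideal.mul_mem_left _ _ (t_mem_last j))
    -- For b < j the correction term is t^b_N t^j_f, which the case of increasing rows covers.
    · have h := rtt (q := q) j.castSucc b (Fin.last n) f.castSucc
      rw [if_neg (c := j.castSucc < b) hjb.not_gt, zero_smul, add_zero] at h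
      rw [← smul_mem_ideal_iff _ (ite_q_ne (q := q) (j.castSucc = b)), h]
      refine add_mem (Submodule.smul_of_tower_mem _ _ (Ideal.mul_mem_left _ _ (t_mem_last j)))
        (Submodule.smul_of_tower_mem _ _ ?_)
      cases b using Fin.lastCases with
      | last => exact absurd hjb (not_lt.mpr (Fin.le_last _))
      | cast b => exact lt_case b _ hjb

/-- The exchange relation moves s to the left at the cost of products t^N_d s^d_e with d < j, hence
the induction on j. -/
lemma t_last_mul_s_mem (j : Fin n) (a e : Fin (n + 1)) :
    t q (Fin.last n) j.castSucc * s q a e ∈ offDiagIdeal q n := by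
  induction j using WellFoundedLT.induction generalizing a e with
  | _ j ih =>
    have h := (isFRT q (n + 1)).ts_exchange a (Fin.last n) e j.castSucc
    have h0 : ∑ b, (if Fin.last n < b then s q a b * t q b j.castSucc else 0) = 0 :=
      Finset.sum_eq_zero fun b _ => if_neg (not_lt.mpr (Fin.le_last b))
    rw [h0, smul_zero, add_zero, ← sub_eq_iff_eq_add] at h
    rw [← smul_mem_ideal_iff _ (ite_q_ne (q := q) (j.castSucc = a)), ← h]
    refine sub_mem (Submodule.smul_of_tower_mem _ _ (Ideal.mul_mem_left _ _ (t_last_mem j)))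
      (Submodule.smul_of_tower_mem _ _ (sum_mem fun d _ => ?_))
    split_ifs with hd
    · cases d using Fin.lastCases with
      | last => exact absurd hd (not_lt.mpr (Fin.le_last _))
      | cast d => exact ih d hd _ _
    · exact zero_mem _

/-- The terms with b ≤ j < N that the truncated sum omits are in the ideal, so modulo the ideal it
equals the full sum, given by s t = 1. -/
lemma sum_s_mul_t_sub_mem (j : Fin n) (a : Fin (n + 1)) :
    ∑ b, (if j.castSucc < b then s q a b * t q b (Fin.last n) else 0) -
      (if a = Fin.last n then 1 else 0) ∈ offDiagIdeal q n := by
  rw [← (isFRT q (n + 1)).st a (Fin.last n), ← Finset.sum_sub_distrib]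
  refine sum_mem fun b _ => ?_
  split_ifs with hb
  · simp
  · rw [zero_sub]
    refine neg_mem (Ideal.mul_mem_left _ _ ?_)
    cases b using Fin.lastCases with
    | last => exact absurd (Fin.castSucc_lt_last j) hb
    | cast b => exact t_mem_last b

lemma sum_t_mul_s (c e : Fin (n + 1)) :
    ∑ d, (if d < Fin.last n then t q c d * s q d e else 0) =
      (if c = e then 1 else 0) - t q c (Fin.last n) * s q (Fin.last n) e := by
  rw [← (isFRT q (n + 1)).ts c e, Fin.sum_univ_castSucc, Fin.sum_univ_castSucc]
  simp [Fin.castSucc_lt_last]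

/-- In the exchange relation for the last column the truncated sum of t s is the full one minus the
very product in question, so the relation can be solved for this product. -/
lemma t_mul_s_mem (j : Fin n) (a e : Fin (n + 1)) :
    t q j.castSucc (Fin.last n) * s q a e ∈ offDiagIdeal q n := by
  have h := (isFRT q (n + 1)).ts_exchange a j.castSucc e (Fin.last n)
  rw [sum_t_mul_s] at h
  have hst := Ideal.mul_mem_left _ (s q a e) (t_mem_last (q := q) j)
  have hs := sum_s_mul_t_sub_mem (q := q) j a
  generalize ∑ b, (if j.castSucc < b then s q a b * t q b (Fin.last n) else 0) = X at h hs
  have hq := q_ne q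
  by_cases ha : a = Fin.last n
  · subst ha
    rw [if_pos rfl] at hs
    simp only [if_true] at h
    rw [← smul_mem_ideal_iff _ (inv_ne_zero hq)]
    -- The product occurs with coefficients q and -(q - q⁻¹), together q⁻¹; the constant δ_{je} is
    -- absorbed in X - 1.
    have e1 : ((q : ℝ) : ℂ)⁻¹ • (t q j.castSucc (Fin.last n) * s q (Fin.last n) e) =
        (if j.castSucc = e then ((q : ℝ) : ℂ) else 1) •
          (s q (Fin.last n) e * t q j.castSucc (Fin.last n)) +
        (if j.castSucc = e then ((q : ℝ) : ℂ) - ((q : ℝ) : ℂ)⁻¹ else 0) • (X - 1) := by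
      rw [smul_sub, add_sub, h]
      split_ifs <;> module
    rw [e1]
    exact add_mem (Submodule.smul_of_tower_mem _ _ hst) (Submodule.smul_of_tower_mem _ _ hs)
  · rw [if_neg ha, sub_zero] at hs
    simp only [if_neg (Ne.symm ha), zero_smul, add_zero, one_smul] at h
    rw [← h]
    exact add_mem (Submodule.smul_of_tower_mem _ _ hst) (Submodule.smul_of_tower_mem _ _ hs)

/-- Stability under right multiplication need only be tested on an ideal generator times an algebra
generator. -/
instance : (offDiagIdeal q n).IsTwoSided where
  mul_mem_of_left := by
    have gen : ∀ p : Uq q (n + 1), (∀ j : Fin n,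
        t q (Fin.last n) j.castSucc * p ∈ offDiagIdeal q n ∧
        t q j.castSucc (Fin.last n) * p ∈ offDiagIdeal q n) →
        ∀ x ∈ offDiagIdeal q n, x * p ∈ offDiagIdeal q n := by
      intro p hp x hx
      induction hx using Submodule.span_induction with
      | mem x h =>
        obtain ⟨j, rfl | rfl⟩ := h
        · exact (hp j).1
        · exact (hp j).2
      | zero => simp
      | add x y _ _ hx hy => rw [add_mul]; exact add_mem hx hy
      | smul c x _ hx => rw [smul_eq_mul, mul_assoc]; exact Ideal.mul_mem_left _ _ hx
    intro x p hx
    induction p using induction generalizing x with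
    | halg r => rw [← Algebra.commutes]; exact Ideal.mul_mem_left _ _ hx
    | ht a b => exact gen _ (fun j => ⟨t_last_mul_t_mem j a b, t_mul_t_mem j a b⟩) x hx
    | hs a b => exact gen _ (fun j => ⟨t_last_mul_s_mem j a b, t_mul_s_mem j a b⟩) x hx
    | hmul a b ha hb => rw [← mul_assoc]; exact hb (ha hx)
    | hadd a b ha hb => rw [mul_add]; exact add_mem (ha hx) (hb hx)

variable (q n) in
/-- The quotient map by the off-diagonal entries. -/
def quot : Uq q (n + 1) →ₐ[ℂ] Uq q (n + 1) ⧸ offDiagIdeal q n :=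
  Ideal.Quotient.mkₐ ℂ (offDiagIdeal q n)

lemma quot_eq_zero {x : Uq q (n + 1)} : quot q n x = 0 ↔ x ∈ offDiagIdeal q n :=
  Ideal.Quotient.eq_zero_iff_mem

lemma quot_t_last (j : Fin n) : quot q n (t q (Fin.last n) j.castSucc) = 0 :=
  quot_eq_zero.mpr (t_last_mem j)

lemma quot_t_castSucc (j : Fin n) : quot q n (t q j.castSucc (Fin.last n)) = 0 :=
  quot_eq_zero.mpr (t_mem_last j)

lemma quot_z_mul (j : Fin (n + 1)) :
    quot q n (t q (Fin.last n) (Fin.last n)) * quot q n (s q (Fin.last n) j) =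
      if Fin.last n = j then 1 else 0 := by
  have h := congrArg (quot q n) ((isFRT q (n + 1)).ts (Fin.last n) j)
  simp only [map_add, map_sum, map_mul, Fin.sum_univ_castSucc, quot_t_last, zero_mul,
    Finset.sum_const_zero, zero_add] at h
  rw [h]
  split_ifs <;> simp

lemma quot_mul_z (j : Fin (n + 1)) :
    quot q n (s q j (Fin.last n)) * quot q n (t q (Fin.last n) (Fin.last n)) =
      if j = Fin.last n then 1 else 0 := by
  have h := congrArg (quot q n) ((isFRT q (n + 1)).st j (Fin.last n))
  simp only [map_add, map_sum, map_mul, Fin.sum_univ_castSucc, quot_t_castSucc, mul_zero,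
    Finset.sum_const_zero, zero_add] at h
  rw [h]
  split_ifs <;> simp

/-- In the quotient the corner of t is invertible, so z s^N_j = 0 kills the entry. Thus the entries
of s become block diagonal although only those of t were divided out. -/
lemma quot_s_last (j : Fin n) : quot q n (s q (Fin.last n) j.castSucc) = 0 := by
  have h1 := quot_z_mul (q := q) j.castSucc
  rw [if_neg (Fin.castSucc_ne_last j).symm] at h1
  have h2 := congrArg (quot q n (s q (Fin.last n) (Fin.last n)) * ·) h1
  simpa only [← mul_assoc, quot_mul_z, if_true, one_mul, mul_zero] using h2

lemma quot_s_castSucc (j : Fin n) : quot q n (s q j.castSucc (Fin.last n)) = 0 := by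
  have h1 := quot_mul_z (q := q) j.castSucc
  rw [if_neg (Fin.castSucc_ne_last j)] at h1
  have h2 := congrArg (· * quot q n (s q (Fin.last n) (Fin.last n))) h1
  simpa only [mul_assoc, quot_z_mul, if_true, mul_one, zero_mul] using h2

lemma isFRT_quot_corner : IsFRT q (n := 1)
    (fun _ _ => quot q n (t q (Fin.last n) (Fin.last n)))
    (fun _ _ => quot q n (s q (Fin.last n) (Fin.last n))) where
  rtt := by
    rw [rtt_iff]
    intro a b e f
    simp [Subsingleton.elim a b, Subsingleton.elim e f]
  ts i j := by simp [quot_z_mul, Subsingleton.elim i j]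
  st i j := by simp [quot_mul_z, Subsingleton.elim i j]

lemma isFRT_quot_block : IsFRT q
    (fun i j : Fin n => quot q n (t q i.castSucc j.castSucc))
    (fun i j => quot q n (s q i.castSucc j.castSucc)) where
  rtt := by
    rw [rtt_iff]
    intro a b e f
    have h := congrArg (quot q n) (rtt (q := q) a.castSucc b.castSucc e.castSucc f.castSucc)
    simpa only [map_add, map_smul, map_mul, Fin.castSucc_inj, Fin.castSucc_lt_castSucc_iff] using h
  ts i j := by
    have h := congrArg (quot q n) ((isFRT q (n + 1)).ts i.castSucc j.castSucc)
    simp only [map_add, map_sum, map_mul, Fin.sum_univ_castSucc, quot_t_castSucc, zero_mul, add_zero,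
      Fin.castSucc_inj] at h
    rw [h]
    split_ifs <;> simp
  st i j := by
    have h := congrArg (quot q n) ((isFRT q (n + 1)).st i.castSucc j.castSucc)
    simp only [map_add, map_sum, map_mul, Fin.sum_univ_castSucc, quot_s_castSucc, zero_mul, add_zero,
      Fin.castSucc_inj] at h
    rw [h]
    split_ifs <;> simp

lemma commute_quot_t (i j : Fin n) : Commute (quot q n (t q (Fin.last n) (Fin.last n)))
    (quot q n (t q i.castSucc j.castSucc)) := by
  have h := congrArg (quot q n) (rtt (q := q) (Fin.last n) i.castSucc (Fin.last n) j.castSucc)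
  rw [commute_iff_eq]
  simpa [quot_t_last, quot_t_castSucc, (Fin.castSucc_ne_last _).symm,
    not_lt.mpr (Fin.castSucc_lt_last _).le] using h

lemma commute_quot_s (i j : Fin n) : Commute (quot q n (t q (Fin.last n) (Fin.last n)))
    (quot q n (s q i.castSucc j.castSucc)) := by
  have h := congrArg (quot q n) ((isFRT q (n + 1)).ts_exchange i.castSucc (Fin.last n) j.castSucc
    (Fin.last n))
  rw [if_neg (Fin.castSucc_ne_last j).symm, if_neg (Fin.castSucc_ne_last j).symm,
    if_neg (Fin.castSucc_ne_last i).symm, if_neg (Fin.castSucc_ne_last i).symm] at h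
  simp only [one_smul, zero_smul, add_zero, map_mul] at h
  exact h.symm

lemma commute_quot_inv {x : Uq q (n + 1) ⧸ offDiagIdeal q n}
    (h : Commute (quot q n (t q (Fin.last n) (Fin.last n))) x) :
    Commute (quot q n (s q (Fin.last n) (Fin.last n))) x := by
  have h1 := quot_z_mul (q := q) (Fin.last n)
  have h2 := quot_mul_z (q := q) (Fin.last n)
  rw [if_pos rfl] at h1 h2
  exact Commute.units_inv_left (u := ⟨_, _, h1, h2⟩) h

/-- The condition under which the two maps to the quotient combine to a map on U_q(1) ⊗ U_q(n). -/
lemma commute_lift_quot (a : Uq q 1) (b : Uq q n) :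
    Commute (lift isFRT_quot_corner a) (lift isFRT_quot_block b) := by
  have hb : ∀ b : Uq q n, Commute (quot q n (t q (Fin.last n) (Fin.last n)))
      (lift isFRT_quot_block b) := by
    intro b
    induction b using induction with
    | halg r => rw [AlgHom.commutes]; exact (Algebra.commutes r _).symm
    | ht i j => rw [lift_t]; exact commute_quot_t i j
    | hs i j => rw [lift_s]; exact commute_quot_s i j
    | hmul a b ha hb => rw [map_mul]; exact ha.mul_right hb
    | hadd a b ha hb => rw [map_add]; exact ha.add_right hb
  induction a using induction with
  | halg r => rw [AlgHom.commutes]; exact Algebra.commutes r _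
  | ht i j => rw [lift_t]; exact hb b
  | hs i j => rw [lift_s]; exact commute_quot_inv (hb b)
  | hmul a b ha hb => rw [map_mul]; exact ha.mul_left hb
  | hadd a b ha hb => rw [map_add]; exact ha.add_left hb

/-- The universal properties of U_q(1) and U_q(n) give a map ψ back to the quotient, and the
quotient map factors as ψ after `alphaOne`, as seen on generators. -/
lemma mem_offDiagIdeal_of_alphaOne_eq_zero {k : Uq q (n + 1)} (hk : alphaOne q n k = 0) :
    k ∈ offDiagIdeal q n := by
  let ψ : Uq q 1 ⊗[ℂ] Uq q n →ₐ[ℂ] Uq q (n + 1) ⧸ offDiagIdeal q n :=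
    Algebra.TensorProduct.lift (lift isFRT_quot_corner) (lift isFRT_quot_block)
      commute_lift_quot
  have h : ψ.comp (alphaOne q n).toAlgHom = quot q n := by
    apply hom_ext
    · intro i j
      change ψ (alphaOne q n (t q i j)) = _
      cases i using Fin.lastCases <;> cases j using Fin.lastCases <;>
        simp only [alphaOne_last_last, alphaOne_last_castSucc, alphaOne_castSucc_last,
          alphaOne_castSucc_castSucc, map_zero, quot_t_last, quot_t_castSucc, ψ,
          Algebra.TensorProduct.lift_tmul, lift_t, map_one, one_mul, mul_one]
    · intro i j
      change ψ (alphaOne q n (s q i j)) = _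
      rw [alphaOne_s]
      cases i using Fin.lastCases <;> cases j using Fin.lastCases <;>
        simp only [alphaOne_last_last, alphaOne_last_castSucc, alphaOne_castSucc_last,
          alphaOne_castSucc_castSucc, map_zero, quot_s_last, quot_s_castSucc, ψ, star_zero,
          TensorProduct.star_tmul, star_one, star_t,
          Algebra.TensorProduct.lift_tmul, lift_s, map_one, one_mul, mul_one]
  rw [← quot_eq_zero, ← h]
  change ψ (alphaOne q n k) = 0
  rw [hk, map_zero]

/-! ### The algebra generated by the entries of the projection -/

variable (q n) in
/-- The subalgebra of `U_q(n+1)` generated by the entries `(t†)^i_{n+1} t^{n+1}_j`. -/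
def projAlgebra : Subalgebra ℂ (Uq q (n + 1)) :=
  Algebra.adjoin ℂ {x | ∃ i j, x = s q i (Fin.last n) * t q (Fin.last n) j}

lemma projEntry_mem (i j : Fin (n + 1)) :
    s q i (Fin.last n) * t q (Fin.last n) j ∈ projAlgebra q n :=
  Algebra.subset_adjoin ⟨i, j, rfl⟩

/-- Δ(s^i_N t^N_j) = ∑ s^k_N t^N_l ⊗ s^i_k t^l_j: the left legs are again generators. -/
lemma comul_mem_of_mem_projAlgebra {b : Uq q (n + 1)} (hb : b ∈ projAlgebra q n) :
    Coalgebra.comul (R := ℂ) b ∈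
      (Algebra.TensorProduct.map (projAlgebra q n).val (AlgHom.id ℂ (Uq q (n + 1)))).range := by
  change b ∈ (Algebra.TensorProduct.map (projAlgebra q n).val
    (AlgHom.id ℂ (Uq q (n + 1)))).range.comap (Bialgebra.comulAlgHom ℂ (Uq q (n + 1)))
  refine Algebra.adjoin_le ?_ hb
  rintro _ ⟨i, j, rfl⟩
  rw [SetLike.mem_coe, Subalgebra.mem_comap, Bialgebra.comulAlgHom_apply, Bialgebra.comul_mul,
    comul_s, comul_t, Finset.sum_mul_sum]
  refine sum_mem fun k _ => sum_mem fun l _ => ?_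
  rw [Algebra.TensorProduct.tmul_mul_tmul]
  exact ⟨(⟨_, projEntry_mem k l⟩ : projAlgebra q n) ⊗ₜ (s q i k * t q l j), by simp⟩

lemma star_mem_projAlgebra {b : Uq q (n + 1)} (hb : b ∈ projAlgebra q n) :
    star b ∈ projAlgebra q n := by
  induction hb using Algebra.adjoin_induction with
  | mem x h =>
    obtain ⟨i, j, rfl⟩ := h
    rw [star_mul, star_t, star_s]
    exact projEntry_mem j i
  | algebraMap r =>
    rw [star_algebraMap_aux]
    exact Subalgebra.algebraMap_mem _ _
  | add x y _ _ hx hy => rw [star_add]; exact add_mem hx hy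
  | mul x y _ _ hx hy => rw [star_mul]; exact mul_mem hy hx

/-- For j < N the relation t s = 1 gives t^N_j = ∑ t^N_i (s^i_N t^N_j) and t^j_N = -∑ t^j_i (s^i_N
t^N_N - δ_{iN}). The factors on the right are generators of `projAlgebra` minus their counits. -/
lemma offDiagIdeal_le : offDiagIdeal q n ≤
    Ideal.span {b : Uq q (n + 1) | b ∈ projAlgebra q n ∧ Coalgebra.counit (R := ℂ) b = 0} := by
  have hε : ∀ i j, s q i (Fin.last n) * t q (Fin.last n) j -
      algebraMap ℂ (Uq q (n + 1)) ((if i = Fin.last n then 1 else 0) *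
        if Fin.last n = j then 1 else 0) ∈
      Ideal.span {b : Uq q (n + 1) | b ∈ projAlgebra q n ∧ Coalgebra.counit (R := ℂ) b = 0} := fun i j =>
    Ideal.subset_span ⟨sub_mem (projEntry_mem i j) (Subalgebra.algebraMap_mem _ _), by
      rw [map_sub, Bialgebra.counit_mul, counit_s, counit_t, Bialgebra.counit_algebraMap,
        sub_self]⟩
  refine Ideal.span_le.mpr ?_
  rintro _ ⟨j, rfl | rfl⟩
  · have : t q (Fin.last n) j.castSucc = ∑ i, t q (Fin.last n) i *
        (s q i (Fin.last n) * t q (Fin.last n) j.castSucc -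
          algebraMap ℂ (Uq q (n + 1)) ((if i = Fin.last n then 1 else 0) *
            if Fin.last n = j.castSucc then 1 else 0)) := by
      simp only [if_neg (Fin.castSucc_ne_last j).symm, mul_zero, map_zero, sub_zero,
        ← mul_assoc, ← Finset.sum_mul, (isFRT q (n + 1)).ts, if_true, one_mul]
    rw [this]
    exact sum_mem fun i _ => Ideal.mul_mem_left _ _ (hε _ _)
  · have : t q j.castSucc (Fin.last n) = - ∑ i, t q j.castSucc i *
        (s q i (Fin.last n) * t q (Fin.last n) (Fin.last n) -
          algebraMap ℂ (Uq q (n + 1)) ((if i = Fin.last n then 1 else 0) *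
            if Fin.last n = Fin.last n then 1 else 0)) := by
      simp only [if_true, mul_one, mul_sub, Finset.sum_sub_distrib,
        ← mul_assoc, ← Finset.sum_mul, (isFRT q (n + 1)).ts, apply_ite (algebraMap ℂ _),
        map_one, map_zero, mul_ite, mul_one, mul_zero, Finset.sum_ite_eq', Finset.mem_univ]
      rw [if_neg (Fin.castSucc_ne_last j), zero_mul]
      simp
    rw [this]
    exact neg_mem (sum_mem fun i _ => Ideal.mul_mem_left _ _ (hε _ _))

lemma ker_canonicalMap_coaction_le :
    LinearMap.ker (canonicalMap (coaction q n).toAlgHom) ≤ horizontalForms (projAlgebra q n) :=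
  ker_canonicalMap_le (π := (alphaOne q n).toAlgHom) (alphaOne_surjective q n)
    (fun _ => comul_mem_of_mem_projAlgebra)
    (fun _ hk => offDiagIdeal_le (mem_offDiagIdeal_of_alphaOne_eq_zero hk))

/-- The coaction multiplies t^N_j by z and s^i_N by z^*, and these phases cancel in the product. -/
lemma projAlgebra_le_invariants : projAlgebra q n ≤ (invariants q n).toSubalgebra := by
  refine Algebra.adjoin_le ?_
  rintro _ ⟨i, j, rfl⟩
  change (coaction q n).toAlgHom (s q i (Fin.last n) * t q (Fin.last n) j) = 1 ⊗ₜ _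
  rw [map_mul, coaction_s, coaction_t, Fin.sum_univ_castSucc, Fin.sum_univ_castSucc]
  simp [alphaOne_s, star_mul_z, Algebra.TensorProduct.one_def]

-- Exactness does not need the invariants to be known: the kernel of χ is already horizontal for the
-- smaller algebra `projAlgebra`.
variable (q n) in
theorem isQuantumPrincipalBundle : IsQuantumPrincipalBundle (A := Uq q 1 ⊗[ℂ] Uq q n)
    (P := Uq q (n + 1)) (coaction q n).toAlgHom (invariants q n).toSubalgebra where
  coassoc := coaction_coassoc q
  counit := coaction_counit q
  base _ := Iff.rfl
  free := canonicalMap_surjective (π := (alphaOne q n).toAlgHom) (alphaOne_surjective q n)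
  exact := le_antisymm
    (inf_le_left.trans (ker_canonicalMap_coaction_le.trans
      (horizontalForms_mono projAlgebra_le_invariants)))
    (horizontalForms_le _ fun _ hb => hb)

end kernel

end Uq

/-! ### Unitary corepresentations -/

section corep

variable {P : Type*} [Ring P] [HopfAlgebra ℂ P] [StarRing P] [StarModule ℂ P]

/-- A unitary matrix corepresentation `w` of a Hopf `*`-algebra together with positive weights `f`
for which the conjugate corepresentation is unitary as well. -/
structure IsUnitaryCorep {I : Type} [Fintype I] [DecidableEq I] (w : I → I → P) (f : I → ℝ) :
    Prop where
  comul : ∀ i j, Coalgebra.comul (R := ℂ) (w i j) = ∑ k, w i k ⊗ₜ w k j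
  counit : ∀ i j, Coalgebra.counit (R := ℂ) (w i j) = if i = j then 1 else 0
  antipode : ∀ i j, HopfAlgebra.antipode ℂ (w i j) = star (w j i)
  pos : ∀ i, 0 < f i
  twist : ∀ i k, ∑ j, (f j : ℂ) • (star (w i j) * w k j) = if i = k then (f i : ℂ) • 1 else 0

/-- The matrix coefficient `ξ^* w η`. -/
def coeff {I : Type} [Fintype I] (w : I → I → P) (ξ η : I → ℂ) : P :=
  ∑ i, ∑ j, (star (ξ i) * η j) • w i j

variable {I J : Type} [Fintype I] [DecidableEq I] [Fintype J] [DecidableEq J]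
  {w : I → I → P} {f : I → ℝ} {w' : J → J → P} {f' : J → ℝ}

lemma IsUnitaryCorep.star_mul (h : IsUnitaryCorep w f) (i j : I) :
    ∑ k, star (w k i) * w k j = if i = j then 1 else 0 := by
  have := HopfAlgebra.mul_antipode_rTensor_comul_apply (R := ℂ) (w i j)
  rw [h.comul, h.counit] at this
  simp only [map_sum, LinearMap.rTensor_tmul, LinearMap.mul'_apply, h.antipode] at this
  rw [this]
  split_ifs <;> simp

lemma IsUnitaryCorep.mul_star (h : IsUnitaryCorep w f) (i j : I) :
    ∑ k, w i k * star (w j k) = if i = j then 1 else 0 := by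
  have := HopfAlgebra.mul_antipode_lTensor_comul_apply (R := ℂ) (w i j)
  rw [h.comul, h.counit] at this
  simp only [map_sum, LinearMap.lTensor_tmul, LinearMap.mul'_apply, h.antipode] at this
  rw [this]
  split_ifs <;> simp

lemma IsUnitaryCorep.one : IsUnitaryCorep (fun _ _ : Unit => (1 : P)) (fun _ => 1) where
  comul _ _ := by simp [Algebra.TensorProduct.one_def]
  counit _ _ := by simp
  antipode _ _ := by simp
  pos _ := one_pos
  twist _ _ := by simp

/-- The tensor product of corepresentations; the weights multiply. -/
lemma IsUnitaryCorep.mul (h : IsUnitaryCorep w f) (h' : IsUnitaryCorep w' f') :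
    IsUnitaryCorep (fun i j : I × J => w i.1 j.1 * w' i.2 j.2) (fun i => f i.1 * f' i.2) where
  comul i j := by
    simp only [Bialgebra.comul_mul, h.comul, h'.comul, Finset.sum_mul_sum,
      Algebra.TensorProduct.tmul_mul_tmul, Fintype.sum_prod_type]
  counit i j := by
    simp only [Bialgebra.counit_mul, h.counit, h'.counit, Prod.ext_iff, ite_and]
    split_ifs <;> simp
  antipode i j := by
    rw [HopfAlgebra.antipode_mul_antidistrib, h.antipode, h'.antipode, StarMul.star_mul]
  pos i := mul_pos (h.pos _) (h'.pos _)
  twist i k := by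
    -- The star reverses the product, so the pair belonging to w stands in the middle and is summed
    -- before the outer pair.
    have e : ∀ y, ∑ x, ((f x * f' y : ℝ) : ℂ) • (star (w i.1 x * w' i.2 y) * (w k.1 x * w' k.2 y)) =
        (f' y : ℂ) • (star (w' i.2 y) * (∑ x, (f x : ℂ) • (star (w i.1 x) * w k.1 x)) *
          w' k.2 y) := by
      intro y
      simp only [Finset.mul_sum, Finset.sum_mul, Finset.smul_sum]
      refine Finset.sum_congr rfl fun x _ => ?_
      simp only [StarMul.star_mul, mul_smul_comm, smul_mul_assoc, smul_smul, mul_assoc]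
      rw [Complex.ofReal_mul, mul_comm (f x : ℂ)]
    rw [Fintype.sum_prod_type, Finset.sum_comm]
    simp only [e, h.twist, Prod.ext_iff, ite_and]
    split_ifs with h1 h2
    · simp only [mul_smul_comm, smul_mul_assoc, mul_one, smul_comm _ (f i.1 : ℂ)]
      rw [← Finset.smul_sum, h'.twist, if_pos h2, smul_smul, Complex.ofReal_mul]
    · simp only [mul_smul_comm, smul_mul_assoc, mul_one, smul_comm _ (f i.1 : ℂ)]
      rw [← Finset.smul_sum, h'.twist, if_neg h2, smul_zero]
    · simp

lemma IsUnitaryCorep.sum (h : IsUnitaryCorep w f) (h' : IsUnitaryCorep w' f') :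
    IsUnitaryCorep (Sum.elim (fun i => Sum.elim (w i) 0) (fun i => Sum.elim 0 (w' i)))
      (Sum.elim f f') where
  comul i j := by cases i <;> cases j <;> simp [h.comul, h'.comul]
  counit i j := by cases i <;> cases j <;> simp [h.counit, h'.counit]
  antipode i j := by cases i <;> cases j <;> simp [h.antipode, h'.antipode]
  pos i := by cases i <;> simp [h.pos, h'.pos]
  twist i k := by
    cases i <;> cases k <;> simp [h.twist, h'.twist, -Complex.coe_smul]

lemma coeff_mul (w : I → I → P) (w' : J → J → P) (ξ η : I → ℂ) (ξ' η' : J → ℂ) :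
    coeff (fun i j : I × J => w i.1 j.1 * w' i.2 j.2) (fun i => ξ i.1 * ξ' i.2)
      (fun i => η i.1 * η' i.2) = coeff w ξ η * coeff w' ξ' η' := by
  simp only [coeff, Fintype.sum_prod_type, Finset.sum_mul_sum, smul_mul_smul_comm]
  refine Finset.sum_congr rfl fun i _ => ?_
  refine Finset.sum_congr rfl fun i' _ => Finset.sum_congr rfl fun j _ =>
    Finset.sum_congr rfl fun j' _ => ?_
  rw [star_mul']
  congr 1
  ring

lemma coeff_sum (w : I → I → P) (w' : J → J → P) (ξ η : I → ℂ) (ξ' η' : J → ℂ) :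
    coeff (Sum.elim (fun i => Sum.elim (w i) 0) (fun i => Sum.elim 0 (w' i)))
      (Sum.elim ξ ξ') (Sum.elim η η') = coeff w ξ η + coeff w' ξ' η' := by
  simp [coeff]

lemma coeff_single (w : I → I → P) (i j : I) (c : ℂ) :
    coeff w (Pi.single i 1) (Pi.single j c) = c • w i j := by
  unfold coeff
  rw [Finset.sum_eq_single i, Finset.sum_eq_single j]
  · simp
  · intro k _ hk; simp [hk]
  · simp
  · intro k _ hk; simp [hk]
  · simp

/-- The Hopf `*`-algebra `P` is spanned by the matrix coefficients of unitary
corepresentations. -/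
def IsSpannedByUnitary (P : Type*) [Ring P] [HopfAlgebra ℂ P] [StarRing P] [StarModule ℂ P] :
    Prop :=
  ∀ u : P, ∃ (I : Type) (_ : Fintype I) (_ : DecidableEq I) (w : I → I → P) (f : I → ℝ)
    (ξ η : I → ℂ), IsUnitaryCorep w f ∧ u = coeff w ξ η

end corep

namespace Uq

variable (q : ℝˣ) (n : ℕ)

lemma antipode_t {n : ℕ} (i j : Fin n) :
    HopfAlgebra.antipode ℂ (t q i j) = s q i j := antiLinear_t q i j

lemma antipode_s {n : ℕ} (i j : Fin n) : HopfAlgebra.antipode ℂ (s q i j) =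
    (((q : ℝ) : ℂ) ^ (2 * (((j : ℕ) : ℤ) - ((i : ℕ) : ℤ)))) • t q i j := antiLinear_s q i j

/-- The weights are those of the twisted orthogonality relation `IsFRT.twisted_st`; even exponents
keep them positive for negative q. -/
lemma isUnitaryCorep_t : IsUnitaryCorep (t q (n := n)) (fun j => (q : ℝ) ^ (2 * (j.val : ℤ))) where
  comul := comul_t q
  counit := counit_t q
  antipode i j := by rw [antipode_t, star_t]
  pos j := Even.zpow_pos (even_two_mul _) q.ne_zero
  twist i k := by
    simp only [star_t, Complex.ofReal_zpow]
    exact (isFRT q n).twisted_st i k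

/-- The conjugate corepresentation is unitary only after rescaling: S multiplies s^i_j by q^(2(j -
i)), and the factor q^(j - i) is its square root. The weights are inverse to those of t. -/
lemma isUnitaryCorep_s : IsUnitaryCorep
    (fun i j : Fin n => (((q : ℝ) : ℂ) ^ ((j.val : ℤ) - i.val)) • s q j i)
    (fun j => (q : ℝ) ^ (-2 * (j.val : ℤ))) where
  comul i j := by
    rw [map_smul, comul_s, Finset.smul_sum]
    refine Finset.sum_congr rfl fun k _ => ?_
    rw [TensorProduct.smul_tmul_smul, ← zpow_add₀ (q_ne q)]
    congr 2
    ring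
  counit i j := by
    rw [map_smul, counit_s]
    by_cases h : i = j
    · subst h; simp
    · simp [h, Ne.symm h]
  antipode i j := by
    rw [map_smul, antipode_s, star_smul, star_s, smul_smul, ← zpow_add₀ (q_ne q), star_zpow₀,
      Complex.star_def, Complex.conj_ofReal]
    congr 2
    ring
  pos j := Even.zpow_pos ((even_two).neg.mul_right _) q.ne_zero
  twist i k := by
    have hq := q_ne q
    have e : ∀ j : Fin n, (((q : ℝ) ^ (-2 * (j.val : ℤ)) : ℝ) : ℂ) •
        (star ((((q : ℝ) : ℂ) ^ ((j.val : ℤ) - i.val)) • s q j i) *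
          ((((q : ℝ) : ℂ) ^ ((j.val : ℤ) - k.val)) • s q j k)) =
        (((q : ℝ) : ℂ) ^ (- (i.val : ℤ) - k.val)) • (t q i j * s q j k) := by
      intro j
      rw [star_smul, star_s, star_zpow₀, Complex.star_def, Complex.conj_ofReal,
        smul_mul_smul_comm, smul_smul, Complex.ofReal_zpow, ← zpow_add₀ hq, ← zpow_add₀ hq]
      congr 2
      ring
    simp only [e]
    rw [← Finset.smul_sum, (isFRT q n).ts]
    by_cases h : i = k
    · subst h
      rw [if_pos rfl, if_pos rfl, Complex.ofReal_zpow]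
      congr 2
      ring
    · simp [h]

/-- Tensor products and direct sums of corepresentations realise products and sums of coefficients,
so the generators suffice. -/
lemma isSpannedByUnitary : IsSpannedByUnitary (Uq q n) := by
  intro u
  induction u using induction with
  | halg r =>
    exact ⟨Unit, inferInstance, inferInstance, _, _, Pi.single () 1, Pi.single () r,
      IsUnitaryCorep.one, by rw [coeff_single, Algebra.algebraMap_eq_smul_one]⟩
  | ht i j =>
    exact ⟨Fin n, inferInstance, inferInstance, _, _, Pi.single i 1, Pi.single j 1,
      isUnitaryCorep_t q n, by rw [coeff_single, one_smul]⟩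
  | hs i j =>
    refine ⟨Fin n, inferInstance, inferInstance, _, _, Pi.single j 1,
      Pi.single i (((q : ℝ) : ℂ) ^ ((j.val : ℤ) - i.val)), isUnitaryCorep_s q n, ?_⟩
    rw [coeff_single, smul_smul, ← zpow_add₀ (q_ne q)]
    simp
  | hmul a b ha hb =>
    obtain ⟨I, _, _, w, f, ξ, η, h, rfl⟩ := ha
    obtain ⟨J, _, _, w', f', ξ', η', h', rfl⟩ := hb
    exact ⟨I × J, inferInstance, inferInstance, _, _, _, _, h.mul h',
      (coeff_mul w w' ξ η ξ' η').symm⟩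
  | hadd a b ha hb =>
    obtain ⟨I, _, _, w, f, ξ, η, h, rfl⟩ := ha
    obtain ⟨J, _, _, w', f', ξ', η', h', rfl⟩ := hb
    exact ⟨I ⊕ J, inferInstance, inferInstance, _, _, _, _, h.sum h',
      (coeff_sum w w' ξ η ξ' η').symm⟩

lemma comul_star (u : Uq q n) :
    Coalgebra.comul (R := ℂ) (star u) = star (Coalgebra.comul (R := ℂ) u) := by
  have := map_star (toStarHom (Bialgebra.comulAlgHom ℂ (Uq q n)) (by
    intro i j
    simp [star_sum])) u
  exact this

end Uq

/-! ### The Haar functional -/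

section semisimple

/-- The module over a free algebra given by a family of endomorphisms. -/
abbrev freeModule {X W : Type*} [AddCommGroup W] [Module ℂ W] (A : X → Module.End ℂ W) :
    Module (FreeAlgebra ℂ X) W :=
  Module.compHom W (FreeAlgebra.lift ℂ A).toRingHom

lemma freeModule_ι_smul {X W : Type*} [AddCommGroup W] [Module ℂ W] (A : X → Module.End ℂ W)
    (x : X) (w : W) : letI := freeModule A; FreeAlgebra.ι ℂ x • w = A x w := by
  change FreeAlgebra.lift ℂ A (FreeAlgebra.ι ℂ x) w = A x w
  rw [FreeAlgebra.lift_ι_apply]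

lemma freeModule_algebraMap_smul {X W : Type*} [AddCommGroup W] [Module ℂ W]
    (A : X → Module.End ℂ W) (c : ℂ) (w : W) :
    letI := freeModule A; algebraMap ℂ (FreeAlgebra ℂ X) c • w = c • w := by
  change FreeAlgebra.lift ℂ A (algebraMap ℂ _ c) w = _
  rw [AlgHom.commutes]
  rfl

/-- If the family is closed under adjoints, the orthogonal complement of an invariant subspace is
invariant. -/
lemma isSemisimpleModule_of_adjoint {X W : Type*} [NormedAddCommGroup W] [InnerProductSpace ℂ W]
    [FiniteDimensional ℂ W] (A : X → Module.End ℂ W)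
    (hA : ∀ x, ∃ y, A y = LinearMap.adjoint (A x)) :
    letI := freeModule A
    IsSemisimpleModule (FreeAlgebra ℂ X) W := by
  let := freeModule A
  refine { exists_isCompl := fun Q => ?_ }
  let Qc : Submodule ℂ W :=
    { Q.toAddSubmonoid with
      smul_mem' := fun c w hw => by
        have := Q.smul_mem (algebraMap ℂ _ c) hw
        rwa [freeModule_algebraMap_smul] at this }
  let Q' : Submodule (FreeAlgebra ℂ X) W :=
    { Qcᗮ.toAddSubmonoid with
      smul_mem' := fun r w hw => by
        change r • w ∈ Qcᗮ
        replace hw : w ∈ Qcᗮ := hw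
        induction r using FreeAlgebra.induction generalizing w with
        | grade0 c => rw [freeModule_algebraMap_smul]; exact Qcᗮ.smul_mem c hw
        | grade1 x =>
          rw [freeModule_ι_smul, Submodule.mem_orthogonal]
          intro v hv
          obtain ⟨y, hy⟩ := hA x
          rw [← LinearMap.adjoint_inner_left, ← hy, ← freeModule_ι_smul]
          exact (Qc.mem_orthogonal w).mp hw _ (Q.smul_mem _ hv)
        | mul a b ha hb => rw [mul_smul]; exact ha _ (hb _ hw)
        | add a b ha hb => rw [add_smul]; exact add_mem (ha _ hw) (hb _ hw) }
  have hcompl : IsCompl Qc Qcᗮ := Submodule.isCompl_orthogonal Qc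
  refine ⟨Q', ?_, ?_⟩
  · rw [Submodule.disjoint_def]
    intro x hx hx'
    exact Submodule.disjoint_def.mp hcompl.disjoint x hx hx'
  · rw [codisjoint_iff, Submodule.eq_top_iff']
    intro x
    obtain ⟨y, z, hy, hz, h⟩ := Submodule.codisjoint_iff_exists_add_eq.mp hcompl.codisjoint x
    exact Submodule.mem_sup.mpr ⟨y, hy, z, hz, h⟩

/-- A linear map intertwining two families of endomorphisms, as a module map. -/
def freeModuleHom {X W V : Type*} [AddCommGroup W] [Module ℂ W] [AddCommGroup V] [Module ℂ V]
    (A : X → Module.End ℂ W) (T : X → Module.End ℂ V) (φ : W →ₗ[ℂ] V)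
    (hφ : ∀ x w, φ (A x w) = T x (φ w)) :
    letI := freeModule A
    letI := freeModule T
    W →ₗ[FreeAlgebra ℂ X] V :=
  letI := freeModule A
  letI := freeModule T
  { toFun := φ
    map_add' := φ.map_add
    map_smul' := fun r w => by
      rw [RingHom.id_apply]
      induction r using FreeAlgebra.induction generalizing w with
      | grade0 c => rw [freeModule_algebraMap_smul, freeModule_algebraMap_smul, map_smul]
      | grade1 x => rw [freeModule_ι_smul, freeModule_ι_smul, hφ]
      | mul a b ha hb => rw [mul_smul, mul_smul, ha, hb]
      | add a b ha hb => rw [add_smul, add_smul, map_add, ha, hb] }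

/-- Images of semisimple modules are semisimple, and so is the sum of all of them, which is V
because every vector lies in one. -/
lemma isSemisimpleModule_of_ranges {X V : Type*} [AddCommGroup V] [Module ℂ V]
    (T : X → Module.End ℂ V)
    (hT : ∀ v, ∃ (I : Type) (_ : Fintype I) (A : X → Module.End ℂ (EuclideanSpace ℂ I))
      (φ : EuclideanSpace ℂ I →ₗ[ℂ] V), (∀ x, ∃ y, A y = LinearMap.adjoint (A x)) ∧
      (∀ x w, φ (A x w) = T x (φ w)) ∧ ∃ w, φ w = v) :
    letI := freeModule T
    IsSemisimpleModule (FreeAlgebra ℂ X) V := by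
  let := freeModule T
  have key : ∀ v : V, ∃ N : Submodule (FreeAlgebra ℂ X) V,
      IsSemisimpleModule (FreeAlgebra ℂ X) N ∧ v ∈ N := by
    intro v
    obtain ⟨I, _, A, φ, hA, hφ, w, hw⟩ := hT v
    let := freeModule A
    have hss : IsSemisimpleModule (FreeAlgebra ℂ X) (EuclideanSpace ℂ I) :=
      isSemisimpleModule_of_adjoint A hA
    exact ⟨LinearMap.range (freeModuleHom A T φ hφ), .range _, ⟨w, hw⟩⟩
  choose N hN hv using key
  refine isSemisimpleModule_of_isSemisimpleModule_submodule' hN ?_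
  rw [Submodule.eq_top_iff']
  exact fun v => Submodule.mem_iSup_of_mem v (hv v)

/-- A common eigenvector spans a one-dimensional submodule with character χ; by semisimplicity its
inclusion has a module retraction, which is the functional. -/
lemma exists_invariant_functional {X V : Type*} [AddCommGroup V] [Module ℂ V]
    (T : X → Module.End ℂ V)
    (hT : letI := freeModule T; IsSemisimpleModule (FreeAlgebra ℂ X) V)
    {v : V} (hv : v ≠ 0) (χ : X → ℂ) (hχ : ∀ x, T x v = χ x • v) :
    ∃ h : Module.Dual ℂ V, h v = 1 ∧ ∀ x w, h (T x w) = χ x * h w := by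
  let := freeModule T
  let A : X → Module.End ℂ (ULift.{0} ℂ) := fun x => χ x • LinearMap.id
  let := freeModule A
  let φ : ULift.{0} ℂ →ₗ[ℂ] V := (LinearMap.toSpanSingleton ℂ V v) ∘ₗ
    (ULift.moduleEquiv : ULift.{0} ℂ ≃ₗ[ℂ] ℂ).toLinearMap
  obtain ⟨h, hh⟩ := IsSemisimpleModule.extension_property (R := FreeAlgebra ℂ X)
    (freeModuleHom A T φ (fun x w => by simp [A, φ, hχ, smul_smul, mul_comm]))
    (fun a b hab => ULift.ext _ _ (smul_left_injective ℂ hv hab)) LinearMap.id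
  refine ⟨⟨⟨fun w => (h w).down, fun a b => by rw [map_add]; rfl⟩, fun c w => ?_⟩, ?_, ?_⟩
  · change (h (c • w)).down = _
    rw [← freeModule_algebraMap_smul T, map_smul, freeModule_algebraMap_smul]
    rfl
  · have := DFunLike.congr_fun hh (ULift.up 1)
    have e : φ (ULift.up 1) = v := by simp [φ]
    change h (φ (ULift.up 1)) = ULift.up 1 at this
    rw [e] at this
    exact congrArg ULift.down this
  · intro x w
    change (h (T x w)).down = χ x * (h w).down
    rw [← freeModule_ι_smul T, map_smul, freeModule_ι_smul]
    rfl

end semisimple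

section haar

variable {P : Type*} [Ring P] [HopfAlgebra ℂ P]

/-- The right action `u ↦ u₁ f(u₂)` of linear functionals. -/
def rightAct (f : Module.Dual ℂ P) : Module.End ℂ P :=
  (TensorProduct.rid ℂ P).toLinearMap ∘ₗ f.lTensor P ∘ₗ Coalgebra.comul

/-- The left action `u ↦ f(u₁) u₂` of linear functionals. -/
def leftAct (f : Module.Dual ℂ P) : Module.End ℂ P :=
  (TensorProduct.lid ℂ P).toLinearMap ∘ₗ f.rTensor P ∘ₗ Coalgebra.comul

lemma apply_leftAct (f g : Module.Dual ℂ P) (u : P) :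
    g (leftAct f u) = f (rightAct g u) := by
  simp only [leftAct, rightAct, LinearMap.comp_apply, LinearEquiv.coe_coe]
  generalize (Coalgebra.comul u : P ⊗[ℂ] P) = X
  induction X using TensorProduct.induction_on with
  | zero => simp
  | tmul a b => simp [mul_comm]
  | add x y hx hy => simp only [map_add, hx, hy]

lemma rightAct_one (f : Module.Dual ℂ P) : rightAct f 1 = f 1 • (1 : P) := by
  simp [rightAct, Algebra.TensorProduct.one_def]

variable [StarRing P]

variable {I : Type} [Fintype I] [DecidableEq I] {w : I → I → P} {c : I → ℝ}

lemma IsUnitaryCorep.rightAct (h : IsUnitaryCorep w c) (f : Module.Dual ℂ P) (i j : I) :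
    rightAct f (w i j) = ∑ k, f (w k j) • w i k := by
  simp [QuantumProjective.rightAct, h.comul]

lemma IsUnitaryCorep.leftAct (h : IsUnitaryCorep w c) (f : Module.Dual ℂ P) (i j : I) :
    leftAct f (w i j) = ∑ k, f (w i k) • w k j := by
  simp [QuantumProjective.leftAct, h.comul]

lemma IsUnitaryCorep.rightAct_coeff (h : IsUnitaryCorep w c) (f : Module.Dual ℂ P)
    (ξ η : I → ℂ) : QuantumProjective.rightAct f (coeff w ξ η) =
      coeff w ξ (fun k => ∑ j, f (w k j) * η j) := by
  simp only [coeff, map_sum, map_smul, h.rightAct, Finset.smul_sum, Finset.mul_sum,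
    Finset.sum_smul]
  refine Finset.sum_congr rfl fun i _ => ?_
  rw [Finset.sum_comm]
  refine Finset.sum_congr rfl fun k _ => Finset.sum_congr rfl fun j _ => ?_
  rw [smul_smul]
  congr 1
  ring

variable [StarModule ℂ P]

/-- The functional `u ↦ conj f((S u)^*)`. -/
def starDual (f : Module.Dual ℂ P) : Module.Dual ℂ P where
  toFun u := star (f (star (HopfAlgebra.antipode ℂ u)))
  map_add' u v := by simp
  map_smul' r u := by simp

variable [Nontrivial P]

/-- The matrix coefficients `ξ^* w η`, as a linear function of `η`. -/
def coeffLin {P : Type*} [Ring P] [HopfAlgebra ℂ P] {I : Type} [Fintype I] (w : I → I → P)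
    (ξ : I → ℂ) : EuclideanSpace ℂ I →ₗ[ℂ] P where
  toFun η := coeff w ξ η
  map_add' x y := by simp [coeff, mul_add, add_smul, Finset.sum_add_distrib]
  map_smul' a x := by simp [coeff, Finset.smul_sum, smul_smul, mul_left_comm]

/-- Unitarity S(w_ij) = (w_ji)^* makes `starDual` on functionals correspond to the adjoint of
matrices. -/
lemma IsUnitaryCorep.exists_adjoint (h : IsUnitaryCorep w c) (f : Module.Dual ℂ P) :
    ∃ g : Module.Dual ℂ P, Matrix.toEuclideanLin (Matrix.of fun k j => g (w k j)) =
      LinearMap.adjoint (Matrix.toEuclideanLin (Matrix.of fun k j => f (w k j))) := by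
  refine ⟨starDual f, ?_⟩
  rw [← Matrix.toEuclideanLin_conjTranspose_eq_adjoint]
  refine congrArg Matrix.toEuclideanLin ?_
  ext i j
  rw [Matrix.conjTranspose_apply, Matrix.of_apply, Matrix.of_apply]
  change star (f (star (HopfAlgebra.antipode ℂ (w i j)))) = _
  rw [h.antipode, star_star]

/-- All functionals act on P from the right, semisimply by unitarity, and 1 is an eigenvector with
character f ↦ f(1). The functional obtained satisfies h(u₁) f(u₂) = h(u) f(1) for every f, and
functionals separate points. -/
lemma exists_haar (hP : IsSpannedByUnitary P) : ∃ h : Module.Dual ℂ P, h 1 = 1 ∧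
    ∀ u, leftAct h u = h u • (1 : P) := by
  have hss := isSemisimpleModule_of_ranges (V := P) rightAct fun u => by
    obtain ⟨I, _, _, w, c, ξ, η, h, rfl⟩ := hP u
    exact ⟨I, inferInstance, fun f => Matrix.toEuclideanLin (Matrix.of fun k j => f (w k j)),
      coeffLin w ξ, h.exists_adjoint, fun f η => (h.rightAct_coeff f ξ η).symm,
      WithLp.toLp 2 η, rfl⟩
  obtain ⟨h, h1, h2⟩ := exists_invariant_functional rightAct hss (one_ne_zero (α := P))
    (fun f => f 1) rightAct_one
  refine ⟨h, h1, fun u => ?_⟩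
  rw [← sub_eq_zero, ← Module.forall_dual_apply_eq_zero_iff ℂ]
  intro f
  rw [map_sub, map_smul, apply_leftAct, h2, smul_eq_mul, mul_comm, sub_self]

/-- A normalised invariant functional is invariant on both sides, unique and real. -/
lemma haar_rightAct (hP : IsSpannedByUnitary P) {h : Module.Dual ℂ P} (h1 : h 1 = 1)
    (hl : ∀ u, leftAct h u = h u • (1 : P)) (u : P) : rightAct h u = h u • (1 : P) := by
  obtain ⟨I, _, _, w, c, ξ, η, hw, rfl⟩ := hP u
  let H : Matrix I I ℂ := Matrix.of fun i j => h (w i j)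
  have e1 : ∀ i j, ∑ k, h (w i k) • w k j = h (w i j) • (1 : P) := fun i j => by
    rw [← hl, hw.leftAct]
  -- In matrix form left invariance is H w = H, and unitarity turns it into H = H w^*.
  have e2 : ∀ i j, ∑ k, H i k • star (w j k) = H i j • (1 : P) := by
    intro i j
    have : ∑ l, (∑ k, h (w i k) • w k l) * star (w j l) = H i j • (1 : P) := by
      simp only [Finset.sum_mul, smul_mul_assoc]
      rw [Finset.sum_comm]
      simp only [← Finset.smul_sum, hw.mul_star]
      simp [H]
    rw [← this]
    exact Finset.sum_congr rfl fun k _ => by rw [e1, smul_mul_assoc, one_mul]; rfl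
  have e3 : ∀ i j, ∑ k, star (H i k) • w j k = star (H i j) • (1 : P) := by
    intro i j
    have := congrArg star (e2 i j)
    simpa [star_sum, -Complex.star_def] using this
  -- The adjoint identity is w H^* = H^*, and h is applied to it entrywise. The left side H H^*
  -- being self-adjoint, H = H^*, hence w H = H, which is right invariance.
  have e4 : H * H.conjTranspose = H.conjTranspose := by
    ext j i
    have := congrArg h (e3 i j)
    simp only [map_sum, map_smul, smul_eq_mul, h1, mul_one] at this
    rw [Matrix.mul_apply, Matrix.conjTranspose_apply, ← this]
    exact Finset.sum_congr rfl fun k _ => mul_comm _ _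
  have e5 : H.conjTranspose = H := by
    have := congrArg Matrix.conjTranspose e4
    rwa [Matrix.conjTranspose_mul, Matrix.conjTranspose_conjTranspose, e4] at this
  have e6 : ∀ i j, ∑ k, h (w k j) • w i k = h (w i j) • (1 : P) := by
    intro i j
    have h5 : ∀ a b, star (H a b) = H b a := fun a b => congrFun (congrFun e5 b) a
    have := e3 j i
    simp only [h5] at this
    exact this
  simp only [coeff, map_sum, map_smul, hw.rightAct, e6, Finset.sum_smul, smul_assoc]

/-- Evaluating g(u₁) h(u₂) by left invariance of g and by right invariance of h gives g(u) and h(u).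
-/
lemma haar_unique (hP : IsSpannedByUnitary P) {h g : Module.Dual ℂ P} (h1 : h 1 = 1)
    (hl : ∀ u, leftAct h u = h u • (1 : P)) (g1 : g 1 = 1)
    (gl : ∀ u, leftAct g u = g u • (1 : P)) : g = h := by
  ext u
  have e1 := apply_leftAct g h u
  rwa [gl, haar_rightAct hP h1 hl, map_smul, map_smul, h1, g1, smul_eq_mul, smul_eq_mul, mul_one,
    mul_one] at e1

/-- The functional u ↦ conj h(u^*) is also normalised and left invariant, so uniqueness applies. -/
lemma haar_star (hP : IsSpannedByUnitary P)
    (hΔ : ∀ u : P, Coalgebra.comul (R := ℂ) (star u) = star (Coalgebra.comul (R := ℂ) u))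
    {h : Module.Dual ℂ P} (h1 : h 1 = 1)
    (hl : ∀ u, leftAct h u = h u • (1 : P)) (u : P) : h (star u) = star (h u) := by
  let g : Module.Dual ℂ P :=
    { toFun := fun u => star (h (star u))
      map_add' := fun u v => by simp
      map_smul' := fun r u => by simp }
  have hg : g = h := by
    refine haar_unique hP h1 hl (by simp [g, h1]) fun u => ?_
    have e : leftAct g u = star (leftAct h (star u)) := by
      simp only [leftAct, LinearMap.comp_apply, LinearEquiv.coe_coe, hΔ]
      generalize (Coalgebra.comul u : P ⊗[ℂ] P) = X
      induction X using TensorProduct.induction_on with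
      | zero => simp
      | tmul a b => simp [g]
      | add x y hx hy => simp only [map_add, hx, hy, star_add]
    rw [e, hl]
    simp [g]
  have := DFunLike.congr_fun hg u
  rw [← this]
  simp [g]

end haar

/-! ### Positivity of the Haar functional -/

section positivity

lemma exists_diagonalization {I : Type} [Fintype I] [DecidableEq I] {X : Matrix I I ℂ}
    (hX : X.IsHermitian) : ∃ (U : Matrix I I ℂ) (l : I → ℝ), U * U.conjTranspose = 1 ∧
      U.conjTranspose * U = 1 ∧
      X = U * Matrix.diagonal (fun i => (l i : ℂ)) * U.conjTranspose := by
  refine ⟨hX.eigenvectorUnitary, hX.eigenvalues, ?_, ?_, ?_⟩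
  · exact Unitary.mul_star_self_of_mem hX.eigenvectorUnitary.2
  · exact Unitary.star_mul_self_of_mem hX.eigenvectorUnitary.2
  · conv_lhs => rw [hX.spectral_theorem, Unitary.conjStarAlgAut_apply]
    rfl

/-- The matrix `U diag(g) U^*`. -/
def conjDiag {I : Type} [Fintype I] [DecidableEq I] (U : Matrix I I ℂ) (g : I → ℝ) :
    Matrix I I ℂ :=
  U * Matrix.diagonal (fun i => (g i : ℂ)) * U.conjTranspose

/-! ### Functional calculus in a fixed eigenbasis. -/

section conjDiag

variable {I : Type} [Fintype I] [DecidableEq I] {U : Matrix I I ℂ}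

lemma conjDiag_mul (h2 : U.conjTranspose * U = 1) (g g' : I → ℝ) :
    conjDiag U g * conjDiag U g' = conjDiag U (g * g') := by
  unfold conjDiag
  calc _ = U * Matrix.diagonal (fun i => (g i : ℂ)) * (U.conjTranspose * U) *
        Matrix.diagonal (fun i => (g' i : ℂ)) * U.conjTranspose := by simp only [Matrix.mul_assoc]
    _ = _ := by
      rw [h2, Matrix.mul_one, Matrix.mul_assoc U, Matrix.diagonal_mul_diagonal]
      simp

lemma conjDiag_conjTranspose (g : I → ℝ) : (conjDiag U g).conjTranspose = conjDiag U g := by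
  unfold conjDiag
  rw [Matrix.conjTranspose_mul, Matrix.conjTranspose_mul, Matrix.conjTranspose_conjTranspose,
    Matrix.diagonal_conjTranspose, Matrix.mul_assoc]
  congr 3
  ext i
  simp

lemma conjDiag_diag (g : I → ℝ) (j : I) :
    conjDiag U g j j = ((∑ k, ‖U j k‖ ^ 2 * g k : ℝ) : ℂ) := by
  unfold conjDiag
  rw [Matrix.mul_apply, Complex.ofReal_sum]
  refine Finset.sum_congr rfl fun k _ => ?_
  rw [Matrix.mul_diagonal, Matrix.conjTranspose_apply]
  push_cast
  rw [← Complex.mul_conj']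
  simp only [Complex.star_def]
  ring

lemma conjDiag_form (g : I → ℝ) (η : I → ℂ) :
    star η ⬝ᵥ (conjDiag U g).mulVec η =
      ((∑ k, g k * ‖(U.conjTranspose.mulVec η) k‖ ^ 2 : ℝ) : ℂ) := by
  unfold conjDiag
  rw [← Matrix.mulVec_mulVec, ← Matrix.mulVec_mulVec, Matrix.dotProduct_mulVec]
  have : Matrix.vecMul (star η) U = star (U.conjTranspose.mulVec η) := by
    rw [Matrix.star_mulVec, Matrix.conjTranspose_conjTranspose]
  rw [this, dotProduct, Complex.ofReal_sum]
  refine Finset.sum_congr rfl fun k _ => ?_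
  rw [Matrix.mulVec_diagonal, Pi.star_apply, Complex.star_def]
  push_cast
  rw [← Complex.conj_mul']
  ring

end conjDiag

variable {P : Type*} [Ring P] [HopfAlgebra ℂ P] [StarRing P] [StarModule ℂ P]
variable {I : Type} [Fintype I] [DecidableEq I] {w : I → I → P} {c : I → ℝ}

/-- A scalar matrix commutes with a corepresentation. -/
def Intertwines (w : I → I → P) (p : Matrix I I ℂ) : Prop :=
  ∀ k j, ∑ l, p l j • w k l = ∑ l, p k l • w l j

lemma intertwines_iff (p : Matrix I I ℂ) : Intertwines w p ↔
    Commute ((algebraMap ℂ P).mapMatrix p) (Matrix.of w) := by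
  unfold Intertwines Commute SemiconjBy
  rw [← Matrix.ext_iff]
  simp only [Matrix.mul_apply, RingHom.mapMatrix_apply, Matrix.map_apply, Matrix.of_apply,
    Algebra.smul_def]
  constructor
  · intro h i j
    rw [← h]
    exact Finset.sum_congr rfl fun l _ => Algebra.commutes _ _
  · intro h i j
    rw [h]
    exact Finset.sum_congr rfl fun l _ => Algebra.commutes _ _

/-- A function of an intertwiner is an intertwiner: in the eigenbasis, commuting with diag(l) means
that the (i, j) entry vanishes unless l_i = l_j, and then g(l_i) = g(l_j). -/
lemma Intertwines.conjDiag {U : Matrix I I ℂ} {l : I → ℝ} (h1 : U * U.conjTranspose = 1)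
    (h2 : U.conjTranspose * U = 1) (h : Intertwines w (conjDiag U l)) (g : ℝ → ℝ) :
    Intertwines w (QuantumProjective.conjDiag U (g ∘ l)) := by
  rw [intertwines_iff] at h ⊢
  unfold QuantumProjective.conjDiag at h ⊢
  set Φ := (algebraMap ℂ P).mapMatrix (m := I)
  set W := Matrix.of w
  have h1' : Φ U * Φ U.conjTranspose = 1 := by rw [← map_mul, h1, map_one]
  have h2' : Φ U.conjTranspose * Φ U = 1 := by rw [← map_mul, h2, map_one]
  have key : ∀ D, Commute (Φ (U * D * U.conjTranspose)) W ↔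
      Commute (Φ D) (Φ U.conjTranspose * W * Φ U) := by
    intro D
    unfold Commute SemiconjBy
    rw [map_mul, map_mul]
    constructor
    · intro h
      calc _ = Φ U.conjTranspose * (Φ U * Φ D * Φ U.conjTranspose * W) * Φ U := by
            simp only [← mul_assoc, h2', one_mul]
        _ = _ := by rw [h]; simp only [mul_assoc, h2', mul_one]
    · intro h
      calc _ = Φ U * (Φ D * (Φ U.conjTranspose * W * Φ U)) * Φ U.conjTranspose := by
            simp only [mul_assoc, h1', mul_one]
        _ = _ := by rw [h]; simp only [← mul_assoc, h1', one_mul]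
  rw [key] at h ⊢
  set V := Φ U.conjTranspose * W * Φ U
  have hd : ∀ f : I → ℝ, Commute (Φ (Matrix.diagonal fun i => (f i : ℂ))) V ↔
      ∀ i j, (f i : ℂ) • V i j = (f j : ℂ) • V i j := by
    intro f
    have e : Φ (Matrix.diagonal fun i => (f i : ℂ)) =
        Matrix.diagonal (fun i => algebraMap ℂ P (f i)) := by
      simp [Φ, RingHom.mapMatrix_apply, Matrix.diagonal_map]
    unfold Commute SemiconjBy
    rw [e, ← Matrix.ext_iff]
    simp only [Matrix.diagonal_mul, Matrix.mul_diagonal, Algebra.smul_def]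
    refine forall_congr' fun i => forall_congr' fun j => ?_
    rw [← Algebra.commutes (f j : ℂ)]
  rw [hd] at h ⊢
  intro i j
  have := h i j
  rw [← sub_eq_zero, ← sub_smul, smul_eq_zero] at this
  rcases this with h0 | h0
  · have : l i = l j := by
      rw [sub_eq_zero] at h0
      exact_mod_cast h0
    simp [this]
  · rw [h0, smul_zero, smul_zero]

/-- The row `ξ^* w`. -/
def rowCoeff (w : I → I → P) (ξ : I → ℂ) (j : I) : P := ∑ i, star (ξ i) • w i j

lemma coeff_eq_sum_rowCoeff (w : I → I → P) (ξ η : I → ℂ) :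
    coeff w ξ η = ∑ j, η j • rowCoeff w ξ j := by
  unfold coeff rowCoeff
  rw [Finset.sum_comm]
  simp only [Finset.smul_sum, smul_smul, mul_comm]

/-- The matrix `h((ξ^* w)_j^* (ξ^* w)_l)`. -/
def gram (h : Module.Dual ℂ P) (w : I → I → P) (ξ : I → ℂ) : Matrix I I ℂ :=
  Matrix.of fun j l => h (star (rowCoeff w ξ j) * rowCoeff w ξ l)

/-- Reduces positivity of h to positivity of the Gram matrix. -/
lemma haar_coeff (h : Module.Dual ℂ P) (ξ η : I → ℂ) :
    h (star (coeff w ξ η) * coeff w ξ η) = star η ⬝ᵥ (gram h w ξ).mulVec η := by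
  simp only [coeff_eq_sum_rowCoeff, star_sum, star_smul, Finset.sum_mul_sum, smul_mul_smul_comm,
    map_sum, map_smul]
  simp only [dotProduct, Matrix.mulVec, gram, Matrix.of_apply, Finset.mul_sum, smul_eq_mul,
    Pi.star_apply]
  refine Finset.sum_congr rfl fun j _ => Finset.sum_congr rfl fun k _ => ?_
  ring

lemma comul_rowCoeff (hw : IsUnitaryCorep w c) (ξ : I → ℂ) (j : I) :
    Coalgebra.comul (R := ℂ) (rowCoeff w ξ j) = ∑ a, rowCoeff w ξ a ⊗ₜ w a j := by
  simp only [rowCoeff, map_sum, map_smul, hw.comul, Finset.smul_sum, TensorProduct.sum_tmul,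
    TensorProduct.smul_tmul']
  rw [Finset.sum_comm]

/-- Left invariance of h says w^* G w = G for the Gram matrix G, and multiplication by the unitary w
gives G w = w G. -/
lemma gram_intertwines (hw : IsUnitaryCorep w c)
    (hΔ : ∀ u : P, Coalgebra.comul (R := ℂ) (star u) = star (Coalgebra.comul (R := ℂ) u))
    {h : Module.Dual ℂ P} (hl : ∀ u, leftAct h u = h u • (1 : P)) (ξ : I → ℂ) :
    Intertwines w (gram h w ξ) := by
  have e : ∀ j l, ∑ a, ∑ b, gram h w ξ a b • (star (w a j) * w b l) = gram h w ξ j l • (1 : P) := by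
    intro j l
    change _ = h _ • (1 : P)
    rw [← hl]
    simp only [leftAct, LinearMap.comp_apply, LinearEquiv.coe_coe, Bialgebra.comul_mul, hΔ,
      comul_rowCoeff hw, star_sum, TensorProduct.star_tmul, Finset.sum_mul_sum,
      Algebra.TensorProduct.tmul_mul_tmul, map_sum, LinearMap.rTensor_tmul, TensorProduct.lid_tmul]
    rfl
  intro k l
  have e2 : ∑ j, w k j * (∑ a, ∑ b, gram h w ξ a b • (star (w a j) * w b l)) =
      ∑ j, gram h w ξ j l • w k j := by
    simp only [e, mul_smul_comm, mul_one]
  rw [← e2]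
  have e3 : ∑ j, w k j * (∑ a, ∑ b, gram h w ξ a b • (star (w a j) * w b l)) =
      ∑ a, ∑ b, gram h w ξ a b • ((∑ j, w k j * star (w a j)) * w b l) := by
    simp only [Finset.mul_sum, Finset.sum_mul, Finset.smul_sum, mul_smul_comm, mul_assoc]
    rw [Finset.sum_comm]
    exact Finset.sum_congr rfl fun a _ => Finset.sum_comm
  rw [e3]
  simp only [hw.mul_star, ite_mul, one_mul, zero_mul, smul_ite, smul_zero]
  rw [Finset.sum_comm]
  simp

/-- The relation `twist` evaluates the weighted sum inside P to a scalar, so the weighted trace is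
visibly nonnegative before anything is known about positivity of h. -/
lemma gram_trace (hw : IsUnitaryCorep w c) {h : Module.Dual ℂ P} (h1 : h 1 = 1) (ξ : I → ℂ) :
    ∑ j, (c j : ℂ) * gram h w ξ j j = ((∑ i, c i * ‖ξ i‖ ^ 2 : ℝ) : ℂ) := by
  have e : ∑ j, (c j : ℂ) • (star (rowCoeff w ξ j) * rowCoeff w ξ j) =
      ((∑ i, c i * ‖ξ i‖ ^ 2 : ℝ) : ℂ) • (1 : P) := by
    have e1 : ∑ j, (c j : ℂ) • (star (rowCoeff w ξ j) * rowCoeff w ξ j) =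
        ∑ i, ∑ k, (ξ i * star (ξ k)) • ∑ j, (c j : ℂ) • (star (w i j) * w k j) := by
      simp only [rowCoeff, star_sum, star_smul, star_star, Finset.sum_mul_sum,
        smul_mul_smul_comm, Finset.smul_sum]
      rw [Finset.sum_comm]
      refine Finset.sum_congr rfl fun i _ => ?_
      rw [Finset.sum_comm]
      refine Finset.sum_congr rfl fun k _ => Finset.sum_congr rfl fun j _ => ?_
      rw [smul_comm]
    rw [e1]
    simp only [hw.twist, smul_ite, smul_zero, Finset.sum_ite_eq, Finset.mem_univ, if_true,
      smul_smul, ← Finset.sum_smul]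
    congr 1
    push_cast
    refine Finset.sum_congr rfl fun i _ => ?_
    rw [← Complex.mul_conj', Complex.star_def, mul_comm]
  have := congrArg h e
  simp only [map_sum, map_smul, h1, smul_eq_mul, mul_one] at this
  exact this

/-- A self-adjoint intertwiner can be moved through w, from the row vector ξ to the column index.
This yields both the conjugation of the Gram matrix by p and the transfer of p from η to ξ. -/
lemma rowCoeff_mulVec {p : Matrix I I ℂ} (hp : p.conjTranspose = p) (hi : Intertwines w p)
    (ξ : I → ℂ) (l : I) : rowCoeff w (p.mulVec ξ) l = ∑ i, p i l • rowCoeff w ξ i := by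
  have hp' : ∀ i m, star (p i m) = p m i := fun i m => congrFun (congrFun hp m) i
  have e1 : rowCoeff w (p.mulVec ξ) l = ∑ m, star (ξ m) • ∑ i, p m i • w i l := by
    simp only [rowCoeff, Matrix.mulVec, dotProduct, star_sum, star_mul', Finset.sum_smul, hp',
      Finset.smul_sum, smul_smul]
    rw [Finset.sum_comm]
    refine Finset.sum_congr rfl fun m _ => Finset.sum_congr rfl fun i _ => ?_
    rw [mul_comm]
  rw [e1]
  simp only [← hi _ l, rowCoeff, Finset.smul_sum]
  rw [Finset.sum_comm]
  exact Finset.sum_congr rfl fun m _ => Finset.sum_congr rfl fun i _ => smul_comm _ _ _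

lemma gram_mulVec (h : Module.Dual ℂ P) {p : Matrix I I ℂ} (hp : p.conjTranspose = p)
    (hi : Intertwines w p) (ξ : I → ℂ) :
    gram h w (p.mulVec ξ) = p * gram h w ξ * p := by
  have hp' : ∀ i m, star (p i m) = p m i := fun i m => congrFun (congrFun hp m) i
  ext j l
  rw [Matrix.mul_assoc]
  simp only [gram, Matrix.of_apply, rowCoeff_mulVec hp hi, star_sum, star_smul, hp',
    Finset.sum_mul_sum, smul_mul_smul_comm, map_sum, map_smul, Matrix.mul_apply]
  simp only [Finset.mul_sum, smul_eq_mul]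
  refine Finset.sum_congr rfl fun a _ => Finset.sum_congr rfl fun b _ => ?_
  ring

/-- The Haar functional is positive and faithful. -/
lemma haar_pos (hP : IsSpannedByUnitary P)
    (hΔ : ∀ u : P, Coalgebra.comul (R := ℂ) (star u) = star (Coalgebra.comul (R := ℂ) u))
    {h : Module.Dual ℂ P} (h1 : h 1 = 1) (hl : ∀ u, leftAct h u = h u • (1 : P)) (u : P) :
    ∃ r : ℝ, 0 ≤ r ∧ h (star u * u) = r ∧ (r = 0 → u = 0) := by
  have : Nontrivial P := ⟨1, 0, fun h0 => by simp [h0] at h1⟩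
  obtain ⟨I, _, _, w, c, ξ, η, hw, rfl⟩ := hP u
  have hX : (gram h w ξ).IsHermitian := by
    ext j l
    rw [Matrix.conjTranspose_apply]
    change star (h _) = h _
    rw [← haar_star hP hΔ h1 hl, StarMul.star_mul, star_star]
  obtain ⟨U, l, hU, hU', hXU⟩ := exists_diagonalization hX
  change _ = conjDiag U l at hXU
  have hint := gram_intertwines hw hΔ hl ξ
  -- The trace formula for the vector g(X) ξ, X being the Gram matrix of ξ; the Gram matrix of g(X)
  -- ξ is g(X) X g(X).
  have key : ∀ g : ℝ → ℝ, ∑ j, c j * ∑ k, ‖U j k‖ ^ 2 * (g (l k) * l k * g (l k)) =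
      ∑ i, c i * ‖(conjDiag U (g ∘ l)).mulVec ξ i‖ ^ 2 := by
    intro g
    have hg : Intertwines w (conjDiag U (g ∘ l)) := (hXU ▸ hint).conjDiag hU hU' g
    have := gram_trace hw h1 ((conjDiag U (g ∘ l)).mulVec ξ)
    rw [gram_mulVec h (conjDiag_conjTranspose _) hg, hXU, conjDiag_mul hU', conjDiag_mul hU'] at this
    simp only [conjDiag_diag] at this
    exact_mod_cast this
  have hl0 : ∀ k, 0 ≤ l k := by
    by_contra! hex
    obtain ⟨k, hk⟩ := hex
    -- The indicator of the negative axis keeps only the negative eigenvalues; one such eigenvalue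
    -- would make the left side negative, while the right side is a sum of weighted squares.
    have e := key (fun x => if x < 0 then 1 else 0)
    have hpos : 0 ≤ ∑ i, c i * ‖(conjDiag U ((fun x : ℝ => if x < 0 then (1 : ℝ) else 0) ∘
        l)).mulVec ξ i‖ ^ 2 :=
      Finset.sum_nonneg fun i _ => mul_nonneg (hw.pos i).le (sq_nonneg _)
    rw [← e] at hpos
    have hterm : ∀ j k, ‖U j k‖ ^ 2 *
        ((if l k < 0 then (1 : ℝ) else 0) * l k * (if l k < 0 then 1 else 0)) ≤ 0 := by
      intro j k
      split_ifs with h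
      · simpa using mul_nonpos_of_nonneg_of_nonpos (sq_nonneg _) h.le
      · simp
    have hcol : ∃ j, U j k ≠ 0 := by
      by_contra! h0
      have := congrFun (congrFun hU' k) k
      rw [Matrix.mul_apply, Finset.sum_eq_zero (fun j _ => by rw [h0 j, mul_zero])] at this
      simp at this
    obtain ⟨j, hj⟩ := hcol
    refine absurd hpos (not_le.mpr ?_)
    refine Finset.sum_neg' (fun j _ => mul_nonpos_of_nonneg_of_nonpos (hw.pos j).le
      (Finset.sum_nonpos fun k _ => hterm j k)) ⟨j, Finset.mem_univ _, ?_⟩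
    refine mul_neg_of_pos_of_neg (hw.pos j) (Finset.sum_neg' (fun k _ => hterm j k)
      ⟨k, Finset.mem_univ _, ?_⟩)
    rw [if_pos hk, one_mul, mul_one]
    exact mul_neg_of_pos_of_neg (by positivity) hk
  refine ⟨_, ?_, by rw [haar_coeff, hXU, conjDiag_form], ?_⟩
  · exact Finset.sum_nonneg fun k _ => mul_nonneg (hl0 k) (sq_nonneg _)
  · intro h0
    rw [Finset.sum_eq_zero_iff_of_nonneg fun k _ => mul_nonneg (hl0 k) (sq_nonneg _)] at h0
    -- g(X) projects onto the kernel of X. It fixes η because the form vanishes at η, and it kills ξ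
    -- by the trace formula; moving it from η to ξ shows that the coefficient is zero.
    let g : ℝ → ℝ := fun x => if x = 0 then 1 else 0
    have hg : Intertwines w (conjDiag U (g ∘ l)) := (hXU ▸ hint).conjDiag hU hU' g
    have hη : (conjDiag U (g ∘ l)).mulVec η = η := by
      have e : Matrix.mulVec (Matrix.diagonal fun i => (((g ∘ l) i : ℝ) : ℂ))
          (U.conjTranspose.mulVec η) = U.conjTranspose.mulVec η := by
        ext k
        rw [Matrix.mulVec_diagonal]
        rcases mul_eq_zero.mp (h0 k (Finset.mem_univ k)) with h | h
        · simp [g, h]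
        · rw [sq_eq_zero_iff, norm_eq_zero] at h
          rw [h, mul_zero]
      unfold conjDiag
      rw [← Matrix.mulVec_mulVec, ← Matrix.mulVec_mulVec, e, Matrix.mulVec_mulVec, hU,
        Matrix.one_mulVec]
    have hξ : (conjDiag U (g ∘ l)).mulVec ξ = 0 := by
      have e := key g
      rw [Finset.sum_eq_zero (fun j _ => by
        rw [Finset.sum_eq_zero (fun k _ => by simp only [g]; split_ifs with h <;> simp [h]),
          mul_zero]), eq_comm, Finset.sum_eq_zero_iff_of_nonneg fun i _ =>
          mul_nonneg (hw.pos i).le (sq_nonneg _)] at e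
      ext i
      have := e i (Finset.mem_univ i)
      rw [mul_eq_zero, or_iff_right (hw.pos i).ne', sq_eq_zero_iff, norm_eq_zero] at this
      exact this
    have e : ∑ j, ((conjDiag U (g ∘ l)).mulVec η) j • rowCoeff w ξ j =
        ∑ i, η i • rowCoeff w ((conjDiag U (g ∘ l)).mulVec ξ) i := by
      simp only [rowCoeff_mulVec (conjDiag_conjTranspose _) hg, Matrix.mulVec, dotProduct,
        Finset.sum_smul, Finset.smul_sum, smul_smul]
      rw [Finset.sum_comm]
      exact Finset.sum_congr rfl fun j _ => Finset.sum_congr rfl fun i _ => by rw [mul_comm]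
    rw [coeff_eq_sum_rowCoeff, ← hη, e, hξ]
    simp [rowCoeff]

end positivity

/-! ### The conditional expectation onto a coideal `*`-subalgebra -/

section expectation

variable {P : Type*} [Ring P] [HopfAlgebra ℂ P] [StarRing P] [StarModule ℂ P]

/-- The inner product `⟪x, y⟫ = h(y x^*)`. -/
@[reducible] def haarCore (hP : IsSpannedByUnitary P)
    (hΔ : ∀ u : P, Coalgebra.comul (R := ℂ) (star u) = star (Coalgebra.comul (R := ℂ) u))
    {h : Module.Dual ℂ P} (h1 : h 1 = 1) (hl : ∀ u, leftAct h u = h u • (1 : P)) :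
    InnerProductSpace.Core ℂ P where
  inner x y := h (y * star x)
  conj_inner_symm x y := by
    have : Nontrivial P := ⟨1, 0, fun h0 => by simp [h0] at h1⟩
    change star (h _) = _
    rw [← haar_star hP hΔ h1 hl, StarMul.star_mul, star_star]
  re_inner_nonneg x := by
    obtain ⟨r, hr, h2, -⟩ := haar_pos hP hΔ h1 hl (star x)
    rw [star_star] at h2
    rw [h2]
    simpa using hr
  add_left x y z := by simp [mul_add]
  smul_left x y r := by simp
  definite x hx := by
    obtain ⟨r, hr, h2, h3⟩ := haar_pos hP hΔ h1 hl (star x)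
    rw [star_star, hx] at h2
    exact star_eq_zero.mp (h3 (by exact_mod_cast h2.symm))

variable {I : Type} [Fintype I] [DecidableEq I] {w : I → I → P} {c : I → ℝ}

/-- Orthogonality to all coefficients of w is preserved by `leftAct`. Right invariance applied to y
w_ij^* gives ∑_k y₁ h(y₂ w_kj^*) w_ik^* = 0; multiplying by w and using w^* w = 1 leaves y₁ h(y₂
w_lj^*) = 0. -/
lemma leftAct_mul_star_eq_zero (hP : IsSpannedByUnitary P)
    (hΔ : ∀ u : P, Coalgebra.comul (R := ℂ) (star u) = star (Coalgebra.comul (R := ℂ) u))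
    {h : Module.Dual ℂ P} (h1 : h 1 = 1) (hl : ∀ u, leftAct h u = h u • (1 : P))
    (hw : IsUnitaryCorep w c) {y : P} (hy : ∀ i j, h (y * star (w i j)) = 0)
    (f : Module.Dual ℂ P) (l j : I) : h (leftAct f y * star (w l j)) = 0 := by
  have : Nontrivial P := ⟨1, 0, fun h0 => by simp [h0] at h1⟩
  let g : I → Module.Dual ℂ P := fun k => h ∘ₗ LinearMap.mulRight ℂ (star (w k j))
  have e1 : ∀ i, ∑ k, rightAct (g k) y * star (w i k) = 0 := by
    intro i
    have : rightAct h (y * star (w i j)) = 0 := by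
      rw [haar_rightAct hP h1 hl, hy, zero_smul]
    rw [← this]
    simp only [rightAct, LinearMap.comp_apply, LinearEquiv.coe_coe, Bialgebra.comul_mul, hΔ,
      hw.comul, star_sum, TensorProduct.star_tmul]
    generalize (Coalgebra.comul y : P ⊗[ℂ] P) = X
    induction X using TensorProduct.induction_on with
    | zero => simp
    | tmul a b => simp [g, Finset.mul_sum]
    | add x y hx hy => simp only [map_add, add_mul, Finset.sum_add_distrib, hx, hy]
  have e2 : rightAct (g l) y = 0 := by
    have : ∑ i, (∑ k, rightAct (g k) y * star (w i k)) * w i l = rightAct (g l) y := by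
      simp only [Finset.sum_mul, mul_assoc]
      rw [Finset.sum_comm]
      simp only [← Finset.mul_sum, hw.star_mul]
      simp
    rw [← this]
    simp [e1]
  have := apply_leftAct f (g l) y
  rw [e2, map_zero] at this
  exact this

/-- A coideal `*`-subalgebra is the range of a module projection. -/
lemma exists_expectation (hP : IsSpannedByUnitary P) [Nontrivial P]
    (hΔ : ∀ u : P, Coalgebra.comul (R := ℂ) (star u) = star (Coalgebra.comul (R := ℂ) u))
    (B : Subalgebra ℂ P) (hstar : ∀ b ∈ B, star b ∈ B)
    (hB : ∀ (f : Module.Dual ℂ P), ∀ b ∈ B, rightAct f b ∈ B) :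
    ∃ E : P →ₗ[ℂ] P, (∀ u, E u ∈ B) ∧ (∀ b ∈ B, E b = b) ∧ ∀ u, ∀ b ∈ B, E (u * b) = E u * b := by
  obtain ⟨h, h1, hl⟩ := exists_haar hP
  let core := haarCore hP hΔ h1 hl
  let _ : NormedAddCommGroup P := core.toNormedAddCommGroup
  let _ : InnerProductSpace ℂ P := InnerProductSpace.ofCore core.toCore
  have hinner : ∀ x y : P, inner ℂ x y = h (y * star x) := fun _ _ => rfl
  let K : Submodule ℂ P := Subalgebra.toSubmodule B
  -- P need not be complete, so the projection has to be constructed: u is projected onto the part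
  -- of B in the finite-dimensional span C of the coefficients of one corepresentation.
  have hK : K.HasOrthogonalProjection := by
    refine ⟨fun u => ?_⟩
    obtain ⟨I, _, _, w, c, ξ, η, hw, hu⟩ := hP u
    let C : Submodule ℂ P := Submodule.span ℂ (Set.range fun p : I × I => w p.1 p.2)
    have hwC : ∀ i j, w i j ∈ C := fun i j => Submodule.subset_span ⟨(i, j), rfl⟩
    have huC : u ∈ C := by
      rw [hu]
      exact sum_mem fun i _ => sum_mem fun j _ => C.smul_mem _ (hwC i j)
    have hfin : FiniteDimensional ℂ C := FiniteDimensional.span_of_finite ℂ (Set.finite_range _)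
    have hfin' : FiniteDimensional ℂ (K ⊓ C : Submodule ℂ P) :=
      Submodule.finiteDimensional_inf_right K C
    have hproj : ∀ b ∈ K, C.starProjection b ∈ K := by
      intro b hb
      -- The projection onto C is the right action of this functional, since C and its complement
      -- are both respected; the coideal B is therefore mapped into itself.
      let g : Module.Dual ℂ P := Coalgebra.counit ∘ₗ C.starProjection.toLinearMap
      have hg1 : ∀ x ∈ C, rightAct g x = x := by
        intro x hx
        induction hx using Submodule.span_induction with
        | mem x hx =>
          obtain ⟨⟨i, j⟩, rfl⟩ := hx
          have : ∀ k, g (w k j) = if k = j then 1 else 0 := fun k => by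
            simp only [g, LinearMap.comp_apply, ContinuousLinearMap.coe_coe,
              Submodule.starProjection_eq_self_iff.mpr (hwC k j), hw.counit]
          simp [hw.rightAct, this]
        | zero => simp
        | add x y _ _ hx hy => rw [map_add, hx, hy]
        | smul a x _ hx => rw [map_smul, hx]
      have hg2 : ∀ y ∈ Cᗮ, rightAct g y = 0 := by
        intro y hy
        rw [← Module.forall_dual_apply_eq_zero_iff ℂ]
        intro f
        rw [← apply_leftAct]
        have hyw : ∀ i j, h (y * star (w i j)) = 0 := fun i j =>
          (C.mem_orthogonal y).mp hy _ (hwC i j)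
        have : leftAct f y ∈ Cᗮ := by
          rw [Submodule.mem_orthogonal]
          intro x hx
          induction hx using Submodule.span_induction with
          | mem x hx =>
            obtain ⟨⟨i, j⟩, rfl⟩ := hx
            exact leftAct_mul_star_eq_zero hP hΔ h1 hl hw hyw f i j
          | zero => simp
          | add x y _ _ hx hy => rw [inner_add_left, hx, hy, add_zero]
          | smul a x _ hx => rw [inner_smul_left, hx, mul_zero]
        simp only [g, LinearMap.comp_apply, ContinuousLinearMap.coe_coe,
          (Submodule.starProjection_apply_eq_zero_iff (K := C)).mpr this, map_zero]
      have e : rightAct g b = C.starProjection b := by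
        conv_lhs => rw [← add_sub_cancel (C.starProjection b) b]
        rw [map_add, hg1 _ (C.starProjection_apply_mem b),
          hg2 _ (C.sub_starProjection_mem_orthogonal b), add_zero]
      rw [← e]
      exact hB g b hb
    refine ⟨(K ⊓ C).starProjection u, ((K ⊓ C).starProjection_apply_mem u).1, ?_⟩
    rw [Submodule.mem_orthogonal]
    intro b hb
    set v := u - (K ⊓ C).starProjection u
    have hvC : v ∈ C := C.sub_mem huC ((K ⊓ C).starProjection_apply_mem u).2
    -- As v lies in C, an element b of B may be replaced by its projection to C, which is in B ∩ C.
    have e1 : inner ℂ b v = inner ℂ (C.starProjection b) v := by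
      rw [← sub_eq_zero, ← inner_sub_left]
      exact (C.mem_orthogonal' _).mp (C.sub_starProjection_mem_orthogonal b) v hvC
    rw [e1]
    exact ((K ⊓ C).mem_orthogonal v).mp ((K ⊓ C).sub_starProjection_mem_orthogonal u) _
      ⟨hproj b hb, C.starProjection_apply_mem b⟩
  refine ⟨K.starProjection.toLinearMap, fun u => K.starProjection_apply_mem u,
    fun b hb => Submodule.starProjection_eq_self_iff.mpr hb, fun u b hb => ?_⟩
  change K.starProjection (u * b) = K.starProjection u * b
  refine Submodule.eq_starProjection_of_mem_orthogonal
    (B.mul_mem (K.starProjection_apply_mem u) hb) ?_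
  rw [← sub_mul, Submodule.mem_orthogonal]
  intro b' hb'
  -- ⟪b', y b⟫ = h(y b b'^*) = ⟪b' b^*, y⟫, and b' b^* is in B. This is where stability of B under
  -- the star enters.
  have := (K.mem_orthogonal' _).mp (K.sub_starProjection_mem_orthogonal u) (b' * star b)
    (B.mul_mem hb' (hstar b hb))
  rw [← inner_conj_symm, starRingEnd_apply, star_eq_zero]
  rw [hinner] at this ⊢
  rwa [StarMul.star_mul, ← mul_assoc]

end expectation

namespace Uq

variable (q : ℝˣ) (n : ℕ)

instance : Nontrivial (Uq q n) :=
  (Bialgebra.counitAlgHom ℂ (Uq q n)).toRingHom.domain_nontrivial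

lemma rightAct_mem_projAlgebra (f : Module.Dual ℂ (Uq q (n + 1))) {b : Uq q (n + 1)}
    (hb : b ∈ projAlgebra q n) : rightAct f b ∈ projAlgebra q n := by
  obtain ⟨X, hX⟩ := comul_mem_of_mem_projAlgebra hb
  simp only [rightAct, LinearMap.comp_apply, LinearEquiv.coe_coe]
  rw [← hX]
  clear hX
  induction X using TensorProduct.induction_on with
  | zero => simp
  | tmul a b => simpa using (projAlgebra q n).smul_mem a.2 _
  | add x y hx hy => simpa only [map_add] using add_mem hx hy

/-- The invariant elements are generated by the products `s^i_N t^N_j`. -/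
lemma invariants_eq_projAlgebra : (invariants q n).toSubalgebra = projAlgebra q n := by
  refine le_antisymm (fun u hu => ?_) (projAlgebra_le_invariants)
  obtain ⟨E, hE, hEb, hEm⟩ := exists_expectation (isSpannedByUnitary q (n + 1))
    (comul_star q (n + 1)) (projAlgebra q n) (fun b hb => star_mem_projAlgebra hb)
    (fun f b hb => rightAct_mem_projAlgebra q n f hb)
  have hu' : coaction q n u = 1 ⊗ₜ u := hu
  let F : Uq q (n + 1) ⊗[ℂ] Uq q (n + 1) →ₗ[ℂ] Uq q (n + 1) :=
    LinearMap.mul' ℂ _ ∘ₗ E.rTensor _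
  -- By right linearity of E, the form p b ⊗ b' p' goes to E(p) b b' p', so p ω p' goes to E(p) m(ω)
  -- p' = 0.
  have hF : horizontalForms (projAlgebra q n) ≤ LinearMap.ker F := by
    refine Submodule.span_le.mpr ?_
    rintro _ ⟨p, p', ω, hω, rfl⟩
    have key : ∀ ω : projAlgebra q n ⊗[ℂ] projAlgebra q n,
        F ((p ⊗ₜ[ℂ] 1) * Algebra.TensorProduct.map (projAlgebra q n).val (projAlgebra q n).val ω *
          (1 ⊗ₜ[ℂ] p')) = E p * (LinearMap.mul' ℂ (projAlgebra q n) ω : _) * p' := by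
      intro ω
      induction ω using TensorProduct.induction_on with
      | zero => simp
      | tmul a b => simp [F, hEm _ _ a.2, mul_assoc]
      | add x y hx hy => simp only [map_add, mul_add, add_mul, hx, hy, Subalgebra.coe_add]
    change F _ = 0
    rw [key, show LinearMap.mul' ℂ (projAlgebra q n) ω = 0 from hω]
    simp
  -- Invariance of u puts u ⊗ 1 - 1 ⊗ u in the kernel of χ; F maps it to E(u) - u.
  have hker : u ⊗ₜ[ℂ] (1 : Uq q (n + 1)) - 1 ⊗ₜ[ℂ] u ∈
      LinearMap.ker (canonicalMap (coaction q n).toAlgHom) := by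
    rw [LinearMap.mem_ker, map_sub, canonicalMap_tmul, canonicalMap_tmul]
    change coaction q n u * 1 - coaction q n 1 * _ = 0
    rw [hu', map_one, mul_one, one_mul, sub_self]
  have := hF (ker_canonicalMap_coaction_le hker)
  rw [LinearMap.mem_ker, map_sub] at this
  simp only [F, LinearMap.comp_apply, LinearMap.rTensor_tmul, LinearMap.mul'_apply, mul_one,
    hEb 1 (one_mem _), one_mul, sub_eq_zero] at this
  rw [← this]
  exact hE u

end Uq

/-! ### The relations of the quantum sphere -/

section sphere

variable (q : ℝˣ) (n : ℕ)

lemma transposeSnd_Rmat_apply (a b c d : Fin n) :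
    transposeSnd (Rmat q n) (a, b) (c, d) = normFactor q n *
      ((if a = c ∧ b = d then (if a = b then ((q : ℝ) : ℂ) else 1) else 0) +
        if a = b ∧ c = d ∧ a < c then ((q : ℝ) : ℂ) - ((q : ℝ) : ℂ)⁻¹ else 0) := by
  simp only [transposeSnd, Rmat, Matrix.of_apply]
  split_ifs <;> first | (exfalso; grind) | simp

variable {n}

lemma sum_transposeSnd_left {M : Type*} [AddCommGroup M] [Module ℂ M] (a b : Fin n)
    (Y : Fin n × Fin n → M) :
    ∑ p, transposeSnd (Rmat q n) (a, b) p • Y p = normFactor q n •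
      ((if a = b then ((q : ℝ) : ℂ) else 1) • Y (a, b) +
        if a = b then (((q : ℝ) : ℂ) - ((q : ℝ) : ℂ)⁻¹) • ∑ c, (if a < c then Y (c, c) else 0)
          else 0) := by
  have h : ∀ c d, transposeSnd (Rmat q n) (a, b) (c, d) • Y (c, d) = normFactor q n •
      ((if a = c then (if b = d then (if a = b then ((q : ℝ) : ℂ) else 1) • Y (c, d) else 0)
        else 0) + if c = d then (if a = b then (((q : ℝ) : ℂ) - ((q : ℝ) : ℂ)⁻¹) •
          (if a < c then Y (c, d) else 0) else 0) else 0) := by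
    intro c d
    rw [transposeSnd_Rmat_apply, mul_smul, add_smul]
    split_ifs <;> first | (exfalso; grind) | simp
  simp only [Fintype.sum_prod_type, h, ← Finset.smul_sum, Finset.sum_add_distrib]
  simp only [Finset.sum_ite_irrel, Finset.sum_const_zero, Finset.sum_ite_eq, Finset.mem_univ,
    if_true, Finset.smul_sum]

lemma sum_transposeSnd_right {M : Type*} [AddCommGroup M] [Module ℂ M] (c d : Fin n)
    (Y : Fin n × Fin n → M) :
    ∑ p, transposeSnd (Rmat q n) p (c, d) • Y p = normFactor q n •
      ((if c = d then ((q : ℝ) : ℂ) else 1) • Y (c, d) +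
        if c = d then (((q : ℝ) : ℂ) - ((q : ℝ) : ℂ)⁻¹) • ∑ a, (if a < c then Y (a, a) else 0)
          else 0) := by
  have h : ∀ a b, transposeSnd (Rmat q n) (a, b) (c, d) • Y (a, b) = normFactor q n •
      ((if c = a then (if d = b then (if c = d then ((q : ℝ) : ℂ) else 1) • Y (a, b) else 0)
        else 0) + if a = b then (if c = d then (((q : ℝ) : ℂ) - ((q : ℝ) : ℂ)⁻¹) •
          (if a < c then Y (a, b) else 0) else 0) else 0) := by
    intro a b
    rw [transposeSnd_Rmat_apply, mul_smul, add_smul]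
    split_ifs <;> first | (exfalso; grind) | simp
  simp only [Fintype.sum_prod_type, h, ← Finset.smul_sum, Finset.sum_add_distrib]
  simp only [Finset.sum_ite_irrel, Finset.sum_const_zero, Finset.sum_ite_eq, Finset.mem_univ,
    if_true, Finset.smul_sum]

/-- The transposed matrix is diagonal off the pairs (a, a), and triangular with diagonal entries q
on them, up to the normalisation. -/
lemma isUnit_det_transposeSnd_Rmat : IsUnit (transposeSnd (Rmat q n)).det := by
  rw [← Matrix.isUnit_iff_isUnit_det, ← Matrix.mulVec_injective_iff_isUnit]
  change Function.Injective (transposeSnd (Rmat q n)).mulVecLin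
  rw [injective_iff_map_eq_zero]
  intro Y hY
  have h : ∀ a b, (if a = b then ((q : ℝ) : ℂ) else 1) • Y (a, b) +
      (if a = b then (((q : ℝ) : ℂ) - ((q : ℝ) : ℂ)⁻¹) • ∑ c, (if a < c then Y (c, c) else 0)
        else 0) = 0 := by
    intro a b
    have := congrFun hY (a, b)
    simp only [Matrix.mulVecLin_apply, Matrix.mulVec, dotProduct, ← smul_eq_mul] at this
    rw [sum_transposeSnd_left, Pi.zero_apply, smul_eq_zero] at this
    exact this.resolve_left (normFactor_ne q n)
  have hdiag : ∀ a, Y (a, a) = 0 := by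
    intro a
    induction a using WellFoundedGT.induction with
    | _ a ih =>
      have := h a a
      rw [if_pos rfl, if_pos rfl, Finset.sum_eq_zero, smul_zero, add_zero, smul_eq_zero] at this
      · exact this.resolve_left (q_ne q)
      · intro c _
        split_ifs with hc
        · exact ih c hc
        · rfl
  ext ⟨a, b⟩
  by_cases hab : a = b
  · subst hab
    exact hdiag a
  · simpa [hab] using h a b

/-- A telescoping geometric sum, starting from the largest index n - 1, where the exponent is 0. It
is the diagonal part of the linear system solved by the metric. -/
lemma sum_zpow_gt (a : Fin n) :
    ((q : ℝ) : ℂ) * ((q : ℝ) : ℂ) ^ (2 * ((a : ℕ) : ℤ) - 2 * (n : ℤ) + 2) +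
      (((q : ℝ) : ℂ) - ((q : ℝ) : ℂ)⁻¹) *
        ∑ c : Fin n, (if a < c then ((q : ℝ) : ℂ) ^ (2 * ((c : ℕ) : ℤ) - 2 * (n : ℤ) + 2) else 0) =
      (q : ℝ) := by
  have hz := q_ne q
  set z := ((q : ℝ) : ℂ)
  have key : ∀ m : ℕ, m < n → z * z ^ (2 * (m : ℤ) - 2 * (n : ℤ) + 2) +
      (z - z⁻¹) * ∑ c : Fin n, (if m < (c : ℕ) then z ^ (2 * ((c : ℕ) : ℤ) - 2 * (n : ℤ) + 2)
        else 0) = z := by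
    intro m hm
    induction hk : n - m generalizing m with
    | zero => omega
    | succ k ih =>
      by_cases hm' : m + 1 < n
      · have e := ih (m + 1) hm' (by omega)
        have hs : ∑ c : Fin n, (if m < (c : ℕ) then z ^ (2 * ((c : ℕ) : ℤ) - 2 * (n : ℤ) + 2)
            else 0) = z ^ (2 * ((m + 1 : ℕ) : ℤ) - 2 * (n : ℤ) + 2) +
            ∑ c : Fin n, (if m + 1 < (c : ℕ) then z ^ (2 * ((c : ℕ) : ℤ) - 2 * (n : ℤ) + 2)
            else 0) := by
          have : ∀ c : Fin n, (if m < (c : ℕ) then z ^ (2 * ((c : ℕ) : ℤ) - 2 * (n : ℤ) + 2)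
              else 0) = (if (⟨m + 1, hm'⟩ : Fin n) = c then
                z ^ (2 * ((c : ℕ) : ℤ) - 2 * (n : ℤ) + 2) else 0) +
              (if m + 1 < (c : ℕ) then z ^ (2 * ((c : ℕ) : ℤ) - 2 * (n : ℤ) + 2) else 0) := by
            intro c
            simp only [Fin.ext_iff]
            split_ifs <;> first | omega | simp
          simp only [this, Finset.sum_add_distrib, Finset.sum_ite_eq, Finset.mem_univ, if_true]
        have e2 : z ^ (2 * ((m + 1 : ℕ) : ℤ) - 2 * (n : ℤ) + 2) =
            z ^ (2 * (m : ℤ) - 2 * (n : ℤ) + 2) * z ^ 2 := by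
          rw [← zpow_natCast z 2, ← zpow_add₀ hz]
          congr 1
          push_cast
          ring
        rw [hs]
        rw [e2] at e ⊢
        generalize z ^ (2 * (m : ℤ) - 2 * (n : ℤ) + 2) = W at e ⊢
        have e3 : z * W + (z - z⁻¹) * (W * z ^ 2) = z * (W * z ^ 2) := by
          field_simp
          ring
        linear_combination e + e3
      · have : m + 1 = n := by omega
        subst this
        rw [Finset.sum_eq_zero, mul_zero, add_zero]
        · have : (2 * (m : ℤ) - 2 * ((m + 1 : ℕ) : ℤ) + 2) = 0 := by push_cast; ring
          rw [this, zpow_zero, mul_one]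
        · intro c _
          rw [if_neg (by omega)]
  exact key a a.2

/-- No inverse is computed: the proposed diagonal metric is checked to solve the linear system with
matrix R^{t₂} and right-hand side λ δ_{ab}. -/
lemma metric_eq (a b : Fin n) : metric q n a b =
    if a = b then ((q : ℝ) : ℂ) ^ (2 * ((a : ℕ) : ℤ) - 2 * (n : ℤ) + 2) else 0 := by
  let G : Fin n × Fin n → ℂ := fun p =>
    if p.1 = p.2 then ((q : ℝ) : ℂ) ^ (2 * ((p.1 : ℕ) : ℤ) - 2 * (n : ℤ) + 2) else 0
  let e : Fin n × Fin n → ℂ := fun p => if p.1 = p.2 then lam q n else 0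
  have hG : (transposeSnd (Rmat q n)).mulVec G = e := by
    ext ⟨a, b⟩
    simp only [Matrix.mulVec, dotProduct, ← smul_eq_mul]
    rw [sum_transposeSnd_left]
    by_cases hab : a = b
    · subst hab
      simp only [if_true, G, e, smul_eq_mul]
      rw [sum_zpow_gt, lam, mul_comm]
    · simp [hab, G, e]
  have hinv : (transposeSnd (Rmat q n))⁻¹.mulVec e = G := by
    rw [← hG, Matrix.mulVec_mulVec, Matrix.nonsing_inv_mul _ (isUnit_det_transposeSnd_Rmat q),
      Matrix.one_mulVec]
  have := congrFun hinv (b, a)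
  have h2 : G (b, a) = if a = b then ((q : ℝ) : ℂ) ^ (2 * ((a : ℕ) : ℤ) - 2 * (n : ℤ) + 2) else 0 := by
    by_cases h : a = b
    · simp [G, h]
    · simp [G, h, Ne.symm h]
  rw [← h2, ← this]
  simp only [metric, Rtilde, transposeSnd, Matrix.of_apply, Matrix.mulVec, dotProduct,
    Fintype.sum_prod_type, e, mul_ite, mul_zero, Finset.sum_ite_eq, Finset.mem_univ, if_true]
  exact Finset.sum_congr rfl fun c _ => mul_comm _ _

variable {A : Type*} [Ring A] [Algebra ℂ A] {q} {v x : Fin n → A}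

lemma sphere_vv_iff : (∀ i j, v i * v j = ∑ k, ∑ l, ((lam q n)⁻¹ * Rmat q n (i, j) (k, l)) •
      (v l * v k)) ↔ ∀ i j, ((q : ℝ) : ℂ) • (v i * v j) =
      (if i = j then ((q : ℝ) : ℂ) else 1) • (v j * v i) +
        (if i < j then ((q : ℝ) : ℂ) - ((q : ℝ) : ℂ)⁻¹ else 0) • (v i * v j) := by
  refine forall_congr' fun i => forall_congr' fun j => ?_
  simp only [mul_smul, ← Finset.smul_sum]
  rw [sum_Rmat_left q i j (fun c d => v d * v c), smul_smul, lam, mul_inv,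
    inv_mul_cancel_right₀ (normFactor_ne q n), eq_inv_smul_iff₀ (q_ne q)]

lemma sphere_xx_iff : (∀ i j, x i * x j = ∑ k, ∑ l, ((lam q n)⁻¹ * Rmat q n (k, l) (i, j)) •
      (x l * x k)) ↔ ∀ i j, ((q : ℝ) : ℂ) • (x i * x j) =
      (if i = j then ((q : ℝ) : ℂ) else 1) • (x j * x i) +
        (if j < i then ((q : ℝ) : ℂ) - ((q : ℝ) : ℂ)⁻¹ else 0) • (x i * x j) := by
  refine forall_congr' fun i => forall_congr' fun j => ?_
  simp only [mul_smul, ← Finset.smul_sum]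
  rw [sum_Rmat_right q i j (fun c d => x d * x c), smul_smul, lam, mul_inv,
    inv_mul_cancel_right₀ (normFactor_ne q n), eq_inv_smul_iff₀ (q_ne q)]

/-- Multiplying by R^{t₂} removes the inverse in R~ and gives the form in which `IsFRT.ts_exchange`
supplies the relation. -/
lemma sphere_xv_iff : (∀ i j, x i * v j = ∑ k, ∑ l, (lam q n * Rtilde q n (l, j) (i, k)) •
      (v k * x l)) ↔ ∀ a g, ((q : ℝ) : ℂ) • (v a * x g) =
      (if g = a then ((q : ℝ) : ℂ) else 1) • (x g * v a) +
        (if g = a then ((q : ℝ) : ℂ) - ((q : ℝ) : ℂ)⁻¹ else 0) •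
          ∑ d, (if d < g then x d * v d else 0) := by
  set M := transposeSnd (Rmat q n) with hM
  have hu : IsUnit M.det := isUnit_det_transposeSnd_Rmat q
  let Y : Fin n × Fin n → A := fun p => x p.1 * v p.2
  let Z : Fin n × Fin n → A := fun p => v p.2 * x p.1
  have e1 : (∀ i j, x i * v j = ∑ k, ∑ l, (lam q n * Rtilde q n (l, j) (i, k)) • (v k * x l)) ↔
      ∀ p, Y p = lam q n • ∑ r, M⁻¹ r p • Z r := by
    rw [Prod.forall]
    refine forall_congr' fun i => forall_congr' fun j => ?_
    rw [Fintype.sum_prod_type, Finset.sum_comm]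
    simp only [mul_smul, ← Finset.smul_sum]
    rfl
  have e2 : (∀ p, Y p = lam q n • ∑ r, M⁻¹ r p • Z r) ↔
      ∀ r, lam q n • Z r = ∑ p, M p r • Y p := by
    have aux : ∀ (A' B' : Matrix (Fin n × Fin n) (Fin n × Fin n) ℂ) (W : Fin n × Fin n → A) p,
        ∑ r, A' r p • ∑ s, B' s r • W s = ∑ s, (B' * A') s p • W s := by
      intro A' B' W p
      simp only [Finset.smul_sum, smul_smul, Matrix.mul_apply, Finset.sum_smul]
      rw [Finset.sum_comm]
      simp only [mul_comm]
    constructor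
    · intro h r
      simp only [h, smul_comm _ (lam q n), ← Finset.smul_sum]
      rw [aux, Matrix.nonsing_inv_mul _ hu]
      simp [Matrix.one_apply]
    · intro h p
      simp only [Finset.smul_sum, smul_comm (lam q n), h]
      rw [← Finset.sum_congr rfl fun r _ => Finset.smul_sum, aux, Matrix.mul_nonsing_inv _ hu]
      simp [Matrix.one_apply]
  rw [e1, e2, Prod.forall, forall_comm]
  refine forall_congr' fun a => forall_congr' fun g => ?_
  rw [sum_transposeSnd_right, lam, mul_comm, mul_smul,
    (smul_right_injective A (normFactor_ne q n)).eq_iff, ite_zero_smul]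

lemma sphere_norm_iff : ∑ a, ∑ b, metric q n a b • (v a * x b) = 1 ↔
    ∑ a : Fin n, (((q : ℝ) : ℂ) ^ (2 * ((a : ℕ) : ℤ) - 2 * (n : ℤ) + 2)) • (v a * x a) = 1 := by
  simp only [metric_eq, ite_smul, zero_smul, Finset.sum_ite_eq, Finset.mem_univ, if_true]

/-- The last row of `t` and the last column of `s` satisfy the relations of the quantum sphere. -/
lemma IsFRT.isSphere {t s : Fin (n + 1) → Fin (n + 1) → A} (h : IsFRT q t s) :
    IsSphere q (fun i => s i (Fin.last n)) (fun i => t (Fin.last n) i) where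
  vv := by
    rw [sphere_vv_iff]
    intro i j
    simpa using (h.s_relation i j (Fin.last n) (Fin.last n)).symm
  xx := by
    rw [sphere_xx_iff]
    intro i j
    simpa using (rtt_iff q t).mp h.rtt (Fin.last n) (Fin.last n) i j
  xv := by
    rw [sphere_xv_iff]
    intro a g
    -- With c = e = N the correction sum over b > N is empty.
    have := h.ts_exchange a (Fin.last n) (Fin.last n) g
    rw [if_pos rfl, Finset.sum_eq_zero (fun b _ => if_neg (not_lt.mpr (Fin.le_last b))), smul_zero,
      add_zero] at this
    exact this
  norm := by
    rw [sphere_norm_iff]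
    -- For size n + 1 the metric exponent is 2a - 2n, so the norm relation is this identity divided
    -- by q^(2n).
    have := h.twisted_st (Fin.last n) (Fin.last n)
    rw [if_pos rfl] at this
    have e : ∀ a : Fin (n + 1), ((q : ℝ) : ℂ) ^ (2 * ((a : ℕ) : ℤ) - 2 * ((n + 1 : ℕ) : ℤ) + 2) =
        ((q : ℝ) : ℂ) ^ (-(2 * (n : ℤ))) * ((q : ℝ) : ℂ) ^ (2 * ((a : ℕ) : ℤ)) := by
      intro a
      rw [← zpow_add₀ (q_ne q)]
      congr 1
      push_cast
      ring
    simp only [e, mul_smul, ← Finset.smul_sum, this]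
    rw [smul_smul, ← zpow_add₀ (q_ne q), Fin.val_last, neg_add_cancel, zpow_zero, one_smul]

end sphere

/-- The map `ι : S_q^{2n+1} → U_q(n+1)` with `ι(x_a) = t^{n+1}_a`. -/
def sphereMap (q : ℝˣ) (n : ℕ) : Sphere q (n + 1) →⋆ₐ[ℂ] Uq q (n + 1) :=
  Sphere.toStarHom (Sphere.lift (Uq.isFRT q (n + 1)).isSphere) (by intro i; simp)

@[simp] lemma sphereMap_x (q : ℝˣ) (n : ℕ) (a : Fin (n + 1)) :
    sphereMap q n (Sphere.x q a) = Uq.t q (Fin.last n) a :=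
  Sphere.lift_x (Uq.isFRT q (n + 1)).isSphere a

@[simp] lemma sphereMap_v (q : ℝˣ) (n : ℕ) (a : Fin (n + 1)) :
    sphereMap q n (Sphere.v q a) = Uq.s q a (Fin.last n) :=
  Sphere.lift_v (Uq.isFRT q (n + 1)).isSphere a

/-! ### Ordered monomials -/

section monomials

variable {A : Type*} [Ring A] [Algebra ℂ A]

/-- The ordered monomial `∏ i, v_i ^ (e i).1 * x_i ^ (e i).2`. -/
def orderedMonomial : {n : ℕ} → (v x : Fin n → A) → (Fin n → ℕ × ℕ) → A
  | 0, _, _, _ => 1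
  | n + 1, v, x, e =>
    orderedMonomial (Fin.init v) (Fin.init x) (Fin.init e) *
      (v (Fin.last n) ^ (e (Fin.last n)).1 * x (Fin.last n) ^ (e (Fin.last n)).2)

/-- The total degree of an ordered monomial. -/
def expDegree {n : ℕ} (e : Fin n → ℕ × ℕ) : ℕ := ∑ i, ((e i).1 + (e i).2)

lemma expDegree_succ {n : ℕ} (e : Fin (n + 1) → ℕ × ℕ) :
    expDegree e = expDegree (Fin.init e) + ((e (Fin.last n)).1 + (e (Fin.last n)).2) :=
  Fin.sum_univ_castSucc _

lemma map_orderedMonomial {B : Type*} [Ring B] [Algebra ℂ B] (f : A →ₐ[ℂ] B) {n : ℕ}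
    (v x : Fin n → A) (e : Fin n → ℕ × ℕ) :
    f (orderedMonomial v x e) = orderedMonomial (f ∘ v) (f ∘ x) e := by
  induction n with
  | zero => exact map_one f
  | succ n ih =>
    simp only [orderedMonomial, map_mul, map_pow, ih]
    rfl

/-- Relations which allow to write all words in `v_i`, `x_i` in terms of ordered monomials of the
same degree. -/
structure IsOrderable {n : ℕ} (v x : Fin n → A) : Prop where
  vv : ∀ i j, i < j → ∃ c : ℂ, v j * v i = c • (v i * v j)
  vx : ∀ i j, i < j → ∃ c : ℂ, v j * x i = c • (x i * v j)
  xv : ∀ i j, i < j → ∃ c : ℂ, x j * v i = c • (v i * x j)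
  xx : ∀ i j, i < j → ∃ c : ℂ, x j * x i = c • (x i * x j)
  comm : ∀ j, ∃ c : ℂ, x j * v j - v j * x j = c • ∑ d, if d < j then x d * v d else 0

/-- The span of the generators. -/
def genSpan {n : ℕ} (v x : Fin n → A) : Submodule ℂ A :=
  Submodule.span ℂ (Set.range v ∪ Set.range x)

lemma v_mem_genSpan {n : ℕ} (v x : Fin n → A) (i : Fin n) : v i ∈ genSpan v x :=
  Submodule.subset_span (Or.inl ⟨i, rfl⟩)

lemma x_mem_genSpan {n : ℕ} (v x : Fin n → A) (i : Fin n) : x i ∈ genSpan v x :=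
  Submodule.subset_span (Or.inr ⟨i, rfl⟩)

lemma genSpan_succ_le {n : ℕ} (v x : Fin (n + 1) → A) :
    genSpan v x ≤ genSpan (Fin.init v) (Fin.init x) ⊔
      Submodule.span ℂ {v (Fin.last n), x (Fin.last n)} := by
  refine Submodule.span_le.mpr ?_
  rintro _ (⟨i, rfl⟩ | ⟨i, rfl⟩)
  · cases i using Fin.lastCases with
    | last => exact Submodule.mem_sup_right (Submodule.subset_span (by simp))
    | cast i => exact Submodule.mem_sup_left (v_mem_genSpan (Fin.init v) (Fin.init x) i)
  · cases i using Fin.lastCases with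
    | last => exact Submodule.mem_sup_right (Submodule.subset_span (by simp))
    | cast i => exact Submodule.mem_sup_left (x_mem_genSpan (Fin.init v) (Fin.init x) i)

lemma IsOrderable.init {n : ℕ} {v x : Fin (n + 1) → A} (h : IsOrderable v x) :
    IsOrderable (Fin.init v) (Fin.init x) where
  vv i j hij := h.vv _ _ (Fin.castSucc_lt_castSucc_iff.mpr hij)
  vx i j hij := h.vx _ _ (Fin.castSucc_lt_castSucc_iff.mpr hij)
  xv i j hij := h.xv _ _ (Fin.castSucc_lt_castSucc_iff.mpr hij)
  xx i j hij := h.xx _ _ (Fin.castSucc_lt_castSucc_iff.mpr hij)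
  comm j := by
    obtain ⟨c, hc⟩ := h.comm j.castSucc
    refine ⟨c, ?_⟩
    rw [Fin.sum_univ_castSucc, if_neg (not_lt.mpr (Fin.castSucc_lt_last j).le), add_zero] at hc
    simp only [Fin.castSucc_lt_castSucc_iff] at hc
    exact hc

/-- An element which commutes with the generators of `G` up to scalars can be moved past `G ^ j`. -/
lemma exists_pow_mem_mul_eq {G : Submodule ℂ A} {z : A}
    (hz : ∀ g ∈ G, ∃ g' ∈ G, z * g = g' * z) (j : ℕ) :
    ∀ g ∈ G ^ j, ∃ g' ∈ G ^ j, z * g = g' * z := by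
  induction j with
  | zero =>
    intro g hg
    rw [pow_zero, Submodule.mem_one] at hg
    obtain ⟨r, rfl⟩ := hg
    exact ⟨_, by simp [Submodule.mem_one], (Algebra.commutes r z).symm⟩
  | succ j ih =>
    intro g hg
    rw [pow_succ] at hg
    induction hg using Submodule.mul_induction_on' with
    | mem_mul_mem a ha b hb =>
      obtain ⟨a', ha', h1⟩ := ih a ha
      obtain ⟨b', hb', h2⟩ := hz b hb
      exact ⟨a' * b', by rw [pow_succ]; exact Submodule.mul_mem_mul ha' hb', by
        rw [← mul_assoc, h1, mul_assoc, h2, mul_assoc]⟩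
    | add a _ b _ ha hb =>
      obtain ⟨a', ha', h1⟩ := ha
      obtain ⟨b', hb', h2⟩ := hb
      exact ⟨a' + b', add_mem ha' hb', by rw [mul_add, h1, h2, add_mul]⟩

lemma exists_mem_genSpan_mul_eq {n : ℕ} {v x : Fin n → A} {z : A}
    (hv : ∀ i, ∃ c : ℂ, z * v i = c • (v i * z)) (hx : ∀ i, ∃ c : ℂ, z * x i = c • (x i * z)) :
    ∀ g ∈ genSpan v x, ∃ g' ∈ genSpan v x, z * g = g' * z := by
  intro g hg
  unfold genSpan at hg
  induction hg using Submodule.span_induction with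
  | mem g hg =>
    rcases hg with ⟨i, rfl⟩ | ⟨i, rfl⟩
    · obtain ⟨c, hc⟩ := hv i
      exact ⟨c • v i, Submodule.smul_mem _ _ (v_mem_genSpan v x i), by rw [hc, smul_mul_assoc]⟩
    · obtain ⟨c, hc⟩ := hx i
      exact ⟨c • x i, Submodule.smul_mem _ _ (x_mem_genSpan v x i), by rw [hc, smul_mul_assoc]⟩
  | zero => exact ⟨0, zero_mem _, by simp⟩
  | add a b _ _ ha hb =>
    obtain ⟨a', ha', h1⟩ := ha
    obtain ⟨b', hb', h2⟩ := hb
    exact ⟨a' + b', add_mem ha' hb', by rw [mul_add, h1, h2, add_mul]⟩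
  | smul r a _ ha =>
    obtain ⟨a', ha', h1⟩ := ha
    exact ⟨r • a', Submodule.smul_mem _ _ ha', by rw [mul_smul_comm, h1, smul_mul_assoc]⟩

/-- The span of the products `g v^a x^b` of total degree `D`, where `g ∈ G ^ j`. -/
def orderedSpan (G : Submodule ℂ A) (v x : A) (D : ℕ) : Submodule ℂ A :=
  Submodule.span ℂ {u | ∃ (j a b : ℕ), j + (a + b) = D ∧ ∃ g ∈ G ^ j, u = g * (v ^ a * x ^ b)}

/-- Each passage of x through one v costs a commutator in G ^ 2, and v moves past G ^ 2, so the
whole correction keeps the form g v^a. -/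
lemma mul_pow_sub_mem {G : Submodule ℂ A} {v x : A} (hv : ∀ g ∈ G, ∃ g' ∈ G, v * g = g' * v)
    (hc : x * v - v * x ∈ G ^ 2) (a : ℕ) :
    ∃ g ∈ G ^ 2, x * v ^ (a + 1) = v ^ (a + 1) * x + g * v ^ a := by
  induction a with
  | zero => exact ⟨_, hc, by simp⟩
  | succ a ih =>
    obtain ⟨g, hg, h⟩ := ih
    have hva : ∀ k, ∀ g ∈ G ^ 2, ∃ g' ∈ G ^ 2, v ^ k * g = g' * v ^ k := by
      intro k
      induction k with
      | zero => exact fun g hg => ⟨g, hg, by simp⟩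
      | succ k ih =>
        intro g hg
        obtain ⟨g1, hg1, h1⟩ := exists_pow_mem_mul_eq hv 2 g hg
        obtain ⟨g2, hg2, h2⟩ := ih g1 hg1
        exact ⟨g2, hg2, by rw [pow_succ, mul_assoc, h1, ← mul_assoc, h2, mul_assoc]⟩
    obtain ⟨g', hg', h'⟩ := hva (a + 1) _ hc
    refine ⟨g' + g, add_mem hg' hg, ?_⟩
    rw [pow_succ v (a + 1), ← mul_assoc, h, add_mul, mul_assoc _ x v, mul_assoc g, ← pow_succ,
      add_mul, ← h']
    noncomm_ring

/-- A new generator is first moved past G ^ j. The only reordering is x past v^(a+1), whose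
correction trades one x and one v for two factors from G, so the total degree is unchanged. -/
lemma mul_mem_orderedSpan {G : Submodule ℂ A} {v x : A}
    (hv : ∀ g ∈ G, ∃ g' ∈ G, v * g = g' * v) (hx : ∀ g ∈ G, ∃ g' ∈ G, x * g = g' * x)
    (hc : x * v - v * x ∈ G ^ 2) {D : ℕ} {z u : A} (hz : z ∈ G ⊔ Submodule.span ℂ {v, x})
    (hu : u ∈ orderedSpan G v x D) : z * u ∈ orderedSpan G v x (D + 1) := by
  unfold orderedSpan at hu
  induction hu using Submodule.span_induction with
  | zero => simp
  | add a b _ _ ha hb => rw [mul_add]; exact add_mem ha hb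
  | smul r a _ ha => rw [mul_smul_comm]; exact Submodule.smul_mem _ _ ha
  | mem u hu =>
    obtain ⟨j, a, b, hD, g, hg, rfl⟩ := hu
    rw [Submodule.mem_sup] at hz
    obtain ⟨g0, hg0, y, hy, rfl⟩ := hz
    rw [add_mul]
    refine add_mem ?_ ?_
    · refine Submodule.subset_span ⟨j + 1, a, b, by omega, g0 * g, ?_, by rw [mul_assoc]⟩
      rw [pow_succ']
      exact Submodule.mul_mem_mul hg0 hg
    · rw [Submodule.mem_span_pair] at hy
      obtain ⟨r, r', rfl⟩ := hy
      rw [add_mul, smul_mul_assoc, smul_mul_assoc]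
      refine add_mem (Submodule.smul_mem _ _ ?_) (Submodule.smul_mem _ _ ?_)
      · obtain ⟨g', hg', h⟩ := exists_pow_mem_mul_eq hv j g hg
        refine Submodule.subset_span ⟨j, a + 1, b, by omega, g', hg', ?_⟩
        rw [← mul_assoc, h, pow_succ']
        simp only [mul_assoc]
      · obtain ⟨g', hg', h⟩ := exists_pow_mem_mul_eq hx j g hg
        rw [← mul_assoc, h]
        cases a with
        | zero =>
          refine Submodule.subset_span ⟨j, 0, b + 1, by omega, g', hg', ?_⟩
          rw [pow_succ', pow_zero, one_mul, one_mul, mul_assoc]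
        | succ a =>
          obtain ⟨k, hk, h2⟩ := mul_pow_sub_mem hv hc a
          have e : g' * x * (v ^ (a + 1) * x ^ b) =
              g' * (v ^ (a + 1) * x ^ (b + 1)) + (g' * k) * (v ^ a * x ^ b) := by
            calc _ = g' * (x * v ^ (a + 1)) * x ^ b := by simp only [mul_assoc]
              _ = _ := by rw [h2, pow_succ' x]; simp only [mul_assoc, mul_add, add_mul]
          rw [e]
          refine add_mem (Submodule.subset_span ⟨j, a + 1, b + 1, by omega, g', hg', rfl⟩)
            (Submodule.subset_span ⟨j + 2, a, b, by omega, g' * k, ?_, rfl⟩)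
          rw [pow_add]
          exact Submodule.mul_mem_mul hg' hk

/-- Induction on the number of pairs: the last pair normalises the span G of the others and is
collected on the right, its own commutator lying in G ^ 2. -/
lemma genSpan_pow_le {n : ℕ} {v x : Fin n → A} (h : IsOrderable v x) (D : ℕ) :
    genSpan v x ^ D ≤
      Submodule.span ℂ {u | ∃ e, expDegree e = D ∧ u = orderedMonomial v x e} := by
  induction n generalizing D with
  | zero =>
    have h0 : genSpan v x = ⊥ := by simp [genSpan]
    rw [h0]
    cases D with
    | zero =>
      rw [pow_zero, Submodule.one_eq_span]
      exact Submodule.span_mono (by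
        rintro _ rfl
        exact ⟨Fin.elim0, by simp [expDegree], rfl⟩)
    | succ D => rw [pow_succ, Submodule.mul_bot]; exact bot_le
  | succ n ih =>
    set G := genSpan (Fin.init v) (Fin.init x)
    have hv : ∀ g ∈ G, ∃ g' ∈ G, v (Fin.last n) * g = g' * v (Fin.last n) :=
      exists_mem_genSpan_mul_eq (fun i => h.vv _ _ (Fin.castSucc_lt_last i))
        (fun i => h.vx _ _ (Fin.castSucc_lt_last i))
    have hx : ∀ g ∈ G, ∃ g' ∈ G, x (Fin.last n) * g = g' * x (Fin.last n) :=
      exists_mem_genSpan_mul_eq (fun i => h.xv _ _ (Fin.castSucc_lt_last i))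
        (fun i => h.xx _ _ (Fin.castSucc_lt_last i))
    have hc : x (Fin.last n) * v (Fin.last n) - v (Fin.last n) * x (Fin.last n) ∈ G ^ 2 := by
      obtain ⟨c, hc⟩ := h.comm (Fin.last n)
      rw [hc]
      refine Submodule.smul_mem _ _ (sum_mem fun d _ => ?_)
      split_ifs with hd
      · cases d using Fin.lastCases with
        | last => exact absurd hd (lt_irrefl _)
        | cast d =>
          rw [pow_two]
          exact Submodule.mul_mem_mul (x_mem_genSpan (Fin.init v) (Fin.init x) d)
            (v_mem_genSpan (Fin.init v) (Fin.init x) d)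
      · exact zero_mem _
    have h1 : genSpan v x ^ D ≤ orderedSpan G (v (Fin.last n)) (x (Fin.last n)) D := by
      induction D with
      | zero =>
        rw [pow_zero, Submodule.one_eq_span]
        refine Submodule.span_mono ?_
        rintro _ rfl
        exact ⟨0, 0, 0, rfl, 1, by rw [pow_zero, Submodule.mem_one]; exact ⟨1, map_one _⟩, by simp⟩
      | succ D ihD =>
        rw [pow_succ', Submodule.mul_le]
        exact fun z hz u hu => mul_mem_orderedSpan hv hx hc (genSpan_succ_le v x hz) (ihD hu)
    refine h1.trans (Submodule.span_le.mpr ?_)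
    rintro _ ⟨j, a, b, hD, g, hg, rfl⟩
    have hg' := ih h.init j hg
    clear hg
    induction hg' using Submodule.span_induction with
    | mem g hg =>
      obtain ⟨e, he, rfl⟩ := hg
      refine Submodule.subset_span ⟨Fin.snoc (α := fun _ => ℕ × ℕ) e (a, b), ?_, ?_⟩
      · rw [expDegree_succ]
        simp [he, hD]
      · simp [orderedMonomial]
    | zero => simp
    | add _ _ _ _ h1 h2 => rw [add_mul]; exact add_mem h1 h2
    | smul r _ _ h1 => rw [smul_mul_assoc]; exact Submodule.smul_mem _ _ h1

lemma sphere_isOrderable (q : ℝˣ) (n : ℕ) :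
    IsOrderable (Sphere.v q (n := n)) (Sphere.x q (n := n)) where
  vv i j hij := by
    refine ⟨((q : ℝ) : ℂ)⁻¹, ?_⟩
    have h := sphere_vv_iff.mp (Sphere.isSphere q n).vv j i
    rw [if_neg hij.ne', if_neg hij.not_gt, zero_smul, add_zero, one_smul] at h
    rw [← h, inv_smul_smul₀ (q_ne q)]
  xx i j hij := by
    refine ⟨((q : ℝ) : ℂ), ?_⟩
    have h := sphere_xx_iff.mp (Sphere.isSphere q n).xx i j
    rw [if_neg hij.ne, if_neg hij.not_gt, zero_smul, add_zero, one_smul] at h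
    exact h.symm
  vx i j hij := by
    refine ⟨((q : ℝ) : ℂ)⁻¹, ?_⟩
    have h := sphere_xv_iff.mp (Sphere.isSphere q n).xv j i
    rw [if_neg hij.ne, if_neg hij.ne, zero_smul, add_zero, one_smul] at h
    rw [← h, inv_smul_smul₀ (q_ne q)]
  xv i j hij := by
    refine ⟨((q : ℝ) : ℂ), ?_⟩
    have h := sphere_xv_iff.mp (Sphere.isSphere q n).xv i j
    rw [if_neg hij.ne', if_neg hij.ne', zero_smul, add_zero, one_smul] at h
    exact h.symm
  comm j := by
    refine ⟨-(((q : ℝ) : ℂ)⁻¹ * (((q : ℝ) : ℂ) - ((q : ℝ) : ℂ)⁻¹)), ?_⟩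
    have h := sphere_xv_iff.mp (Sphere.isSphere q n).xv j j
    rw [if_pos rfl, if_pos rfl] at h
    rw [neg_smul, mul_smul, eq_neg_iff_add_eq_zero]
    apply smul_right_injective _ (q_ne q)
    simp only [smul_add, smul_sub, smul_zero, smul_inv_smul₀ (q_ne q), h, sub_add_eq_add_sub,
      sub_self]

/-- Every element of the quantum sphere is a combination of ordered monomials of two consecutive
degrees. -/
lemma exists_orderedMonomial_span (q : ℝˣ) (n : ℕ) (u : Sphere q n) : ∃ D,
    u ∈ Submodule.span ℂ {y | ∃ e, (expDegree e = D ∨ expDegree e = D + 1) ∧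
      y = orderedMonomial (Sphere.v q) (Sphere.x q) e} := by
  set G := genSpan (Sphere.v q (n := n)) (Sphere.x q) with hG
  -- The norm relation writes 1 in degree two, so degrees can be raised in steps of two; two
  -- consecutive degrees form an increasing chain.
  have h1 : (1 : Submodule ℂ (Sphere q n)) ≤ G ^ 2 := by
    rw [Submodule.one_eq_span, Submodule.span_singleton_le_iff_mem,
      ← sphere_norm_iff.mp (Sphere.isSphere q n).norm]
    refine sum_mem fun a _ => Submodule.smul_mem _ _ ?_
    rw [pow_two]
    exact Submodule.mul_mem_mul (v_mem_genSpan _ _ a) (x_mem_genSpan _ _ a)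
  have h2 : ∀ D, G ^ D ≤ G ^ (D + 2) := fun D => by
    rw [pow_add]
    conv_lhs => rw [← mul_one (G ^ D)]
    exact mul_le_mul' le_rfl h1
  have hmono : Monotone fun D => G ^ D ⊔ G ^ (D + 1) := monotone_nat_of_le_succ fun D => by
    rw [sup_comm]
    exact sup_le_sup le_rfl (h2 D)
  have key : ∃ D, u ∈ G ^ D ⊔ G ^ (D + 1) := by
    induction u using Sphere.induction with
    | halg r =>
      refine ⟨0, Submodule.mem_sup_left ?_⟩
      rw [pow_zero, Submodule.mem_one]
      exact ⟨r, rfl⟩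
    | hv i => exact ⟨0, Submodule.mem_sup_right (by rw [zero_add, pow_one]; exact v_mem_genSpan _ _ i)⟩
    | hx i => exact ⟨0, Submodule.mem_sup_right (by rw [zero_add, pow_one]; exact x_mem_genSpan _ _ i)⟩
    | hmul a b ha hb =>
      obtain ⟨D, hD⟩ := ha
      obtain ⟨E, hE⟩ := hb
      refine ⟨D + E + 1, ?_⟩
      have := Submodule.mul_mem_mul hD hE
      refine (?_ : (G ^ D ⊔ G ^ (D + 1)) * (G ^ E ⊔ G ^ (E + 1)) ≤ _) this
      rw [Submodule.sup_mul, Submodule.mul_sup, Submodule.mul_sup, ← pow_add, ← pow_add, ← pow_add,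
        ← pow_add]
      refine sup_le (sup_le ((h2 _).trans ?_) ?_) (sup_le ?_ ?_)
      · exact le_sup_right
      · exact le_sup_left
      · rw [show D + 1 + E = D + E + 1 by ring]; exact le_sup_left
      · rw [show D + 1 + (E + 1) = D + E + 1 + 1 by ring]; exact le_sup_right
    | hadd a b ha hb =>
      obtain ⟨D, hD⟩ := ha
      obtain ⟨E, hE⟩ := hb
      exact ⟨max D E, add_mem (hmono (le_max_left D E) hD) (hmono (le_max_right D E) hE)⟩
  obtain ⟨D, hD⟩ := key
  refine ⟨D, (?_ : G ^ D ⊔ G ^ (D + 1) ≤ _) hD⟩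
  refine sup_le ((genSpan_pow_le (sphere_isOrderable q n) D).trans (Submodule.span_mono ?_))
    ((genSpan_pow_le (sphere_isOrderable q n) (D + 1)).trans (Submodule.span_mono ?_))
  · rintro _ ⟨e, he, rfl⟩
    exact ⟨e, Or.inl he, rfl⟩
  · rintro _ ⟨e, he, rfl⟩
    exact ⟨e, Or.inr he, rfl⟩

end monomials

/-! ### A faithful family for the sphere -/

section family

variable {A : Type*} [Ring A] [Algebra ℂ A]

/-- The block matrix `diag(1, …, 1, T)` with a `2 × 2` block `T`. -/
def blockLast (T : Fin 2 → Fin 2 → A) : (n : ℕ) → Fin (n + 2) → Fin (n + 2) → A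
  | 0 => T
  | n + 1 => extendFirst (blockLast T n)

lemma IsFRT.blockLast {q : ℝˣ} {t s : Fin 2 → Fin 2 → A} (h : IsFRT q t s) (n : ℕ) :
    IsFRT q (blockLast t n) (blockLast s n) := by
  induction n with
  | zero => exact h
  | succ n ih => exact ih.extendFirst

variable (T : Fin 2 → Fin 2 → A) (n : ℕ)

lemma blockLast_last_last : blockLast T n (Fin.last _) (Fin.last _) = T 1 1 := by
  induction n with
  | zero => rfl
  | succ n ih => exact ih

lemma blockLast_last_prev :
    blockLast T n (Fin.last _) (Fin.last n).castSucc = T 1 0 := by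
  induction n with
  | zero => rfl
  | succ n ih => exact ih

lemma blockLast_prev_last :
    blockLast T n (Fin.last n).castSucc (Fin.last _) = T 0 1 := by
  induction n with
  | zero => rfl
  | succ n ih => exact ih

lemma blockLast_last_castSucc (j : Fin n) :
    blockLast T n (Fin.last _) j.castSucc.castSucc = 0 := by
  induction n with
  | zero => exact j.elim0
  | succ n ih =>
    cases j using Fin.cases with
    | zero => rfl
    | succ j => exact ih j

lemma blockLast_castSucc_last (j : Fin n) :
    blockLast T n j.castSucc.castSucc (Fin.last _) = 0 := by
  induction n with
  | zero => exact j.elim0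
  | succ n ih =>
    cases j using Fin.cases with
    | zero => rfl
    | succ j => exact ih j

/-- The rank-one case with both off-diagonal entries equal to y; the second matrix is the antipode
of the first. -/
lemma isFRT_two (q : ℝˣ) {a y d : A} (hay : y * a = ((q : ℝ) : ℂ) • (a * y))
    (hdy : d * y = ((q : ℝ) : ℂ) • (y * d)) (had : a * d = 1 + ((q : ℝ) : ℂ)⁻¹ • (y * y))
    (hda : d * a = 1 + ((q : ℝ) : ℂ) • (y * y)) :
    IsFRT q ![![a, y], ![y, d]] ![![d, -((q : ℝ) : ℂ) • y], ![-((q : ℝ) : ℂ)⁻¹ • y, a]] where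
  rtt := by
    have hq := q_ne q
    rw [rtt_iff]
    intro i j k l
    fin_cases i <;> fin_cases j <;> fin_cases k <;> fin_cases l <;>
      simp [hay, hdy, had, hda, -Complex.coe_smul] <;> match_scalars <;> field_simp <;> ring
  ts i j := by
    have hq := q_ne q
    fin_cases i <;> fin_cases j <;>
      simp [hay, hdy, had, hda, Fin.sum_univ_two, -Complex.coe_smul, smul_smul, hq]
  st i j := by
    have hq := q_ne q
    fin_cases i <;> fin_cases j <;>
      simp [hay, hdy, had, hda, Fin.sum_univ_two, -Complex.coe_smul, smul_smul, hq]

end family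

/-! ### Shift operators on a lattice and their leading terms. -/

section torus

/-- Functions on the lattice, on which the quantum torus acts. -/
abbrev Lattice : Type := ℤ → ℤ → ℂ

/-- The translation in the first variable. -/
def shiftFst : Module.End ℂ Lattice where
  toFun f i j := f (i - 1) j
  map_add' _ _ := rfl
  map_smul' _ _ := rfl

/-- The `q`-twisted translation in the second variable. -/
def shiftSnd (q : ℝˣ) : Module.End ℂ Lattice where
  toFun f i j := ((q : ℝ) : ℂ) ^ i * f i (j - 1)
  map_add' f g := by ext i j; simp [mul_add]
  map_smul' r f := by ext i j; simp [mul_left_comm]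

/-- The inverse of the twisted translation in the second variable. -/
def shiftSndInv (q : ℝˣ) : Module.End ℂ Lattice where
  toFun f i j := ((q : ℝ) : ℂ) ^ (-i) * f i (j + 1)
  map_add' f g := by ext i j; simp [mul_add]
  map_smul' r f := by ext i j; simp [mul_left_comm]

/-- The operator `(1 + κ q⁻¹ y²) d⁻¹`. -/
def cornerOp (q : ℝˣ) (κ : ℂ) : Module.End ℂ Lattice :=
  (1 + (κ * ((q : ℝ) : ℂ)⁻¹) • (shiftFst * shiftFst)) * shiftSndInv q

variable (q : ℝˣ) (κ : ℂ)

lemma cornerOp_apply (f : Lattice) (i j : ℤ) : cornerOp q κ f i j =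
    ((q : ℝ) : ℂ) ^ (-i) * f i (j + 1) +
      κ * ((q : ℝ) : ℂ)⁻¹ * (((q : ℝ) : ℂ) ^ (-(i - 1 - 1)) * f (i - 1 - 1) (j + 1)) := rfl

lemma shiftSnd_mul_shiftFst :
    shiftSnd q * shiftFst = ((q : ℝ) : ℂ) • (shiftFst * shiftSnd q) := by
  ext f i j
  change ((q : ℝ) : ℂ) ^ i * f (i - 1) (j - 1) =
    ((q : ℝ) : ℂ) * (((q : ℝ) : ℂ) ^ (i - 1) * f (i - 1) (j - 1))
  rw [zpow_sub_one₀ (q_ne q)]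
  have := q_ne q
  field_simp

lemma shiftFst_mul_cornerOp :
    shiftFst * cornerOp q κ = ((q : ℝ) : ℂ) • (cornerOp q κ * shiftFst) := by
  ext f i j
  change cornerOp q κ f (i - 1) j = ((q : ℝ) : ℂ) * cornerOp q κ (shiftFst f) i j
  rw [cornerOp_apply, cornerOp_apply]
  change _ = ((q : ℝ) : ℂ) * (((q : ℝ) : ℂ) ^ (-i) * f (i - 1) (j + 1) +
    κ * ((q : ℝ) : ℂ)⁻¹ * (((q : ℝ) : ℂ) ^ (-(i - 1 - 1)) * f (i - 1 - 1 - 1) (j + 1)))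
  have hq := q_ne q
  rw [show -(i - 1) = -i + 1 by ring, show -(i - 1 - 1 - 1) = -(i - 1 - 1) + 1 by ring,
    zpow_add_one₀ hq, zpow_add_one₀ hq]
  ring

/-- With κ = 1 this and the reversed product are the relations of `isFRT_two`; with κ = 0 the two
operators are inverse to each other, as U_q(1) requires. -/
lemma cornerOp_mul_shiftSnd : cornerOp q κ * shiftSnd q =
    1 + (κ * ((q : ℝ) : ℂ)⁻¹) • (shiftFst * shiftFst) := by
  have hq := q_ne q
  have : shiftSndInv q * shiftSnd q = 1 := by
    ext f i j
    change ((q : ℝ) : ℂ) ^ (-i) * (((q : ℝ) : ℂ) ^ i * f i (j + 1 - 1)) = f i j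
    rw [← mul_assoc, ← zpow_add₀ hq, neg_add_cancel, zpow_zero, one_mul, add_sub_cancel_right]
  rw [cornerOp, mul_assoc, this, mul_one]

lemma shiftSnd_mul_cornerOp : shiftSnd q * cornerOp q κ =
    1 + (κ * ((q : ℝ) : ℂ)) • (shiftFst * shiftFst) := by
  have hq := q_ne q
  have h1 : shiftSnd q * shiftSndInv q = 1 := by
    ext f i j
    change ((q : ℝ) : ℂ) ^ i * (((q : ℝ) : ℂ) ^ (-i) * f i (j - 1 + 1)) = f i j
    rw [← mul_assoc, ← zpow_add₀ hq, add_neg_cancel, zpow_zero, one_mul, sub_add_cancel]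
  have h2 : shiftSnd q * (shiftFst * shiftFst) =
      (((q : ℝ) : ℂ) * ((q : ℝ) : ℂ)) • (shiftFst * shiftFst * shiftSnd q) := by
    rw [← mul_assoc, shiftSnd_mul_shiftFst, smul_mul_assoc, mul_assoc, shiftSnd_mul_shiftFst,
      mul_smul_comm, smul_smul, mul_assoc]
  have h3 : shiftSnd q * (1 + (κ * ((q : ℝ) : ℂ)⁻¹) • (shiftFst * shiftFst)) =
      (1 + (κ * ((q : ℝ) : ℂ)) • (shiftFst * shiftFst)) * shiftSnd q := by
    rw [mul_add, mul_one, mul_smul_comm, h2, smul_smul, add_mul, one_mul, smul_mul_assoc]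
    congr 2
    field_simp
  rw [cornerOp, ← mul_assoc, h3, mul_assoc, h1, mul_one]

/-- The function `f` vanishes on the columns below `D`, and is a nonzero multiple of the
delta function at `δ` on the column `D`. -/
def HasLead (f : Lattice) (D δ : ℤ) : Prop :=
  (∀ i j, i < D → f i j = 0) ∧ ∃ r : ℂ, r ≠ 0 ∧ ∀ j, f D j = if j = δ then r else 0

lemma HasLead.shiftFst {f : Lattice} {D δ : ℤ} (h : HasLead f D δ) :
    HasLead (shiftFst f) (D + 1) δ := by
  obtain ⟨h1, r, hr, h2⟩ := h
  refine ⟨fun i j hi => h1 _ _ (by omega), r, hr, fun j => ?_⟩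
  change f (D + 1 - 1) j = _
  rw [add_sub_cancel_right, h2]

lemma HasLead.shiftSnd {f : Lattice} {D δ : ℤ} (h : HasLead f D δ) :
    HasLead (shiftSnd q f) D (δ + 1) := by
  obtain ⟨h1, r, hr, h2⟩ := h
  refine ⟨fun i j hi => ?_, _, mul_ne_zero (zpow_ne_zero D (q_ne q)) hr, fun j => ?_⟩
  · change _ * f i (j - 1) = 0
    rw [h1 _ _ hi, mul_zero]
  · change _ * f D (j - 1) = _
    rw [h2, mul_ite, mul_zero]
    simp only [sub_eq_iff_eq_add]

lemma HasLead.cornerOp {f : Lattice} {D δ : ℤ} (h : HasLead f D δ) :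
    HasLead (cornerOp q κ f) D (δ - 1) := by
  obtain ⟨h1, r, hr, h2⟩ := h
  refine ⟨fun i j hi => ?_, _, mul_ne_zero (zpow_ne_zero (-D) (q_ne q)) hr, fun j => ?_⟩
  · rw [cornerOp_apply, h1 _ _ hi, h1 _ _ (by omega)]
    simp
  · rw [cornerOp_apply, h1 (D - 1 - 1) _ (by omega), h2, mul_zero, mul_zero, add_zero, mul_ite,
      mul_zero]
    simp only [eq_sub_iff_add_eq]

/-- `shiftFst` raises the leading column by one, `shiftSnd` and `cornerOp` move the leading point by
1 and -1 within its column. The κ-term of `cornerOp` only reaches later columns. -/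
lemma hasLead_word (D a b : ℕ) :
    HasLead ((QuantumProjective.shiftFst ^ D *
      (QuantumProjective.cornerOp q κ ^ a * QuantumProjective.shiftSnd q ^ b))
      (fun i j => if i = 0 ∧ j = 0 then 1 else 0)) D (b - a) := by
  induction D with
  | zero =>
    rw [pow_zero, one_mul]
    induction a with
    | zero =>
      rw [pow_zero, one_mul]
      induction b with
      | zero => exact ⟨fun i j hi => if_neg (by simp at hi; omega), 1, one_ne_zero, by simp⟩
      | succ b ih =>
        rw [pow_succ', show ((b + 1 : ℕ) : ℤ) - (0 : ℕ) = b - (0 : ℕ) + 1 by push_cast; ring]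
        exact ih.shiftSnd q
    | succ a ih =>
      rw [pow_succ', mul_assoc, show (b : ℤ) - (a + 1 : ℕ) = b - a - 1 by push_cast; ring]
      exact ih.cornerOp q κ
  | succ D ih =>
    rw [pow_succ', mul_assoc, Nat.cast_succ]
    exact ih.shiftFst

end torus

/-! ### Linear independence of ordered monomials in a representation. -/

section independence

variable {A : Type*} [Ring A] [Algebra ℂ A]

/-- The ordered monomials of degrees `D` and `D + 1` are linearly independent. -/
def HasIndependentMonomials {n : ℕ} (v x : Fin n → A) : Prop :=
  ∀ (D : ℕ) (s : Finset (Fin n → ℕ × ℕ)) (c : (Fin n → ℕ × ℕ) → ℂ),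
    (∀ e ∈ s, expDegree e = D ∨ expDegree e = D + 1) →
    ∑ e ∈ s, c e • orderedMonomial v x e = 0 → ∀ e ∈ s, c e = 0

/-- Every generator carries one factor y, so the first tensor leg records the total degree. -/
lemma orderedMonomial_tmul {n : ℕ} (v x : Fin n → A) (y : Module.End ℂ Lattice) {k : ℂ}
    (hk : k ≠ 0) (e : Fin n → ℕ × ℕ) : ∃ r : ℂ, r ≠ 0 ∧
      orderedMonomial (fun i => y ⊗ₜ[ℂ] (k • v i)) (fun i => y ⊗ₜ[ℂ] x i) e =
        r • ((y ^ expDegree e) ⊗ₜ[ℂ] orderedMonomial v x e) := by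
  induction n with
  | zero => exact ⟨1, one_ne_zero, by simp [orderedMonomial, expDegree, Algebra.TensorProduct.one_def]⟩
  | succ n ih =>
    obtain ⟨r, hr, h⟩ := ih (Fin.init v) (Fin.init x) (Fin.init e)
    refine ⟨r * k ^ (e (Fin.last n)).1, mul_ne_zero hr (pow_ne_zero _ hk), ?_⟩
    have h' : orderedMonomial (Fin.init fun i => y ⊗ₜ[ℂ] (k • v i))
      (Fin.init fun i => y ⊗ₜ[ℂ] x i) (Fin.init e) = _ := h
    rw [orderedMonomial, h', orderedMonomial, expDegree_succ]
    simp only [Algebra.TensorProduct.tmul_pow, Algebra.TensorProduct.tmul_mul_tmul, smul_pow,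
      TensorProduct.tmul_smul, smul_mul_assoc, mul_smul_comm, smul_smul, pow_add]
    rw [mul_comm (k ^ _) r]

/-- The first tensor leg of a monomial is y^i times powers of the last pair, with i the degree in
the other variables. Reading off its leading coefficient at the smallest i isolates monomials with
one fixed power of the last pair, and the hypothesis applies to what remains. -/
lemma HasIndependentMonomials.step {q : ℝˣ} {n : ℕ} {v x : Fin n → A}
    (h : HasIndependentMonomials v x) (κ : ℂ) {k : ℂ} (hk : k ≠ 0) :
    HasIndependentMonomials (A := Module.End ℂ Lattice ⊗[ℂ] A)
      (Fin.snoc (α := fun _ => Module.End ℂ Lattice ⊗[ℂ] A)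
        (fun i => shiftFst ⊗ₜ[ℂ] (k • v i)) (cornerOp q κ ⊗ₜ[ℂ] 1))
      (Fin.snoc (α := fun _ => Module.End ℂ Lattice ⊗[ℂ] A)
        (fun i => shiftFst ⊗ₜ[ℂ] x i) (shiftSnd q ⊗ₜ[ℂ] 1)) := by
  intro D s c hs hsum
  by_contra! hex
  set V := Fin.snoc (α := fun _ => Module.End ℂ Lattice ⊗[ℂ] A)
        (fun i => shiftFst ⊗ₜ[ℂ] (k • v i)) (cornerOp q κ ⊗ₜ[ℂ] 1)
  set X := Fin.snoc (α := fun _ => Module.End ℂ Lattice ⊗[ℂ] A)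
        (fun i => shiftFst ⊗ₜ[ℂ] x i) (shiftSnd q ⊗ₜ[ℂ] 1)
  have hmono : ∀ e : Fin (n + 1) → ℕ × ℕ, ∃ r : ℂ, r ≠ 0 ∧ orderedMonomial V X e =
      r • ((shiftFst ^ expDegree (Fin.init e) * (cornerOp q κ ^ (e (Fin.last n)).1 *
        shiftSnd q ^ (e (Fin.last n)).2)) ⊗ₜ[ℂ] orderedMonomial v x (Fin.init e)) := by
    intro e
    obtain ⟨r, hr, h⟩ := orderedMonomial_tmul v x shiftFst hk (Fin.init e)
    refine ⟨r, hr, ?_⟩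
    rw [orderedMonomial]
    simp only [V, X, Fin.init_snoc, Fin.snoc_last, h, Algebra.TensorProduct.tmul_pow,
      Algebra.TensorProduct.tmul_mul_tmul, one_pow, mul_one, smul_mul_assoc]
  choose r hr hmono using hmono
  let s0 := s.filter fun e => c e ≠ 0
  have hs0 : s0.Nonempty := by
    obtain ⟨e, he, hc⟩ := hex
    exact ⟨e, by simp [s0, he, hc]⟩
  obtain ⟨e0, he0, hmin⟩ := s0.exists_min_image (fun e => expDegree (Fin.init e)) hs0
  set i := expDegree (Fin.init e0) with hi
  let δ : Lattice := fun i j => if i = 0 ∧ j = 0 then 1 else 0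
  -- Evaluates an operator on the delta function, at the leading point of the monomial `e0`.
  let ev : Module.End ℂ Lattice →ₗ[ℂ] ℂ :=
    { toFun := fun T => T δ i ((e0 (Fin.last n)).2 - (e0 (Fin.last n)).1)
      map_add' := fun _ _ => rfl
      map_smul' := fun _ _ => rfl }
  let F : Module.End ℂ Lattice ⊗[ℂ] A →ₗ[ℂ] A := (TensorProduct.lid ℂ A).toLinearMap ∘ₗ ev.rTensor A
  let g : (Fin (n + 1) → ℕ × ℕ) → ℂ := fun e => ev (shiftFst ^ expDegree (Fin.init e) *
    (cornerOp q κ ^ (e (Fin.last n)).1 * shiftSnd q ^ (e (Fin.last n)).2))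
  have hF : ∀ e, F (orderedMonomial V X e) = (r e * g e) • orderedMonomial v x (Fin.init e) := by
    intro e
    rw [hmono, map_smul, mul_smul]
    rfl
  have hg0 : ∀ e ∈ s0, ¬ (expDegree (Fin.init e) = i ∧ e (Fin.last n) = e0 (Fin.last n)) →
      g e = 0 := by
    intro e he hne
    obtain ⟨h1, r', -, h2⟩ := hasLead_word q κ (expDegree (Fin.init e)) (e (Fin.last n)).1
      (e (Fin.last n)).2
    rcases (hmin e he).lt_or_eq with hlt | heq
    · exact h1 _ _ (by exact_mod_cast hlt)
    · have h3 := h2 ((e0 (Fin.last n)).2 - (e0 (Fin.last n)).1)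
      rw [if_neg] at h3
      · simp only [g]
        rw [← heq] at h3 ⊢
        exact h3
      -- Equal i and equal b - a, with total degree D or D + 1: the sums a + b differ by at most one
      -- and have the same parity, so the exponents agree. This is why only two consecutive degrees
      -- are allowed.
      · intro hδ
        refine hne ⟨heq.symm, ?_⟩
        have d1 := hs e (Finset.mem_filter.mp he).1
        have d2 := hs e0 (Finset.mem_filter.mp he0).1
        rw [expDegree_succ] at d1 d2
        exact Prod.ext (by omega) (by omega)
  have hg1 : ∀ e, expDegree (Fin.init e) = i → e (Fin.last n) = e0 (Fin.last n) → g e ≠ 0 := by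
    intro e h1 h2
    obtain ⟨-, r', hr', h3⟩ := hasLead_word q κ (expDegree (Fin.init e)) (e (Fin.last n)).1
      (e (Fin.last n)).2
    have := h3 ((e0 (Fin.last n)).2 - (e0 (Fin.last n)).1)
    rw [if_pos (by rw [h2])] at this
    have h4 : g e = r' := by
      rw [← this]
      simp only [g]
      rw [h1]
      rfl
    rw [h4]
    exact hr'
  let t := s0.filter fun e => expDegree (Fin.init e) = i ∧ e (Fin.last n) = e0 (Fin.last n)
  have hinj : Set.InjOn Fin.init (t : Set (Fin (n + 1) → ℕ × ℕ)) := by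
    intro e he e' he' hee
    rw [← Fin.snoc_init_self e, ← Fin.snoc_init_self e', hee, (Finset.mem_filter.mp he).2.2,
      (Finset.mem_filter.mp he').2.2]
  let ext : (Fin n → ℕ × ℕ) → (Fin (n + 1) → ℕ × ℕ) := fun e =>
    Fin.snoc (α := fun _ => ℕ × ℕ) e (e0 (Fin.last n))
  have hext : ∀ e ∈ t, ext (Fin.init e) = e := by
    intro e he
    simp only [ext]
    rw [← (Finset.mem_filter.mp he).2.2, Fin.snoc_init_self]
  have hsum' : ∑ e ∈ t.image Fin.init, (c (ext e) * (r (ext e) * g (ext e))) •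
      orderedMonomial v x e = 0 := by
    rw [Finset.sum_image hinj]
    have e1 : ∑ e ∈ s, c e • orderedMonomial V X e = ∑ e ∈ s0, c e • orderedMonomial V X e := by
      exact (Finset.sum_filter_of_ne (p := fun e => c e ≠ 0) fun e _ he hc =>
        he (by rw [hc, zero_smul])).symm
    rw [e1] at hsum
    have e2 := congrArg F hsum
    rw [map_sum, map_zero] at e2
    rw [← e2]
    rw [Finset.sum_filter]
    refine Finset.sum_congr rfl fun e he => ?_
    split_ifs with hc
    · rw [hext e (Finset.mem_filter.mpr ⟨he, hc⟩), map_smul, hF, mul_smul]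
    · rw [map_smul, hF, hg0 e he hc, mul_zero, zero_smul, smul_zero]
  have he0t : e0 ∈ t := Finset.mem_filter.mpr ⟨he0, rfl, rfl⟩
  have := h i (t.image Fin.init) _ (by
    intro e he
    obtain ⟨e', he', rfl⟩ := Finset.mem_image.mp he
    exact Or.inl (Finset.mem_filter.mp he').2.1) hsum' (Fin.init e0)
    (Finset.mem_image_of_mem _ he0t)
  rw [hext e0 he0t] at this
  exact mul_ne_zero (Finset.mem_filter.mp he0).2 (mul_ne_zero (hr e0) (hg1 e0 rfl rfl)) this

lemma hasIndependentMonomials_zero (v x : Fin 0 → ℂ) : HasIndependentMonomials v x := by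
  intro D s c _ hsum e he
  have : s = {e} := by
    ext e'
    simp [Subsingleton.elim e' e, he]
  rw [this, Finset.sum_singleton] at hsum
  simpa [orderedMonomial] using hsum

/-- The product of a 2 × 2 block in the last two coordinates with diag(t, 1) has last row (y ⊗
t^{N-1}_i, d ⊗ 1), and similarly for s, which is the pattern of `HasIndependentMonomials.step`. -/
lemma exists_isFRT_independent (q : ℝˣ) (n : ℕ) : ∃ (A : Type) (_ : Ring A) (_ : Algebra ℂ A)
    (t s : Fin (n + 1) → Fin (n + 1) → A), IsFRT q t s ∧
      HasIndependentMonomials (fun i => s i (Fin.last n)) (fun i => t (Fin.last n) i) := by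
  induction n with
  | zero =>
    have hsub : ∀ i j : Fin (0 + 1), i = j := fun i j => Subsingleton.elim (α := Fin 1) i j
    refine ⟨Module.End ℂ Lattice ⊗[ℂ] ℂ, inferInstance, inferInstance,
      fun _ _ => shiftSnd q ⊗ₜ 1, fun _ _ => cornerOp q 0 ⊗ₜ 1, ⟨?_, ?_, ?_⟩, ?_⟩
    · rw [rtt_iff]
      intro a b e f
      simp [hsub a b, hsub e f]
    · intro i j
      simp [hsub i j, shiftSnd_mul_cornerOp, Algebra.TensorProduct.one_def]
    · intro i j
      simp [hsub i j, cornerOp_mul_shiftSnd, Algebra.TensorProduct.one_def]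
    · convert (hasIndependentMonomials_zero Fin.elim0 Fin.elim0).step (q := q) 0
        (one_ne_zero (α := ℂ)) using 1
      · ext i
        rw [hsub i (Fin.last 0), Fin.snoc_last]
      · ext i
        rw [hsub i (Fin.last 0), Fin.snoc_last]
  | succ n ih =>
    obtain ⟨A, _, _, t, s, hts, hind⟩ := ih
    have hM := isFRT_two (A := Module.End ℂ Lattice) q (a := cornerOp q 1) (y := shiftFst)
      (d := shiftSnd q) (shiftFst_mul_cornerOp q 1) (shiftSnd_mul_shiftFst q)
      (by rw [cornerOp_mul_shiftSnd, one_mul]) (by rw [shiftSnd_mul_cornerOp, one_mul])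
    refine ⟨Module.End ℂ Lattice ⊗[ℂ] A, inferInstance, inferInstance, _, _,
      (hM.blockLast n).tensor hts.extendLast, ?_⟩
    -- The scalar -q is the coefficient of y in the last column of the inverse block.
    convert hind.step (q := q) 1 (neg_ne_zero.mpr (q_ne q)) using 1
    · ext i
      rw [Fin.sum_univ_castSucc, Fin.sum_univ_castSucc]
      simp only [blockLast_castSucc_last, blockLast_last_last, blockLast_prev_last,
        TensorProduct.zero_tmul, Finset.sum_const_zero, zero_add]
      cases i using Fin.lastCases with
      | last => simp
      | cast i => simp [TensorProduct.smul_tmul, TensorProduct.neg_tmul, TensorProduct.tmul_neg, -Complex.coe_smul]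
    · ext i
      rw [Fin.sum_univ_castSucc, Fin.sum_univ_castSucc]
      simp only [blockLast_last_castSucc, blockLast_last_last, blockLast_last_prev,
        TensorProduct.zero_tmul, Finset.sum_const_zero, zero_add]
      cases i using Fin.lastCases with
      | last => simp
      | cast i => simp

end independence

/-- An element of the kernel is a combination of ordered monomials of two consecutive degrees; its
image in the representation is zero, and independence there makes all coefficients vanish. -/
lemma sphereMap_injective (q : ℝˣ) (n : ℕ) : Function.Injective (sphereMap q n) := by
  rw [injective_iff_map_eq_zero]
  intro u hu
  obtain ⟨A, _, _, t, s, hts, hind⟩ := exists_isFRT_independent q n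
  let f : Sphere q (n + 1) →ₐ[ℂ] A := (Uq.lift hts).comp (sphereMap q n).toAlgHom
  have hf : f u = 0 := by
    change Uq.lift hts (sphereMap q n u) = 0
    rw [hu, map_zero]
  have hfv : f ∘ Sphere.v q = fun i => s i (Fin.last n) := by
    ext i
    change Uq.lift hts (sphereMap q n (Sphere.v q i)) = _
    rw [sphereMap_v, Uq.lift_s]
  have hfx : f ∘ Sphere.x q = fun i => t (Fin.last n) i := by
    ext i
    change Uq.lift hts (sphereMap q n (Sphere.x q i)) = _
    rw [sphereMap_x, Uq.lift_t]
  obtain ⟨D, hD⟩ := exists_orderedMonomial_span q (n + 1) u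
  have himg : {y | ∃ e, (expDegree e = D ∨ expDegree e = D + 1) ∧
      y = orderedMonomial (Sphere.v q) (Sphere.x q) e} =
      orderedMonomial (Sphere.v q (n := n + 1)) (Sphere.x q) ''
        {e | expDegree e = D ∨ expDegree e = D + 1} := by
    ext y
    simp only [Set.mem_ofPred_eq, Set.mem_image, eq_comm]
  rw [himg, Finsupp.mem_span_image_iff_linearCombination] at hD
  obtain ⟨l, hl, rfl⟩ := hD
  rw [Finsupp.mem_supported] at hl
  rw [Finsupp.linearCombination_apply, Finsupp.sum, map_sum] at hf
  simp only [map_smul, map_orderedMonomial, hfv, hfx] at hf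
  have : l = 0 := by
    ext e
    by_contra he
    exact he (hind D l.support l (fun e he => hl he) hf e (Finsupp.mem_support_iff.mpr he))
  rw [this, map_zero]

/-! ### Complex projective quantum space as the base -/

section base

variable (q : ℝˣ) (n : ℕ)

lemma circleCoaction_x {n : ℕ} (i : Fin n) :
    circleCoaction q n (Sphere.x q i) = Sphere.x q i ⊗ₜ Uq.t q 0 0 :=
  Sphere.lift_x ((Sphere.isSphere q n).tensor (z_mul_star q) (star_mul_z q)) i

lemma circleCoaction_v {n : ℕ} (i : Fin n) :
    circleCoaction q n (Sphere.v q i) = Sphere.v q i ⊗ₜ Uq.s q 0 0 :=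
  Sphere.lift_v ((Sphere.isSphere q n).tensor (z_mul_star q) (star_mul_z q)) i

/-- Equivariance of ι, up to the flip from a right to a left coaction: U_q(n) does not act on the
last row, and U_q(1) acts by the phase z. -/
lemma coaction_sphereMap (u : Sphere q (n + 1)) : Uq.coaction q n (sphereMap q n u) =
    Algebra.TensorProduct.map
      (Algebra.TensorProduct.includeLeft : Uq q 1 →ₐ[ℂ] Uq q 1 ⊗[ℂ] Uq q n)
      (sphereMap q n).toAlgHom
      (Algebra.TensorProduct.comm ℂ _ _ (circleCoaction q (n + 1) u)) := by
  induction u using Sphere.induction with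
  | halg r => simp only [AlgHomClass.commutes]
  | hv i =>
    rw [circleCoaction_v, sphereMap_v, Algebra.TensorProduct.comm_tmul,
      Algebra.TensorProduct.map_tmul]
    change (Uq.coaction q n).toAlgHom _ = _ ⊗ₜ sphereMap q n (Sphere.v q i)
    rw [Uq.coaction_s, Fin.sum_univ_castSucc]
    simp [Uq.alphaOne_s]
  | hx i =>
    rw [circleCoaction_x, sphereMap_x, Algebra.TensorProduct.comm_tmul,
      Algebra.TensorProduct.map_tmul]
    change (Uq.coaction q n).toAlgHom _ = _ ⊗ₜ sphereMap q n (Sphere.x q i)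
    rw [Uq.coaction_t, Fin.sum_univ_castSucc]
    simp
  | hmul a b ha hb => simp only [map_mul, ha, hb]
  | hadd a b ha hb => simp only [map_add, ha, hb]

lemma mem_projSpace {n : ℕ} {u : Sphere q n} :
    u ∈ ProjSpace q n ↔ circleCoaction q n u = u ⊗ₜ 1 := Iff.rfl

lemma sphereMap_mem_invariants {u : Sphere q (n + 1)} (hu : u ∈ ProjSpace q (n + 1)) :
    sphereMap q n u ∈ Uq.invariants q n := by
  change Uq.coaction q n (sphereMap q n u) = 1 ⊗ₜ sphereMap q n u
  rw [coaction_sphereMap, (mem_projSpace q).mp hu, Algebra.TensorProduct.comm_tmul,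
    Algebra.TensorProduct.map_tmul, map_one]
  rfl

lemma v_mul_x_mem_projSpace {n : ℕ} (i j : Fin n) :
    Sphere.v q i * Sphere.x q j ∈ ProjSpace q n := by
  rw [mem_projSpace, map_mul, circleCoaction_v, circleCoaction_x,
    Algebra.TensorProduct.tmul_mul_tmul, star_mul_z]

/-- Generators of CP_q need not be known: it contains the products v^i x_j, whose images generate
the algebra of invariants. -/
lemma exists_projSpace_of_mem_invariants {w : Uq q (n + 1)} (hw : w ∈ Uq.invariants q n) :
    ∃ u ∈ ProjSpace q (n + 1), sphereMap q n u = w := by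
  have hle : Uq.projAlgebra q n ≤
      (ProjSpace q (n + 1)).toSubalgebra.map (sphereMap q n).toAlgHom := by
    refine Algebra.adjoin_le ?_
    rintro _ ⟨i, j, rfl⟩
    exact ⟨_, v_mul_x_mem_projSpace q i j, (map_mul (sphereMap q n) _ _).trans (by simp)⟩
  have hw' : w ∈ (Uq.invariants q n).toSubalgebra := hw
  rw [Uq.invariants_eq_projAlgebra] at hw'
  exact hle hw'

/-- The restriction of `ι` to complex projective quantum space. -/
def projMap : ProjSpace q (n + 1) →⋆ₐ[ℂ] Uq.invariants q n :=
  StarAlgHom.codRestrict ((sphereMap q n).comp (ProjSpace q (n + 1)).subtype) (Uq.invariants q n)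
    fun u => sphereMap_mem_invariants q n u.2

lemma projMap_bijective : Function.Bijective (projMap q n) := by
  refine ⟨fun u v huv => Subtype.ext (sphereMap_injective q n (congrArg Subtype.val huv)),
    fun w => ?_⟩
  obtain ⟨u, hu, h⟩ := exists_projSpace_of_mem_invariants q n w.2
  exact ⟨⟨u, hu⟩, Subtype.ext h⟩

end base

end QuantumProjective

end

/-- The size n ≥ 1 of the statement in words is `n + 1` here, and the last index is `Fin.last n`. -/
theorem theorem3p4 (q : ℝˣ) (n : ℕ) :
    IsQuantumPrincipalBundle (A := Uq q 1 ⊗[ℂ] Uq q n) (P := Uq q (n + 1))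
      (Uq.coaction q n).toAlgHom (Uq.invariants q n).toSubalgebra ∧
    ∃ (ι : Sphere q (n + 1) →⋆ₐ[ℂ] Uq q (n + 1))
      (e : ProjSpace q (n + 1) ≃⋆ₐ[ℂ] Uq.invariants q n),
      (∀ a, ι (Sphere.x q a) = Uq.t q (Fin.last n) a) ∧
      ∀ u : ProjSpace q (n + 1), (e u : Uq q (n + 1)) = ι u :=
  ⟨Uq.isQuantumPrincipalBundle q n, sphereMap q n,
    StarAlgEquiv.ofBijective (projMap q n) (projMap_bijective q n), sphereMap_x q n,
    fun _ => rfl⟩
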